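/- Let $\Bbbk$ be a commutative ring and $n\ge 0$. Let $W=\mathcal S_n$ with simple reflections $S=\{s_1,\dots,s_{n-1}\}$, $s_j=(j\ \,j+1)$, and length function $\ell$. For $J\subseteq S$ let $W_J$ be the parabolic subgroup generated by $J$ and $w_J$ its longest element. An $(I,J)$-coset is an element $p$ of $W_I\backslash W/W_J$; $\overline p$ denotes its longest element. Let $*$ be the product on $W$ of the Coxeter monoid ($s*s=s$ for $s\in S$, and $x*y=xy$ if $\ell(xy)=\ell(x)+\ell(y)$). For an $(I,J)$-coset $p$ and a $(J,K)$-coset $q$, let $p*q$ be the $(I,K)$-coset containing $\overline p*\overline q$. It is called reduced if $\overline p*\overline q=(\overline p w_J^{-1})\,\overline q=\overline p\,(w_J^{-1}\overline q)$, with lengths adding up in both of the latter products. The nilCoxeter algebroid $\mathcal D(\mathcal S_n)$ is the $\Bbbk$-linear category whose objects are the subsets of $S$, in which $\mathrm{Hom}(J,I)$ is the free $\Bbbk$-module on symbols $\partial_p$, one for each $(I,J)$-coset $p$, and $\partial_p\circ\partial_q=\partial_{p*q}$ if $p*q$ is reduced, $\partial_p\circ\partial_q=0$ otherwise. An $(I,J)$-coset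 is atomic if there are $M\subseteq S$ and $s\in M$ such that, with $t=w_Msw_M$, one has $I=M\setminus\{s\}$, $J=M\setminus\{t\}$ and the coset contains $w_M$. Let $\mathcal{AD}(\mathcal S_n)$ be the $\Bbbk$-linear subcategory of $\mathcal D(\mathcal S_n)$ with the same objects that is generated by the $\partial_p$ with $p$ atomic. For $J\subseteq S$ with $S\setminus J=\{d_1<\dots<d_\ell\}$ (ordered by index) and $1\le i\le\ell$, let $s=d_i$, $M=J\cup\{s\}$, $t=w_Msw_M$, and let $\mathtt a_i^J$ be the atomic $(M\setminus\{t\},J)$-coset containing $w_M$. The labeled nilCoxeter algebroid $\mathcal{NC}(n)$ is the $\Bbbk$-linear category presented as follows. Its objects are the compositions $(n_1,\dots,n_k)$ of $n$ into positive parts. A composition is identified with the set $J\subseteq S$ of those $s_j$ for which $j$ and $j+1$ lie in the same block, so that $W_J=\mathcal S_{n_1}\times\dots\times\mathcal S_{n_k}$. The generating morphisms are the crossings $$\partial_i^J:(n_1,\dots,n_i,n_{i+1},\dots,n_k)\to(n_1,\dots,n_{i+1},n_i,\dots,n_k),\qquad 1\le i\le k-1,$$ where $J$ corresponds to the source. The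 relations, for every source $J$ (the remaining superscripts being determined), are $$\partial_i\partial_{i+1}\partial_i^J=\partial_{i+1}\partial_i\partial_{i+1}^J\ (1\le i\le k-2),\qquad \partial_i\partial_j^J=\partial_j\partial_i^J\ (|i-j|>1),\qquad \partial_i\partial_i^J=0\ (1\le i\le k-1).$$ Then there is an isomorphism of $\Bbbk$-linear categories (a $\Bbbk$-linear functor that is bijective on objects and on all morphism spaces) $$\psi:\mathcal{NC}(n)\xrightarrow{\ \sim\ }\mathcal{AD}(\mathcal S_n)$$ that sends each composition to the corresponding subset $J\subseteq S$ and satisfies $\psi(\partial_i^J)=\partial_{\mathtt a_i^J}$ for all $J$ and $i$. -/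

import Mathlib

open CategoryTheory

universe u v

/-! ## Linear categories presented by generators and relations -/

/-- Objects of the `R`-linear category presented by the quiver `V` of generating morphisms, with
the elements of `rel a b` (linear combinations of paths from `a` to `b`) imposed to vanish. -/
structure Presented (R : Type u) [CommRing R] (V : Type) [Quiver.{0} V]
    (rel : ∀ a b : V, Set (Quiver.Path a b →₀ R)) where
  vertex : V

namespace Presented

noncomputable section

variable {R : Type u} [CommRing R] {V : Type} [Quiver.{0} V]

/-- Bilinear concatenation of linear combinations of paths. -/
def pathComp (R : Type u) [CommRing R] {V : Type} [Quiver.{0} V] (a b c : V) :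
    (Quiver.Path a b →₀ R) →ₗ[R] (Quiver.Path b c →₀ R) →ₗ[R] (Quiver.Path a c →₀ R) :=
  Finsupp.linearCombination R fun p =>
    Finsupp.linearCombination R fun q => Finsupp.single (p.comp q) (1 : R)

lemma pathComp_single {a b c : V} (p : Quiver.Path a b) (q : Quiver.Path b c) :
    pathComp R a b c (Finsupp.single p 1) (Finsupp.single q 1) = Finsupp.single (p.comp q) 1 := by
  simp [pathComp]

lemma pathComp_assoc {a b c d : V} (f : Quiver.Path a b →₀ R) (g : Quiver.Path b c →₀ R)
    (h : Quiver.Path c d →₀ R) :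
    pathComp R a c d (pathComp R a b c f g) h = pathComp R a b d f (pathComp R b c d g h) := by
  induction f using Finsupp.induction_linear with
  | zero => simp
  | add f₁ f₂ h₁ h₂ => simp [h₁, h₂]
  | single p r =>
    induction g using Finsupp.induction_linear with
    | zero => simp
    | add f₁ f₂ h₁ h₂ => simp only [map_add, LinearMap.add_apply, h₁, h₂]
    | single q s =>
      induction h using Finsupp.induction_linear with
      | zero => simp
      | add f₁ f₂ h₁ h₂ => simp only [map_add, h₁, h₂]
      | single q' s' =>
        simp only [pathComp, Finsupp.linearCombination_single, LinearMap.smul_apply,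
          Finsupp.smul_single, smul_eq_mul, mul_one, mul_assoc, Quiver.Path.comp_assoc]

lemma pathComp_nil_left {a b : V} (f : Quiver.Path a b →₀ R) :
    pathComp R a a b (Finsupp.single Quiver.Path.nil 1) f = f := by
  induction f using Finsupp.induction_linear with
  | zero => simp
  | add f₁ f₂ h₁ h₂ => simp [h₁, h₂]
  | single p r => simp [pathComp]

lemma pathComp_nil_right {a b : V} (f : Quiver.Path a b →₀ R) :
    pathComp R a b b f (Finsupp.single Quiver.Path.nil 1) = f := by
  induction f using Finsupp.induction_linear with
  | zero => simp
  | add f₁ f₂ h₁ h₂ => simp [h₁, h₂]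
  | single p r => simp [pathComp]

/-- The two-sided ideal generated by the relators. -/
def ideal (rel : ∀ a b : V, Set (Quiver.Path a b →₀ R)) (a b : V) :
    Submodule R (Quiver.Path a b →₀ R) :=
  Submodule.span R {x | ∃ (c d : V) (f : Quiver.Path a c →₀ R) (y : Quiver.Path c d →₀ R)
    (g : Quiver.Path d b →₀ R), y ∈ rel c d ∧
      x = pathComp R a d b (pathComp R a c d f y) g}

variable {rel : ∀ a b : V, Set (Quiver.Path a b →₀ R)}

lemma comp_mem_ideal_left {a b c : V} (f : Quiver.Path a b →₀ R) {g : Quiver.Path b c →₀ R}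
    (hg : g ∈ ideal rel b c) : pathComp R a b c f g ∈ ideal rel a c := by
  induction hg using Submodule.span_induction with
  | mem x hx =>
    obtain ⟨c', d', k, y, l, hy, rfl⟩ := hx
    refine Submodule.subset_span ⟨c', d', pathComp R _ _ _ f k, y, l, hy, ?_⟩
    simp only [pathComp_assoc]
  | zero => simp
  | add x y _ _ hx hy => rw [map_add]; exact Submodule.add_mem _ hx hy
  | smul r x _ hx => rw [map_smul]; exact Submodule.smul_mem _ _ hx

lemma comp_mem_ideal_right {a b c : V} {f : Quiver.Path a b →₀ R} (g : Quiver.Path b c →₀ R)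
    (hf : f ∈ ideal rel a b) : pathComp R a b c f g ∈ ideal rel a c := by
  induction hf using Submodule.span_induction with
  | mem x hx =>
    obtain ⟨c', d', k, y, l, hy, rfl⟩ := hx
    refine Submodule.subset_span ⟨c', d', k, y, pathComp R _ _ _ l g, hy, ?_⟩
    simp only [pathComp_assoc]
  | zero => simp
  | add x y _ _ hx hy => rw [map_add, LinearMap.add_apply]; exact Submodule.add_mem _ hx hy
  | smul r x _ hx => rw [map_smul, LinearMap.smul_apply]; exact Submodule.smul_mem _ _ hx

/-- Morphisms: linear combinations of paths modulo the ideal of relations. -/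
def Hom (X Y : Presented R V rel) : Type u :=
  (Quiver.Path X.vertex Y.vertex →₀ R) ⧸ ideal rel X.vertex Y.vertex

instance (X Y : Presented R V rel) : AddCommGroup (Hom X Y) :=
  inferInstanceAs (AddCommGroup ((Quiver.Path X.vertex Y.vertex →₀ R) ⧸ ideal rel _ _))

instance (X Y : Presented R V rel) : Module R (Hom X Y) :=
  inferInstanceAs (Module R ((Quiver.Path X.vertex Y.vertex →₀ R) ⧸ ideal rel _ _))

/-- The class of a linear combination of paths. -/
def toHom (X Y : Presented R V rel) : (Quiver.Path X.vertex Y.vertex →₀ R) →ₗ[R] Hom X Y :=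
  (ideal rel X.vertex Y.vertex).mkQ

lemma toHom_surjective (X Y : Presented R V rel) : Function.Surjective (toHom X Y) :=
  (ideal rel X.vertex Y.vertex).mkQ_surjective

lemma toHom_eq_zero_iff {X Y : Presented R V rel} {x : Quiver.Path X.vertex Y.vertex →₀ R} :
    toHom X Y x = 0 ↔ x ∈ ideal rel X.vertex Y.vertex :=
  Submodule.Quotient.mk_eq_zero _

/-- Bilinear composition of morphisms. -/
def homComp (X Y Z : Presented R V rel) : Hom X Y →ₗ[R] Hom Y Z →ₗ[R] Hom X Z :=
  (ideal rel X.vertex Y.vertex).liftQ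
    { toFun := fun f => (ideal rel Y.vertex Z.vertex).liftQ
        ((toHom X Z).comp (pathComp R X.vertex Y.vertex Z.vertex f))
        (fun _ hg => toHom_eq_zero_iff.2 (comp_mem_ideal_left f hg))
      map_add' := fun f₁ f₂ => by
        apply Submodule.linearMap_qext
        refine LinearMap.ext fun g => ?_
        change toHom X Z (pathComp R _ _ _ (f₁ + f₂) g) =
          toHom X Z (pathComp R _ _ _ f₁ g) + toHom X Z (pathComp R _ _ _ f₂ g)
        rw [map_add, LinearMap.add_apply, map_add]
      map_smul' := fun r f => by
        apply Submodule.linearMap_qext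
        refine LinearMap.ext fun g => ?_
        change toHom X Z (pathComp R _ _ _ (r • f) g) = r • toHom X Z (pathComp R _ _ _ f g)
        rw [map_smul, LinearMap.smul_apply, map_smul] }
    (fun f hf => by
      apply Submodule.linearMap_qext
      refine LinearMap.ext fun g => ?_
      exact toHom_eq_zero_iff.2 (comp_mem_ideal_right g hf))

lemma homComp_toHom {X Y Z : Presented R V rel} (f : Quiver.Path X.vertex Y.vertex →₀ R)
    (g : Quiver.Path Y.vertex Z.vertex →₀ R) :
    homComp X Y Z (toHom X Y f) (toHom Y Z g) = toHom X Z (pathComp R _ _ _ f g) := rfl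

instance : Category.{u} (Presented R V rel) where
  Hom X Y := Hom X Y
  id X := toHom X X (Finsupp.single Quiver.Path.nil 1)
  comp {X Y Z} f g := homComp X Y Z f g
  id_comp {X Y} f := by
    obtain ⟨f, rfl⟩ := toHom_surjective X Y f
    rw [homComp_toHom, pathComp_nil_left]
  comp_id {X Y} f := by
    obtain ⟨f, rfl⟩ := toHom_surjective X Y f
    rw [homComp_toHom, pathComp_nil_right]
  assoc {W X Y Z} f g h := by
    obtain ⟨f, rfl⟩ := toHom_surjective W X f
    obtain ⟨g, rfl⟩ := toHom_surjective X Y g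
    obtain ⟨h, rfl⟩ := toHom_surjective Y Z h
    simp only [homComp_toHom, pathComp_assoc]

instance : Preadditive (Presented R V rel) where
  homGroup X Y := inferInstanceAs (AddCommGroup (Hom X Y))
  add_comp X Y Z f f' g := LinearMap.map_add₂ (homComp X Y Z) f f' g
  comp_add X Y Z f g g' := (homComp X Y Z f).map_add g g'

instance : Linear R (Presented R V rel) where
  homModule X Y := inferInstanceAs (Module R (Hom X Y))
  smul_comp X Y Z r f g := LinearMap.map_smul₂ (homComp X Y Z) r f g
  comp_smul X Y Z f r g := (homComp X Y Z f).map_smul r g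

/-- The morphism given by a generator. -/
def gen {X Y : Presented R V rel} (e : X.vertex ⟶ Y.vertex) : X ⟶ Y :=
  toHom X Y (Finsupp.single e.toPath 1)

end

end Presented

/-! ## Linear subcategories generated by a class of morphisms -/

/-- Objects of the `R`-linear subcategory of `C`, containing all objects, that is generated by the
morphisms in `P`. -/
structure GeneratedSubcategory (R : Type u) [CommRing R] {C : Type} [Category.{u} C]
    [Preadditive C] [Linear R C] (P : MorphismProperty C) where
  obj : C

namespace GeneratedSubcategory

variable {R : Type u} [CommRing R] {C : Type} [Category.{u} C] [Preadditive C] [Linear R C]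

/-- The morphisms obtained from `P` and the identities by composition and `R`-linear
combination. -/
inductive Mem (R : Type u) [CommRing R] {C : Type} [Category.{u} C] [Preadditive C] [Linear R C]
    (P : MorphismProperty C) : ∀ {X Y : C}, (X ⟶ Y) → Prop
  | of {X Y : C} (f : X ⟶ Y) : P f → Mem R P f
  | id (X : C) : Mem R P (𝟙 X)
  | comp {X Y Z : C} (f : X ⟶ Y) (g : Y ⟶ Z) : Mem R P f → Mem R P g → Mem R P (f ≫ g)
  | zero (X Y : C) : Mem R P (0 : X ⟶ Y)
  | add {X Y : C} (f g : X ⟶ Y) : Mem R P f → Mem R P g → Mem R P (f + g)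
  | smul {X Y : C} (r : R) (f : X ⟶ Y) : Mem R P f → Mem R P (r • f)

/-- The submodule of morphisms `X ⟶ Y` lying in the generated subcategory. -/
def homs (R : Type u) [CommRing R] {C : Type} [Category.{u} C] [Preadditive C] [Linear R C]
    (P : MorphismProperty C) (X Y : C) : Submodule R (X ⟶ Y) where
  carrier := {f | Mem R P f}
  add_mem' := Mem.add _ _
  zero_mem' := Mem.zero _ _
  smul_mem' r f := Mem.smul r f

variable {P : MorphismProperty C}

instance : Category.{u} (GeneratedSubcategory R P) where
  Hom X Y := homs R P X.obj Y.obj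
  id X := ⟨𝟙 X.obj, Mem.id _⟩
  comp f g := ⟨f.1 ≫ g.1, Mem.comp _ _ f.2 g.2⟩
  id_comp f := Subtype.ext (Category.id_comp f.1)
  comp_id f := Subtype.ext (Category.comp_id f.1)
  assoc f g h := Subtype.ext (Category.assoc f.1 g.1 h.1)

instance : Preadditive (GeneratedSubcategory R P) where
  homGroup X Y := inferInstanceAs (AddCommGroup (homs R P X.obj Y.obj))
  add_comp _ _ _ f f' g := Subtype.ext (Preadditive.add_comp _ _ _ f.1 f'.1 g.1)
  comp_add _ _ _ f g g' := Subtype.ext (Preadditive.comp_add _ _ _ f.1 g.1 g'.1)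

instance : Linear R (GeneratedSubcategory R P) where
  homModule X Y := inferInstanceAs (Module R (homs R P X.obj Y.obj))
  smul_comp _ _ _ r f g := Subtype.ext (Linear.smul_comp _ _ _ r f.1 g.1)
  comp_smul _ _ _ f r g := Subtype.ext (Linear.comp_smul _ _ _ f.1 r g.1)

/-- The inclusion functor. -/
def incl (R : Type u) [CommRing R] {C : Type} [Category.{u} C] [Preadditive C] [Linear R C]
    (P : MorphismProperty C) : GeneratedSubcategory R P ⥤ C where
  obj X := X.obj
  map f := f.1

end GeneratedSubcategory

/-! ## The symmetric group as a Coxeter group -/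

namespace TypeA

noncomputable section

variable {n : ℕ}

/-- The smaller of the two consecutive letters exchanged by the `i`-th simple reflection. -/
def lo (i : Fin (n - 1)) : Fin n := ⟨i, by have := i.2; omega⟩

/-- The larger of the two consecutive letters exchanged by the `i`-th simple reflection. -/
def hi (i : Fin (n - 1)) : Fin n := ⟨i + 1, by have := i.2; omega⟩

/-- The simple reflections of `S_n`, indexed by `Fin (n - 1)`. -/
def simple (i : Fin (n - 1)) : Equiv.Perm (Fin n) := Equiv.swap (lo i) (hi i)

/-- Coxeter length: the number of inversions. -/
def len (w : Equiv.Perm (Fin n)) : ℕ :=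
  (Finset.univ.filter fun q : Fin n × Fin n => q.1 < q.2 ∧ w q.2 < w q.1).card

lemma lo_lt_hi (i : Fin (n - 1)) : lo i < hi i := by
  simp [lo, hi, Fin.lt_def]

lemma simple_mul_self (i : Fin (n - 1)) : simple i * simple i = 1 := by
  simp [simple]

lemma simple_mul_simple_mul (i : Fin (n - 1)) (w : Equiv.Perm (Fin n)) :
    simple i * (simple i * w) = w := by
  rw [← mul_assoc, simple_mul_self, one_mul]

lemma mul_simple_mul_simple (i : Fin (n - 1)) (w : Equiv.Perm (Fin n)) :
    w * simple i * simple i = w := by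
  rw [mul_assoc, simple_mul_self, mul_one]

lemma simple_inv (i : Fin (n - 1)) : (simple i)⁻¹ = simple i := by
  simp [simple]

lemma simple_lo (i : Fin (n - 1)) : simple i (lo i) = hi i := by simp [simple]

lemma simple_hi (i : Fin (n - 1)) : simple i (hi i) = lo i := by simp [simple]

lemma simple_lt {i : Fin (n - 1)} {a b : Fin n} (h : a < b) (h' : ¬ (a = lo i ∧ b = hi i)) :
    simple i a < simple i b := by
  simp only [simple, Equiv.swap_apply_def]
  split_ifs <;> simp only [lo, hi, Fin.ext_iff, Fin.lt_def] at * <;> omega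

lemma len_mul_simple {i : Fin (n - 1)} {w : Equiv.Perm (Fin n)} (h : w (lo i) < w (hi i)) :
    len (w * simple i) = len w + 1 := by
  classical
  have key : (Finset.univ.filter fun q : Fin n × Fin n =>
      q.1 < q.2 ∧ (w * simple i) q.2 < (w * simple i) q.1) =
      insert (lo i, hi i) ((Finset.univ.filter fun q : Fin n × Fin n =>
        q.1 < q.2 ∧ w q.2 < w q.1).map (Equiv.prodCongr (simple i) (simple i)).toEmbedding) := by
    ext ⟨a, b⟩
    have hs : (simple i).symm = simple i := simple_inv i
    rw [Finset.mem_filter, Finset.mem_insert, Finset.mem_map_equiv, Finset.mem_filter]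
    simp only [Finset.mem_univ, true_and, Prod.mk.injEq, Equiv.prodCongr_symm,
      Equiv.prodCongr_apply, Prod.map, Equiv.Perm.mul_apply, hs]
    constructor
    · rintro ⟨hab, hw⟩
      by_cases hc : a = lo i ∧ b = hi i
      · exact Or.inl hc
      · exact Or.inr ⟨simple_lt hab hc, hw⟩
    · rintro (⟨rfl, rfl⟩ | ⟨hab, hw⟩)
      · rw [simple_lo, simple_hi]
        exact ⟨lo_lt_hi i, h⟩
      · refine ⟨?_, hw⟩
        have hc : ¬ (simple i a = lo i ∧ simple i b = hi i) := by
          rintro ⟨h1, h2⟩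
          rw [h1, h2] at hw
          exact absurd hw (not_lt.2 h.le)
        have := simple_lt hab hc
        have e : ∀ x, simple i (simple i x) = x := fun x => by
          rw [← Equiv.Perm.mul_apply, simple_mul_self, Equiv.Perm.one_apply]
        rwa [e, e] at this
  unfold len
  rw [key, Finset.card_insert_of_notMem, Finset.card_map]
  simp only [Finset.mem_map_equiv, Equiv.prodCongr_symm, Equiv.prodCongr_apply, Prod.map,
    Finset.mem_filter, not_and]
  have hs : (simple i).symm = simple i := simple_inv i
  rw [hs, simple_lo, simple_hi]
  intro _ h'
  exact absurd h' (not_lt.2 (lo_lt_hi i).le)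

lemma len_inv (w : Equiv.Perm (Fin n)) : len w⁻¹ = len w := by
  unfold len
  refine Finset.card_bij' (fun q _ => (w⁻¹ q.2, w⁻¹ q.1)) (fun q _ => (w q.2, w q.1)) ?_ ?_ ?_ ?_
  · rintro ⟨a, b⟩ h
    simpa [and_comm] using h
  · rintro ⟨a, b⟩ h
    simpa [and_comm] using h
  · rintro ⟨a, b⟩ h
    simp
  · rintro ⟨a, b⟩ h
    simp

lemma len_simple_mul {i : Fin (n - 1)} {w : Equiv.Perm (Fin n)} (h : w⁻¹ (lo i) < w⁻¹ (hi i)) :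
    len (simple i * w) = len w + 1 := by
  have := len_mul_simple h
  rwa [len_inv, ← len_inv, mul_inv_rev, inv_inv, simple_inv] at this

lemma ascR_iff {i : Fin (n - 1)} {w : Equiv.Perm (Fin n)} :
    len w < len (w * simple i) ↔ w (lo i) < w (hi i) := by
  refine ⟨fun h => ?_, fun h => by rw [len_mul_simple h]; omega⟩
  by_contra h'
  have hne : w (hi i) ≠ w (lo i) := fun e => (lo_lt_hi i).ne' (w.injective e)
  have h2 : (w * simple i) (lo i) < (w * simple i) (hi i) := by
    rw [Equiv.Perm.mul_apply, Equiv.Perm.mul_apply, simple_lo, simple_hi]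
    exact lt_of_le_of_ne (not_lt.1 h') hne
  have := len_mul_simple h2
  rw [mul_simple_mul_simple] at this
  omega

lemma ascL_iff {i : Fin (n - 1)} {w : Equiv.Perm (Fin n)} :
    len w < len (simple i * w) ↔ w⁻¹ (lo i) < w⁻¹ (hi i) := by
  rw [← ascR_iff, len_inv, ← len_inv (simple i * w), mul_inv_rev, simple_inv]

lemma len_ascR {i : Fin (n - 1)} {w : Equiv.Perm (Fin n)} (h : len w < len (w * simple i)) :
    len (w * simple i) = len w + 1 := len_mul_simple (ascR_iff.1 h)

lemma len_ascL {i : Fin (n - 1)} {w : Equiv.Perm (Fin n)} (h : len w < len (simple i * w)) :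
    len (simple i * w) = len w + 1 := len_simple_mul (ascL_iff.1 h)

lemma len_descR {i : Fin (n - 1)} {w : Equiv.Perm (Fin n)} (h : ¬ len w < len (w * simple i)) :
    len w = len (w * simple i) + 1 := by
  have h1 : len (w * simple i) < len (w * simple i * simple i) := by
    rw [ascR_iff] at h ⊢
    have hne : w (hi i) ≠ w (lo i) := fun e => (lo_lt_hi i).ne' (w.injective e)
    rw [Equiv.Perm.mul_apply, Equiv.Perm.mul_apply, simple_lo, simple_hi]
    exact lt_of_le_of_ne (not_lt.1 h) hne
  have := len_ascR h1
  rwa [mul_simple_mul_simple] at this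

lemma len_descL {i : Fin (n - 1)} {w : Equiv.Perm (Fin n)} (h : ¬ len w < len (simple i * w)) :
    len w = len (simple i * w) + 1 := by
  rw [← len_inv w, ← len_inv (simple i * w), mul_inv_rev, simple_inv] at h ⊢
  exact len_descR h

/-- A permutation other than the identity has a right descent. -/
lemma exists_descR {w : Equiv.Perm (Fin n)} (hw : w ≠ 1) :
    ∃ i : Fin (n - 1), w (hi i) < w (lo i) := by
  by_contra! h
  apply hw
  have hmono : StrictMono w := by
    have hlt : ∀ i : Fin (n - 1), w (lo i) < w (hi i) := fun i =>
      lt_of_le_of_ne (h i) fun e => (lo_lt_hi i).ne (w.injective e)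
    have aux : ∀ (k : ℕ) (a b : Fin n), (b : ℕ) = a + k + 1 → w a < w b := by
      intro k
      induction k with
      | zero =>
        intro a b hab
        have hb := b.2
        have := hlt ⟨a, by omega⟩
        have e : hi (⟨a, by omega⟩ : Fin (n - 1)) = b := by
          apply Fin.ext; simp [hi]; omega
        rw [e] at this
        exact this
      | succ k ih =>
        intro a b hab
        have hb := b.2
        have := hlt ⟨a + k + 1, by omega⟩
        have e : hi (⟨a + k + 1, by omega⟩ : Fin (n - 1)) = b := by
          apply Fin.ext; simp [hi]; omega
        rw [e] at this
        exact (ih a _ rfl).trans this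
    intro a b hab
    exact aux (b - a - 1) a b (by have := Fin.lt_def.1 hab; omega)
  have hid : ∀ a, w a = a := by
    have e : (hmono.orderIsoOfSurjective w w.surjective) = OrderIso.refl (Fin n) :=
      Subsingleton.elim _ _
    intro a
    exact congrArg (fun f : Fin n ≃o Fin n => f a) e
  exact Equiv.ext hid

lemma len_one : len (1 : Equiv.Perm (Fin n)) = 0 := by
  simp only [len, Finset.card_eq_zero, Finset.filter_eq_empty_iff]
  rintro ⟨a, b⟩ - ⟨h1, h2⟩
  exact absurd h1 (not_lt.2 h2.le)

lemma exists_reduced_word (w : Equiv.Perm (Fin n)) :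
    ∃ l : List (Fin (n - 1)), (l.map simple).prod = w ∧ l.length = len w := by
  induction hk : len w generalizing w with
  | zero =>
    refine ⟨[], ?_, rfl⟩
    by_contra hne
    have hne : w ≠ 1 := fun e => hne (by simp [e])
    obtain ⟨i, hi'⟩ := exists_descR hne
    have := len_descR (i := i) (w := w) (by rw [ascR_iff]; exact not_lt.2 hi'.le)
    omega
  | succ k ih =>
    have hne : w⁻¹ ≠ 1 := by
      intro e
      rw [inv_eq_one] at e
      rw [e, len_one] at hk
      omega
    obtain ⟨i, hi'⟩ := exists_descR hne
    have := len_descL (i := i) (w := w) (by rw [ascL_iff]; exact not_lt.2 hi'.le)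
    obtain ⟨l, hl, hl'⟩ := ih (simple i * w) (by omega)
    refine ⟨i :: l, ?_, by simp [hl']⟩
    rw [List.map_cons, List.prod_cons, hl, simple_mul_simple_mul]

/-! ### The Coxeter monoid -/

/-- Multiplication `s_i * w` by a generator in the Coxeter monoid, transported to `S_n`. -/
def starLeft (i : Fin (n - 1)) (w : Equiv.Perm (Fin n)) : Equiv.Perm (Fin n) :=
  if len w < len (simple i * w) then simple i * w else w

/-- Right multiplication `w * s_i` by a generator in the Coxeter monoid. -/
def starRight (i : Fin (n - 1)) (w : Equiv.Perm (Fin n)) : Equiv.Perm (Fin n) :=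
  if len w < len (w * simple i) then w * simple i else w

/-- A reduced expression of `w`. -/
def reducedWord (w : Equiv.Perm (Fin n)) : List (Fin (n - 1)) := (exists_reduced_word w).choose

/-- The product of the Coxeter monoid `(S_n, *)`, i.e. `s_1 * (s_2 * ⋯ (s_k * y))` for a reduced
expression `x = s_1 s_2 ⋯ s_k`. By `star_assoc`, `one_star`, `star_one`, `simple_star` and
`star_eq_mul_of_len'` below this is the monoid structure on `S_n` with `x * y = x y` whenever
lengths add up and `s_i * s_i = s_i`. -/
def star (x y : Equiv.Perm (Fin n)) : Equiv.Perm (Fin n) := (reducedWord x).foldr starLeft y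

lemma starLeft_starRight (i j : Fin (n - 1)) (w : Equiv.Perm (Fin n)) :
    starLeft i (starRight j w) = starRight j (starLeft i w) := by
  by_cases hL : len w < len (simple i * w) <;> by_cases hR : len w < len (w * simple j)
  · have eL : starLeft i w = simple i * w := if_pos hL
    have eR : starRight j w = w * simple j := if_pos hR
    rw [eL, eR]
    unfold starLeft starRight
    have h1 := len_ascL hL
    have h2 := len_ascR hR
    rw [← mul_assoc]
    by_cases h : len (w * simple j) < len (simple i * w * simple j)
    · rw [if_pos h, if_pos (by omega)]
    · rw [if_neg h, if_neg (by omega)]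
      have h3 : ¬ len (simple i * w) < len (simple i * w * simple j) := by omega
      rw [ascR_iff] at h3 hR
      have h4 : w (lo j) = lo i ∧ w (hi j) = hi i := by
        by_contra hc
        exact h3 (simple_lt hR hc)
      have h5 : simple i = w * simple j * w⁻¹ := by
        rw [simple, simple, ← h4.1, ← h4.2]
        exact (Equiv.mul_swap_eq_swap_mul w (lo j) (hi j) ▸ by simp)
      rw [h5, inv_mul_cancel_right]
  · have eL : starLeft i w = simple i * w := if_pos hL
    have eR : starRight j w = w := if_neg hR
    rw [eL, eR, eL]
    have h2 := len_descR hR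
    have h1 := len_ascL hL
    have h3 : len (simple i * (w * simple j)) ≤ len (w * simple j) + 1 := by
      by_cases h : len (w * simple j) < len (simple i * (w * simple j))
      · rw [len_ascL h]
      · omega
    rw [← mul_assoc] at h3
    exact (if_neg (by omega)).symm
  · have eL : starLeft i w = w := if_neg hL
    have eR : starRight j w = w * simple j := if_pos hR
    rw [eL, eR]
    have h2 := len_descL hL
    have h1 := len_ascR hR
    have h3 : len (simple i * w * simple j) ≤ len (simple i * w) + 1 := by
      by_cases h : len (simple i * w) < len (simple i * w * simple j)
      · rw [len_ascR h]
      · omega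
    rw [mul_assoc] at h3
    exact if_neg (by omega)
  · have eL : starLeft i w = w := if_neg hL
    have eR : starRight j w = w := if_neg hR
    rw [eL, eR, eL]

lemma len_starLeft_le (i : Fin (n - 1)) (w : Equiv.Perm (Fin n)) :
    len (starLeft i w) ≤ len w + 1 := by
  unfold starLeft
  split_ifs with h
  · rw [len_ascL h]
  · omega

lemma len_simple_mul_le (i : Fin (n - 1)) (w : Equiv.Perm (Fin n)) :
    len (simple i * w) ≤ len w + 1 := by
  by_cases h : len w < len (simple i * w)
  · rw [len_ascL h]
  · omega

lemma foldr_le (l : List (Fin (n - 1))) (y : Equiv.Perm (Fin n)) :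
    len (l.foldr starLeft y) ≤ l.length + len y := by
  induction l with
  | nil => simp
  | cons i l ih =>
    have := len_starLeft_le i (l.foldr starLeft y)
    simp only [List.foldr_cons, List.length_cons]
    omega

lemma foldr_eq_of_len (l : List (Fin (n - 1))) (y : Equiv.Perm (Fin n))
    (h : len (l.foldr starLeft y) = l.length + len y) :
    l.foldr starLeft y = (l.map simple).prod * y := by
  induction l with
  | nil => simp
  | cons i l ih =>
    simp only [List.foldr_cons, List.length_cons, List.map_cons, List.prod_cons] at h ⊢
    have h1 := len_starLeft_le i (l.foldr starLeft y)
    have h2 := foldr_le l y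
    have h3 := ih (by omega)
    rw [mul_assoc, ← h3]
    generalize l.foldr starLeft y = z at *
    unfold starLeft at h ⊢
    split_ifs at h ⊢ with h4
    · rfl
    · omega

lemma prod_mul_le (l : List (Fin (n - 1))) (y : Equiv.Perm (Fin n)) :
    len ((l.map simple).prod * y) ≤ l.length + len y := by
  induction l with
  | nil => simp
  | cons i l ih =>
    have := len_simple_mul_le i ((l.map simple).prod * y)
    simp only [List.map_cons, List.prod_cons, List.length_cons, mul_assoc]
    omega

lemma foldr_eq_of_len' (l : List (Fin (n - 1))) (y : Equiv.Perm (Fin n))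
    (h : len ((l.map simple).prod * y) = l.length + len y) :
    l.foldr starLeft y = (l.map simple).prod * y := by
  induction l with
  | nil => simp
  | cons i l ih =>
    simp only [List.foldr_cons, List.length_cons, List.map_cons, List.prod_cons, mul_assoc] at h ⊢
    have h1 := len_simple_mul_le i ((l.map simple).prod * y)
    have h2 := prod_mul_le l y
    rw [ih (by omega)]
    exact if_pos (by omega)

lemma foldr_reducedWord (w : Equiv.Perm (Fin n)) : (reducedWord w).foldr starLeft 1 = w := by
  obtain ⟨h1, h2⟩ := (exists_reduced_word w).choose_spec
  have := foldr_eq_of_len' (reducedWord w) 1 (by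
    rw [mul_one, len_one]
    exact (congrArg len h1).trans h2.symm)
  rw [this, mul_one]
  exact h1

lemma starLeft_inv (i : Fin (n - 1)) (w : Equiv.Perm (Fin n)) :
    (starLeft i w)⁻¹ = starRight i w⁻¹ := by
  unfold starLeft starRight
  rw [len_inv, ← len_inv (simple i * w), mul_inv_rev, simple_inv]
  split_ifs <;> simp [simple_inv]

lemma foldl_starRight (l : List (Fin (n - 1))) (w : Equiv.Perm (Fin n)) :
    l.reverse.foldl (fun x i => starRight i x) w⁻¹ = (l.foldr starLeft w)⁻¹ := by
  induction l with
  | nil => simp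
  | cons i l ih => simp [ih, starLeft_inv]

lemma exists_foldl (w : Equiv.Perm (Fin n)) :
    ∃ l : List (Fin (n - 1)), l.foldl (fun x i => starRight i x) 1 = w := by
  refine ⟨(reducedWord w⁻¹).reverse, ?_⟩
  have := foldl_starRight (reducedWord w⁻¹) 1
  rwa [foldr_reducedWord, inv_inv, inv_one] at this

lemma starLeft_foldl (i : Fin (n - 1)) (l : List (Fin (n - 1))) (w : Equiv.Perm (Fin n)) :
    starLeft i (l.foldl (fun x i => starRight i x) w) =
      l.foldl (fun x i => starRight i x) (starLeft i w) := by
  induction l generalizing w with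
  | nil => rfl
  | cons j l ih => simp [ih, starLeft_starRight]

lemma foldr_foldl (m l : List (Fin (n - 1))) (w : Equiv.Perm (Fin n)) :
    m.foldr starLeft (l.foldl (fun x i => starRight i x) w) =
      l.foldl (fun x i => starRight i x) (m.foldr starLeft w) := by
  induction m with
  | nil => rfl
  | cons j m ih => simp [ih, starLeft_foldl]

lemma star_foldl (x : Equiv.Perm (Fin n)) (l : List (Fin (n - 1))) :
    star x (l.foldl (fun x i => starRight i x) 1) = l.foldl (fun x i => starRight i x) x := by
  rw [star, foldr_foldl, foldr_reducedWord]

lemma star_eq_foldr {x : Equiv.Perm (Fin n)} {m : List (Fin (n - 1))}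
    (h : m.foldr starLeft 1 = x) (y : Equiv.Perm (Fin n)) : star x y = m.foldr starLeft y := by
  obtain ⟨l, rfl⟩ := exists_foldl y
  rw [star_foldl, foldr_foldl, h]

lemma star_one (x : Equiv.Perm (Fin n)) : star x 1 = x := foldr_reducedWord x

lemma one_star (x : Equiv.Perm (Fin n)) : star 1 x = x := star_eq_foldr (m := []) rfl x

lemma starLeft_star (i : Fin (n - 1)) (x y : Equiv.Perm (Fin n)) :
    star (starLeft i x) y = starLeft i (star x y) :=
  star_eq_foldr (m := i :: reducedWord x) (by simp [foldr_reducedWord]) y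

lemma star_starRight (i : Fin (n - 1)) (x y : Equiv.Perm (Fin n)) :
    star x (starRight i y) = starRight i (star x y) := by
  obtain ⟨l, rfl⟩ := exists_foldl y
  have := star_foldl x (l ++ [i])
  simp only [List.foldl_append, List.foldl_cons, List.foldl_nil] at this
  rw [this, star_foldl]

lemma star_assoc (x y z : Equiv.Perm (Fin n)) : star (star x y) z = star x (star y z) := by
  rw [star_eq_foldr (m := reducedWord x ++ reducedWord y) (x := star x y)
    (by rw [List.foldr_append, foldr_reducedWord]; rfl) z, List.foldr_append]
  rfl

lemma simple_star (i : Fin (n - 1)) (y : Equiv.Perm (Fin n)) :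
    star (starLeft i 1) y = starLeft i y := by rw [starLeft_star, one_star]

lemma starLeft_one (i : Fin (n - 1)) : starLeft i 1 = starRight i (1 : Equiv.Perm (Fin n)) := by
  simp [starLeft, starRight]

lemma star_simple (i : Fin (n - 1)) (y : Equiv.Perm (Fin n)) :
    star y (starLeft i 1) = starRight i y := by rw [starLeft_one, star_starRight, star_one]

lemma len_reducedWord (x : Equiv.Perm (Fin n)) : (reducedWord x).length = len x :=
  (exists_reduced_word x).choose_spec.2

lemma prod_reducedWord (x : Equiv.Perm (Fin n)) : ((reducedWord x).map simple).prod = x :=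
  (exists_reduced_word x).choose_spec.1

lemma len_star_le (x y : Equiv.Perm (Fin n)) : len (star x y) ≤ len x + len y := by
  have := foldr_le (reducedWord x) y
  rwa [len_reducedWord] at this

lemma star_eq_mul_of_len {x y : Equiv.Perm (Fin n)} (h : len (star x y) = len x + len y) :
    star x y = x * y := by
  have := foldr_eq_of_len (reducedWord x) y (by rwa [len_reducedWord])
  rwa [prod_reducedWord] at this

lemma star_eq_mul_of_len' {x y : Equiv.Perm (Fin n)} (h : len (x * y) = len x + len y) :
    star x y = x * y := by
  have := foldr_eq_of_len' (reducedWord x) y (by rwa [prod_reducedWord, len_reducedWord])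
  rwa [prod_reducedWord] at this

/-! ### Parabolic subgroups and double cosets -/

/-- The parabolic subgroup `W_J`. -/
def parabolic (J : Finset (Fin (n - 1))) : Subgroup (Equiv.Perm (Fin n)) :=
  Subgroup.closure (simple '' (J : Set (Fin (n - 1))))

lemma exists_longest (J : Finset (Fin (n - 1))) :
    ∃ w ∈ parabolic J, ∀ v ∈ parabolic J, len v ≤ len w := by
  classical
  obtain ⟨w, hw, h⟩ := Finset.exists_max_image
    (Finset.univ.filter fun w : Equiv.Perm (Fin n) => w ∈ parabolic J) len
    ⟨1, by simp⟩
  simp only [Finset.mem_filter, Finset.mem_univ, true_and] at hw h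
  exact ⟨w, hw, h⟩

/-- The longest element `w_J` of `W_J`. -/
def longest (J : Finset (Fin (n - 1))) : Equiv.Perm (Fin n) := (exists_longest J).choose

/-- `(I, J)`-cosets, i.e. elements of `W_I \ S_n / W_J`. -/
abbrev Coset (I J : Finset (Fin (n - 1))) : Type :=
  DoubleCoset.Quotient (parabolic I : Set (Equiv.Perm (Fin n))) (parabolic J)

/-- The `(I, J)`-coset containing `w`. -/
def Coset.mk (I J : Finset (Fin (n - 1))) (w : Equiv.Perm (Fin n)) : Coset I J :=
  DoubleCoset.mk (parabolic I) (parabolic J) w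

variable {I J K L : Finset (Fin (n - 1))}

lemma Coset.exists_max (p : Coset I J) :
    ∃ w, Coset.mk I J w = p ∧ ∀ v, Coset.mk I J v = p → len v ≤ len w := by
  classical
  obtain ⟨w, hw, h⟩ := Finset.exists_max_image
    (Finset.univ.filter fun w : Equiv.Perm (Fin n) => Coset.mk I J w = p) len
    (by
      obtain ⟨w, rfl⟩ := Quotient.exists_rep p
      exact ⟨w, by simp; rfl⟩)
  simp only [Finset.mem_filter, Finset.mem_univ, true_and] at hw h
  exact ⟨w, hw, h⟩

/-- The maximal element of a double coset, i.e. its unique longest element. -/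
def Coset.max (p : Coset I J) : Equiv.Perm (Fin n) := p.exists_max.choose

/-- The composition `p * q` of double cosets in the singular Coxeter monoid. -/
def Coset.star (p : Coset I J) (q : Coset J K) : Coset I K :=
  Coset.mk I K (TypeA.star p.max q.max)

/-- `x . y = z`, i.e. `z = x y` with lengths adding up. -/
def ReducedProd (x y z : Equiv.Perm (Fin n)) : Prop :=
  z = x * y ∧ len z = len x + len y

/-- The composition `p * q` is reduced. -/
def Coset.IsReduced (p : Coset I J) (q : Coset J K) : Prop :=
  ReducedProd (p.max * (longest J)⁻¹) q.max (TypeA.star p.max q.max) ∧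
    ReducedProd p.max ((longest J)⁻¹ * q.max) (TypeA.star p.max q.max)

lemma longest_mem (J : Finset (Fin (n - 1))) : longest J ∈ parabolic J :=
  (exists_longest J).choose_spec.1

lemma len_le_longest {v : Equiv.Perm (Fin n)} (hv : v ∈ parabolic J) : len v ≤ len (longest J) :=
  (exists_longest J).choose_spec.2 v hv

lemma simple_mem {i : Fin (n - 1)} (h : i ∈ J) : simple i ∈ parabolic J :=
  Subgroup.subset_closure ⟨i, h, rfl⟩

lemma Coset.mk_max (p : Coset I J) : Coset.mk I J p.max = p := p.exists_max.choose_spec.1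

lemma Coset.len_le_max {p : Coset I J} {v : Equiv.Perm (Fin n)} (h : Coset.mk I J v = p) :
    len v ≤ len p.max := p.exists_max.choose_spec.2 v h

lemma Coset.mk_eq_iff {x y : Equiv.Perm (Fin n)} :
    Coset.mk I J x = Coset.mk I J y ↔ ∃ h ∈ parabolic I, ∃ k ∈ parabolic J, y = h * x * k :=
  DoubleCoset.eq _ _ _ _

/-- Left absorption of the generators in `I`. -/
def AbsL (I : Finset (Fin (n - 1))) (x : Equiv.Perm (Fin n)) : Prop := ∀ i ∈ I, starLeft i x = x

/-- Right absorption of the generators in `I`. -/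
def AbsR (I : Finset (Fin (n - 1))) (x : Equiv.Perm (Fin n)) : Prop := ∀ i ∈ I, starRight i x = x

lemma absL_longest (J : Finset (Fin (n - 1))) : AbsL J (longest J) := fun _ hi =>
  if_neg (not_lt.2 (len_le_longest (Subgroup.mul_mem _ (simple_mem hi) (longest_mem J))))

lemma absR_longest (J : Finset (Fin (n - 1))) : AbsR J (longest J) := fun _ hi =>
  if_neg (not_lt.2 (len_le_longest (Subgroup.mul_mem _ (longest_mem J) (simple_mem hi))))

lemma absL_max (p : Coset I J) : AbsL I p.max := fun i hi =>
  if_neg (not_lt.2 (Coset.len_le_max (by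
    conv_rhs => rw [← p.mk_max]
    rw [eq_comm, Coset.mk_eq_iff]
    exact ⟨simple i, simple_mem hi, 1, Subgroup.one_mem _, by simp⟩)))

lemma absR_max (p : Coset I J) : AbsR J p.max := fun i hi =>
  if_neg (not_lt.2 (Coset.len_le_max (by
    conv_rhs => rw [← p.mk_max]
    rw [eq_comm, Coset.mk_eq_iff]
    exact ⟨1, Subgroup.one_mem _, simple i, simple_mem hi, by simp⟩)))

lemma parabolic_le {v : Equiv.Perm (Fin n)} (hv : v ∈ parabolic J) {k : Fin (n - 1)}
    (hk : k ∉ J) (a : Fin n) : v a ≤ lo k ↔ a ≤ lo k := by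
  induction hv using Subgroup.closure_induction generalizing a with
  | mem x hx =>
    obtain ⟨i, hi', rfl⟩ := hx
    have hne : i ≠ k := fun e => hk (e ▸ hi')
    have hne : (i : ℕ) ≠ k := fun e => hne (Fin.ext e)
    simp only [simple, Equiv.swap_apply_def]
    split_ifs <;> simp only [lo, hi, Fin.ext_iff, Fin.le_def] at * <;> omega
  | one => simp
  | mul x y _ _ hx hy => rw [Equiv.Perm.mul_apply, hx, hy]
  | inv x _ hx => rw [← hx, ← Equiv.Perm.mul_apply, mul_inv_cancel, Equiv.Perm.one_apply]

/-- A nontrivial element of `W_J` has a right descent in `J`. -/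
lemma exists_descR_parabolic {v : Equiv.Perm (Fin n)} (hv : v ∈ parabolic J) (hne : v ≠ 1) :
    ∃ i ∈ J, v (hi i) < v (lo i) := by
  obtain ⟨i, h⟩ := exists_descR hne
  refine ⟨i, ?_, h⟩
  by_contra hi'
  have h1 := (parabolic_le hv hi' (lo i)).2 le_rfl
  have h2 := (parabolic_le hv hi' (hi i)).1 (h.le.trans h1)
  exact absurd (lo_lt_hi i) (not_lt.2 h2)

lemma parabolic_induction {P : Equiv.Perm (Fin n) → Prop} (one : P 1)
    (mul : ∀ (u : Equiv.Perm (Fin n)) (i : Fin (n - 1)), u ∈ parabolic J → i ∈ J →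
      u (lo i) < u (hi i) → P u → P (u * simple i))
    {v : Equiv.Perm (Fin n)} (hv : v ∈ parabolic J) : P v := by
  induction hk : len v using Nat.strong_induction_on generalizing v with
  | _ k ih =>
    by_cases hne : v = 1
    · rwa [hne]
    · obtain ⟨i, hiJ, h⟩ := exists_descR_parabolic hv hne
      have hu : v * simple i ∈ parabolic J := Subgroup.mul_mem _ hv (simple_mem hiJ)
      have hl := len_descR (i := i) (w := v) (by rw [ascR_iff]; exact not_lt.2 h.le)
      have := mul (v * simple i) i hu hiJ
        (by rwa [Equiv.Perm.mul_apply, Equiv.Perm.mul_apply, simple_lo, simple_hi])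
        (ih _ (by omega) hu rfl)
      rwa [mul_simple_mul_simple] at this

lemma star_absR {x v : Equiv.Perm (Fin n)} (hx : AbsR J x) (hv : v ∈ parabolic J) :
    star x v = x := by
  refine parabolic_induction (P := fun v => star x v = x) (star_one x) ?_ hv
  · intro u i _ hi' h ih
    have e : u * simple i = starRight i u := (if_pos (ascR_iff.2 h)).symm
    rw [e, star_starRight, ih, hx i hi']

lemma starRight_inv (i : Fin (n - 1)) (w : Equiv.Perm (Fin n)) :
    (starRight i w)⁻¹ = starLeft i w⁻¹ := by
  rw [inv_eq_iff_eq_inv, starLeft_inv, inv_inv]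

lemma star_inv (x y : Equiv.Perm (Fin n)) : (star x y)⁻¹ = star y⁻¹ x⁻¹ := by
  have h := foldl_starRight (reducedWord x) y
  have h' := foldl_starRight (reducedWord x) 1
  rw [foldr_reducedWord, inv_one] at h'
  rw [star, ← h, ← h', star_foldl]

lemma absL_inv {x : Equiv.Perm (Fin n)} (hx : AbsL J x) : AbsR J x⁻¹ := fun i hi' => by
  rw [← starLeft_inv, hx i hi']

lemma absR_inv {x : Equiv.Perm (Fin n)} (hx : AbsR J x) : AbsL J x⁻¹ := fun i hi' => by
  rw [← starRight_inv, hx i hi']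

lemma star_absL {x v : Equiv.Perm (Fin n)} (hx : AbsL J x) (hv : v ∈ parabolic J) :
    star v x = x := by
  have := star_absR (absL_inv hx) (Subgroup.inv_mem _ hv)
  rwa [← star_inv, inv_inj] at this

lemma longest_inv (J : Finset (Fin (n - 1))) : (longest J)⁻¹ = longest J := by
  have h1 := star_absR (absR_longest J) (Subgroup.inv_mem _ (longest_mem J))
  have h2 := star_absL (absR_inv (absR_longest J)) (longest_mem J)
  rw [← h2, h1]

lemma starLeft_simple_mul (i : Fin (n - 1)) (z : Equiv.Perm (Fin n)) :
    starLeft i (simple i * z) = starLeft i z := by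
  unfold starLeft
  rw [simple_mul_simple_mul]
  by_cases h : len z < len (simple i * z)
  · rw [if_pos h, if_neg (by omega)]
  · have := len_descL h
    rw [if_neg h, if_pos (by omega)]

lemma longest_star_mul {u : Equiv.Perm (Fin n)} (hu : u ∈ parabolic I) (z : Equiv.Perm (Fin n)) :
    star (longest I) (u * z) = star (longest I) z := by
  refine parabolic_induction
    (P := fun u => ∀ z, star (longest I) (u * z) = star (longest I) z) ?_ ?_ hu z
  · intro z
    rw [one_mul]
  · intro u i _ hi' _ ih z
    have key : ∀ y, star (longest I) y = star (longest I) (starLeft i y) := fun y => by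
      conv_lhs => rw [← absR_longest I i hi', ← star_simple, star_assoc, simple_star]
    rw [mul_assoc, ih, key, starLeft_simple_mul, ← key]

lemma mul_star_longest {u : Equiv.Perm (Fin n)} (hu : u ∈ parabolic J) (z : Equiv.Perm (Fin n)) :
    star (z * u) (longest J) = star z (longest J) := by
  have := longest_star_mul (Subgroup.inv_mem _ hu) z⁻¹
  rw [← mul_inv_rev, ← longest_inv, ← star_inv, ← star_inv, inv_inj] at this
  exact this

lemma Coset.max_mk (z : Equiv.Perm (Fin n)) :
    (Coset.mk I J z).max = TypeA.star (TypeA.star (longest I) z) (longest J) := by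
  set p := Coset.mk I J z with hp
  have h := p.mk_max
  rw [hp, eq_comm, Coset.mk_eq_iff] at h
  obtain ⟨a, ha, b, hb, e⟩ := h
  have h1 : TypeA.star (TypeA.star (longest I) p.max) (longest J) = p.max := by
    rw [star_absL (absL_max p) (longest_mem I), star_absR (absR_max p) (longest_mem J)]
  rw [← h1, ← hp] at *
  rw [e, mul_assoc, longest_star_mul ha, star_assoc, mul_star_longest hb, ← star_assoc]

lemma Coset.max_mk_of_abs {x : Equiv.Perm (Fin n)} (hL : AbsL I x) (hR : AbsR J x) :
    (Coset.mk I J x).max = x := by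
  rw [Coset.max_mk, star_absL hL (longest_mem I), star_absR hR (longest_mem J)]

lemma Coset.max_star (p : Coset I J) (q : Coset J K) :
    (p.star q).max = TypeA.star p.max q.max :=
  Coset.max_mk_of_abs (fun i hi' => by rw [← starLeft_star, absL_max p i hi'])
    (fun i hi' => by rw [← star_starRight, absR_max q i hi'])

lemma Coset.ext_max {p q : Coset I J} (h : p.max = q.max) : p = q := by
  rw [← p.mk_max, ← q.mk_max, h]

lemma len_mul_parabolic {y u : Equiv.Perm (Fin n)} (hy : ∀ j ∈ J, y (lo j) < y (hi j))
    (hu : u ∈ parabolic J) : len (y * u) = len y + len u := by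
  have block : ∀ (k : ℕ) (a b : Fin n), (b : ℕ) = a + k + 1 →
      (∀ i : Fin (n - 1), (a : ℕ) ≤ i → (i : ℕ) < b → i ∈ J) → y a < y b := by
    intro k
    induction k with
    | zero =>
      intro a b hab h
      have hb := b.2
      have h1 := hy ⟨a, by omega⟩ (h ⟨a, by omega⟩ (by simp) (by simp; omega))
      have e : hi (⟨a, by omega⟩ : Fin (n - 1)) = b := by
        apply Fin.ext; simp [hi]; omega
      rw [e] at h1
      exact h1
    | succ k ih =>
      intro a b hab h
      have hb := b.2
      have h1 := hy ⟨a + k + 1, by omega⟩ (h ⟨a + k + 1, by omega⟩ (by simp; omega)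
        (by simp; omega))
      have e : hi (⟨a + k + 1, by omega⟩ : Fin (n - 1)) = b := by
        apply Fin.ext; simp [hi]; omega
      rw [e] at h1
      refine (ih a _ rfl fun i h2 h3 => h i h2 ?_).trans h1
      simp [lo] at h3
      omega
  refine parabolic_induction (P := fun u => len (y * u) = len y + len u) ?_ ?_ hu
  · rw [mul_one, len_one, add_zero]
  · intro u i hu hiJ h ih
    rw [len_mul_simple h, ← mul_assoc, len_mul_simple, ih, add_assoc]
    rw [Equiv.Perm.mul_apply, Equiv.Perm.mul_apply]
    refine block (u (hi i) - u (lo i) - 1) _ _ (by have := Fin.lt_def.1 h; omega) ?_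
    intro k h1 h2
    by_contra hk
    have hik : i ≠ k := fun e => hk (e ▸ hiJ)
    have hik : (i : ℕ) ≠ k := fun e => hik (Fin.ext e)
    have h3 := (parabolic_le hu hk (lo i)).1 h1
    have h4 : ¬ hi i ≤ lo k := fun h5 => by
      have := (parabolic_le hu hk (hi i)).2 h5
      simp only [lo, Fin.le_def] at this
      omega
    simp only [lo, hi, Fin.le_def] at h3 h4
    omega

lemma len_mul_longest_inv {x : Equiv.Perm (Fin n)} (hx : AbsR J x) :
    len (x * (longest J)⁻¹) + len (longest J) = len x := by
  classical
  obtain ⟨v, hv, hmin⟩ := Finset.exists_min_image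
    (Finset.univ.filter fun w : Equiv.Perm (Fin n) => w ∈ parabolic J) (fun v => len (x * v))
    ⟨1, by simp⟩
  simp only [Finset.mem_filter, Finset.mem_univ, true_and] at hv hmin
  have hy : ∀ j ∈ J, (x * v) (lo j) < (x * v) (hi j) := by
    intro j hj
    rw [← ascR_iff]
    by_contra h
    have h1 := len_descR h
    have h2 := hmin (v * simple j) (Subgroup.mul_mem _ hv (simple_mem hj))
    rw [← mul_assoc] at h2
    omega
  have h1 : star (x * v) v⁻¹ = x := by
    rw [star_eq_mul_of_len' (len_mul_parabolic hy (Subgroup.inv_mem _ hv)), mul_inv_cancel_right]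
  have h2 : star x (longest J) = x := star_absR hx (longest_mem J)
  rw [← h1, star_assoc, star_absL (absL_longest J) (Subgroup.inv_mem _ hv), h1,
    star_eq_mul_of_len' (len_mul_parabolic hy (longest_mem J))] at h2
  have h3 := len_mul_parabolic hy (longest_mem J)
  rw [h2] at h3
  rw [← h2, mul_inv_cancel_right, h2]
  omega

lemma len_longest_inv_mul {x : Equiv.Perm (Fin n)} (hx : AbsL J x) :
    len ((longest J)⁻¹ * x) + len (longest J) = len x := by
  have := len_mul_longest_inv (absL_inv hx)
  rwa [len_inv x, ← len_inv (x⁻¹ * _), mul_inv_rev, inv_inv, inv_inv, ← longest_inv,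
    len_inv (longest J)] at this

lemma star_longest_inv {x y : Equiv.Perm (Fin n)} (hx : AbsR J x) (hy : AbsL J y) :
    star (x * (longest J)⁻¹) y = star x y := by
  have h1 : star (x * (longest J)⁻¹) (longest J) = x := by
    rw [star_eq_mul_of_len' (by rw [inv_mul_cancel_right, len_mul_longest_inv hx]),
      inv_mul_cancel_right]
  conv_rhs => rw [← h1, star_assoc, star_absL hy (longest_mem J)]

lemma len_star_add_le {x y : Equiv.Perm (Fin n)} (hx : AbsR J x) (hy : AbsL J y) :
    len (star x y) + len (longest J) ≤ len x + len y := by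
  rw [← star_longest_inv hx hy]
  have h1 := len_star_le (x * (longest J)⁻¹) y
  have h2 := len_mul_longest_inv hx
  omega

lemma Coset.isReduced_iff {p : Coset I J} {q : Coset J K} :
    p.IsReduced q ↔ len (TypeA.star p.max q.max) + len (longest J) = len p.max + len q.max := by
  have h1 := len_mul_longest_inv (absR_max p)
  have h2 := len_longest_inv_mul (absL_max q)
  constructor
  · rintro ⟨⟨-, h⟩, -⟩
    omega
  · intro h
    have h3 : TypeA.star p.max q.max = p.max * (longest J)⁻¹ * q.max := by
      rw [← star_longest_inv (absR_max p) (absL_max q)]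
      apply star_eq_mul_of_len
      rw [star_longest_inv (absR_max p) (absL_max q)]
      omega
    exact ⟨⟨h3, by omega⟩, ⟨by rw [h3, mul_assoc], by omega⟩⟩

lemma Coset.star_assoc (p : Coset I J) (q : Coset J K) (r : Coset K L) :
    (p.star q).star r = p.star (q.star r) :=
  Coset.ext_max (by simp only [Coset.max_star, TypeA.star_assoc])

lemma Coset.isReduced_assoc (p : Coset I J) (q : Coset J K) (r : Coset K L) :
    (p.IsReduced q ∧ (p.star q).IsReduced r) ↔ (q.IsReduced r ∧ p.IsReduced (q.star r)) := by
  simp only [Coset.isReduced_iff, Coset.max_star, TypeA.star_assoc]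
  have h1 := len_star_add_le (absR_max p) (absL_max q)
  have h2 := len_star_add_le (absR_max q) (absL_max r)
  have h3 := len_star_add_le (absR_max (p.star q)) (absL_max r)
  have h4 := len_star_add_le (absR_max p) (absL_max (q.star r))
  simp only [Coset.max_star, TypeA.star_assoc] at h3 h4
  omega

lemma Coset.max_one (I : Finset (Fin (n - 1))) : (Coset.mk I I 1).max = longest I := by
  rw [Coset.max_mk, TypeA.star_one, star_absR (absR_longest I) (longest_mem I)]

lemma Coset.one_star (p : Coset I J) :
    (Coset.mk I I 1).IsReduced p ∧ (Coset.mk I I 1).star p = p := by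
  have h : TypeA.star (longest I) p.max = p.max := star_absL (absL_max p) (longest_mem I)
  refine ⟨?_, Coset.ext_max ?_⟩
  · rw [Coset.isReduced_iff, Coset.max_one, h, add_comm]
  · rw [Coset.max_star, Coset.max_one, h]

lemma Coset.star_one (p : Coset I J) :
    p.IsReduced (Coset.mk J J 1) ∧ p.star (Coset.mk J J 1) = p := by
  have h : TypeA.star p.max (longest J) = p.max := star_absR (absR_max p) (longest_mem J)
  refine ⟨?_, Coset.ext_max ?_⟩
  · rw [Coset.isReduced_iff, Coset.max_one, h]
  · rw [Coset.max_star, Coset.max_one, h]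

/-! ### The nilCoxeter algebroid `D` and its atomic subcategory -/

/-- Objects of the nilCoxeter algebroid `D(S_n)` over `R`: subsets of the set of simple
reflections. -/
structure NilCoxeter (R : Type u) (n : ℕ) where
  subset : Finset (Fin (n - 1))

open Classical in
/-- The composition `∂_p ∘ ∂_q`, namely `∂_{p * q}` if `p * q` is reduced and `0` otherwise. -/
def demazureComp (R : Type u) [CommRing R] (p : Coset I J) (q : Coset J K) : Coset I K →₀ R :=
  if p.IsReduced q then Finsupp.single (p.star q) 1 else 0

/-- The bilinear extension of `demazureComp`. -/
def nilComp (R : Type u) [CommRing R] (I J K : Finset (Fin (n - 1))) :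
    (Coset I J →₀ R) →ₗ[R] (Coset J K →₀ R) →ₗ[R] (Coset I K →₀ R) :=
  Finsupp.linearCombination R fun p => Finsupp.linearCombination R fun q => demazureComp R p q

variable {R : Type u} [CommRing R]

lemma nilComp_single (p : Coset I J) (q : Coset J K) :
    nilComp R I J K (Finsupp.single p 1) (Finsupp.single q 1) = demazureComp R p q := by
  simp [nilComp]

lemma nilComp_assoc_single (p : Coset I J) (q : Coset J K) (r : Coset K L) :
    nilComp R I K L (demazureComp R p q) (Finsupp.single r 1) =
      nilComp R I J L (Finsupp.single p 1) (demazureComp R q r) := by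
  have h := Coset.isReduced_assoc p q r
  by_cases h1 : p.IsReduced q
  · by_cases h2 : (p.star q).IsReduced r
    · obtain ⟨h3, h4⟩ := h.1 ⟨h1, h2⟩
      rw [demazureComp, demazureComp, if_pos h1, if_pos h3, nilComp_single, nilComp_single,
        demazureComp, demazureComp, if_pos h2, if_pos h4, Coset.star_assoc]
    · rw [demazureComp, if_pos h1, nilComp_single, demazureComp, if_neg h2]
      by_cases h3 : q.IsReduced r
      · have h4 : ¬ p.IsReduced (q.star r) := fun h4 => h2 (h.2 ⟨h3, h4⟩).2
        rw [demazureComp, if_pos h3, nilComp_single, demazureComp, if_neg h4]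
      · rw [demazureComp, if_neg h3, map_zero]
  · rw [demazureComp, if_neg h1, map_zero, LinearMap.zero_apply]
    by_cases h3 : q.IsReduced r
    · have h4 : ¬ p.IsReduced (q.star r) := fun h4 => h1 (h.2 ⟨h3, h4⟩).1
      rw [demazureComp, if_pos h3, nilComp_single, demazureComp, if_neg h4]
    · rw [demazureComp, if_neg h3, map_zero]

lemma nilComp_assoc (f : Coset I J →₀ R) (g : Coset J K →₀ R) (h : Coset K L →₀ R) :
    nilComp R I K L (nilComp R I J K f g) h = nilComp R I J L f (nilComp R J K L g h) := by
  induction f using Finsupp.induction_linear with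
  | zero => simp
  | add f₁ f₂ h₁ h₂ => simp only [map_add, LinearMap.add_apply, h₁, h₂]
  | single p r =>
    induction g using Finsupp.induction_linear with
    | zero => simp
    | add f₁ f₂ h₁ h₂ => simp only [map_add, LinearMap.add_apply, h₁, h₂]
    | single q s =>
      induction h using Finsupp.induction_linear with
      | zero => simp
      | add f₁ f₂ h₁ h₂ => simp only [map_add, h₁, h₂]
      | single t a =>
        rw [← mul_one r, ← mul_one s, ← mul_one a, ← smul_eq_mul, ← smul_eq_mul, ← smul_eq_mul,
          ← Finsupp.smul_single, ← Finsupp.smul_single, ← Finsupp.smul_single]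
        simp only [map_smul, LinearMap.smul_apply, nilComp_single, nilComp_assoc_single]

lemma nilComp_id_left (f : Coset I J →₀ R) :
    nilComp R I I J (Finsupp.single (Coset.mk I I 1) 1) f = f := by
  induction f using Finsupp.induction_linear with
  | zero => simp
  | add f₁ f₂ h₁ h₂ => simp only [map_add, h₁, h₂]
  | single p r =>
    obtain ⟨h1, h2⟩ := Coset.one_star p
    rw [← mul_one r, ← smul_eq_mul, ← Finsupp.smul_single, map_smul, nilComp_single,
      demazureComp, if_pos h1, h2]

lemma nilComp_id_right (f : Coset I J →₀ R) :
    nilComp R I J J f (Finsupp.single (Coset.mk J J 1) 1) = f := by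
  induction f using Finsupp.induction_linear with
  | zero => simp
  | add f₁ f₂ h₁ h₂ => simp only [map_add, LinearMap.add_apply, h₁, h₂]
  | single p r =>
    obtain ⟨h1, h2⟩ := Coset.star_one p
    rw [← mul_one r, ← smul_eq_mul, ← Finsupp.smul_single, map_smul, LinearMap.smul_apply,
      nilComp_single, demazureComp, if_pos h1, h2]

namespace NilCoxeter

/-- Morphisms from `J` to `I`: the free module on the `(I, J)`-cosets. Here `f ≫ g` is the
composition written `g ∘ f`. -/
instance : Category.{u} (NilCoxeter R n) where
  Hom Y X := Coset X.subset Y.subset →₀ R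
  id X := Finsupp.single (Coset.mk X.subset X.subset 1) 1
  comp {X Y Z} f g := nilComp R Z.subset Y.subset X.subset g f
  id_comp f := nilComp_id_right f
  comp_id f := nilComp_id_left f
  assoc f g h := (nilComp_assoc h g f).symm

instance : Preadditive (NilCoxeter R n) where
  homGroup Y X := inferInstanceAs (AddCommGroup (Coset X.subset Y.subset →₀ R))
  add_comp X Y Z f f' g := (nilComp R Z.subset Y.subset X.subset g).map_add f f'
  comp_add X Y Z f g g' := LinearMap.map_add₂ (nilComp R Z.subset Y.subset X.subset) g g' f

instance : Linear R (NilCoxeter R n) where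
  homModule Y X := inferInstanceAs (Module R (Coset X.subset Y.subset →₀ R))
  smul_comp X Y Z r f g := (nilComp R Z.subset Y.subset X.subset g).map_smul r f
  comp_smul X Y Z f r g := LinearMap.map_smul₂ (nilComp R Z.subset Y.subset X.subset) r g f

/-- The basis morphism `∂_p` from `J` to `I` of an `(I, J)`-coset `p`. -/
def del (R : Type u) [CommRing R] (p : Coset I J) :
    (⟨J⟩ : NilCoxeter R n) ⟶ (⟨I⟩ : NilCoxeter R n) :=
  (Finsupp.single p 1 : Coset I J →₀ R)

end NilCoxeter

/-- An `(I, J)`-coset is atomic if there are `M`, `s ∈ M` and `t = w_M s w_M` with `I = M \ s` and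
`J = M \ t`, and the coset contains `w_M`. -/
def Coset.IsAtomic (p : Coset I J) : Prop :=
  ∃ (M : Finset (Fin (n - 1))) (s t : Fin (n - 1)), s ∈ M ∧ t ∈ M ∧
    simple t = longest M * simple s * longest M ∧ I = M.erase s ∧ J = M.erase t ∧
    p = Coset.mk I J (longest M)

/-- The morphisms `∂_p` for `p` atomic. -/
def atomicMorphisms (R : Type u) [CommRing R] (n : ℕ) : MorphismProperty (NilCoxeter R n) :=
  fun Y X f => ∃ p : Coset X.subset Y.subset, p.IsAtomic ∧ f = NilCoxeter.del R p

/-- The category `AD(S_n)`, generated inside `D(S_n)` by the `∂_p` with `p` atomic. -/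
abbrev AD (R : Type u) [CommRing R] (n : ℕ) : Type :=
  GeneratedSubcategory R (atomicMorphisms R n)

/-- The simple reflection `d_i`, where `d_1 < ⋯ < d_ℓ` are the elements of the complement of `J`
(here numbered from `0`). -/
def outer (J : Finset (Fin (n - 1))) (i : Fin Jᶜ.card) : Fin (n - 1) := Jᶜ.orderEmbOfFin rfl i

/-- The set `J s` with `s = d_i`. -/
def atomicTop (J : Finset (Fin (n - 1))) (i : Fin Jᶜ.card) : Finset (Fin (n - 1)) :=
  insert (outer J i) J

/-- The set `J s \ t` with `s = d_i` and `t = w_{Js} s w_{Js}`. -/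
def atomicTarget (J : Finset (Fin (n - 1))) (i : Fin Jᶜ.card) : Finset (Fin (n - 1)) :=
  (atomicTop J i).filter fun t =>
    simple t ≠ longest (atomicTop J i) * simple (outer J i) * longest (atomicTop J i)

/-- The atomic coset `a_i^J`: the `(J s \ t, J)`-coset containing `w_{Js}`. -/
def atomicCoset (J : Finset (Fin (n - 1))) (i : Fin Jᶜ.card) : Coset (atomicTarget J i) J :=
  Coset.mk _ _ (longest (atomicTop J i))

/-! ### The labeled nilCoxeter algebroid -/

/-- Sequences of strand labels, i.e. compositions of `n`. -/
structure Strands (n : ℕ) where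
  labels : Composition n

/-- `IsCrossing i c d`: the sequence `d` is obtained from `c` by exchanging the labels in the
adjacent positions `i` and `i + 1` (positions are numbered from `0`). -/
def IsCrossing (i : ℕ) (c d : Composition n) : Prop :=
  ∃ (l r : List ℕ) (a b : ℕ), l.length = i ∧ c.blocks = l ++ a :: b :: r ∧
    d.blocks = l ++ b :: a :: r

/-- The generating crossings. -/
instance : Quiver.{0} (Strands n) where
  Hom c d := {i : ℕ // IsCrossing i c.labels d.labels}

/-- The crossing of the strands in positions `i` and `i + 1`, as a path of length one. -/
def crossing {c d : Strands n} (i : ℕ) (h : IsCrossing i c.labels d.labels) : Quiver.Path c d :=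
  Quiver.Hom.toPath (⟨i, h⟩ : c ⟶ d)

/-- The braid relations, the commutation relations and the nil relations on crossings. -/
inductive NilRelator (R : Type u) [CommRing R] (n : ℕ) :
    ∀ c d : Strands n, (Quiver.Path c d →₀ R) → Prop
  | braid (i : ℕ) {c c₁ c₂ d₁ d₂ d : Strands n}
      (h₁ : IsCrossing i c.labels c₁.labels) (h₂ : IsCrossing (i + 1) c₁.labels c₂.labels)
      (h₃ : IsCrossing i c₂.labels d.labels)
      (k₁ : IsCrossing (i + 1) c.labels d₁.labels) (k₂ : IsCrossing i d₁.labels d₂.labels)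
      (k₃ : IsCrossing (i + 1) d₂.labels d.labels) :
      NilRelator R n c d
        (Finsupp.single (((crossing i h₁).comp (crossing (i + 1) h₂)).comp (crossing i h₃)) 1 -
          Finsupp.single
            (((crossing (i + 1) k₁).comp (crossing i k₂)).comp (crossing (i + 1) k₃)) 1)
  | comm (i j : ℕ) (hij : i + 1 < j ∨ j + 1 < i) {c c₁ d₁ d : Strands n}
      (h₁ : IsCrossing j c.labels c₁.labels) (h₂ : IsCrossing i c₁.labels d.labels)
      (k₁ : IsCrossing i c.labels d₁.labels) (k₂ : IsCrossing j d₁.labels d.labels) :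
      NilRelator R n c d
        (Finsupp.single ((crossing j h₁).comp (crossing i h₂)) 1 -
          Finsupp.single ((crossing i k₁).comp (crossing j k₂)) 1)
  | nil (i : ℕ) {c c₁ d : Strands n}
      (h₁ : IsCrossing i c.labels c₁.labels) (h₂ : IsCrossing i c₁.labels d.labels) :
      NilRelator R n c d (Finsupp.single ((crossing i h₁).comp (crossing i h₂)) 1)

/-- The labeled nilCoxeter algebroid `NC(n)`. -/
abbrev NC (R : Type u) [CommRing R] (n : ℕ) : Type :=
  Presented R (Strands n) fun c d => {x | NilRelator R n c d x}

/-- The composition `c`, regarded as an object of `NC(n)`. -/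
def NC.of (R : Type u) [CommRing R] (c : Composition n) : NC R n := ⟨⟨c⟩⟩

/-- The generating morphism `∂_i` with source `c`. -/
def NC.del (R : Type u) [CommRing R] {c d : Composition n} (i : ℕ) (h : IsCrossing i c d) :
    NC.of R c ⟶ NC.of R d :=
  Presented.gen (⟨i, h⟩ : (NC.of R c).vertex ⟶ (NC.of R d).vertex)

/-- The set of simple reflections exchanging two letters in the same block of a composition. -/
def subsetOf (c : Composition n) : Finset (Fin (n - 1)) :=
  Finset.univ.filter fun j => c.index (lo j) = c.index (hi j)

end

end TypeA

namespace TypeA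

noncomputable section

variable {n : ℕ}

/-! ### Compositions and subsets of the simple reflections -/

/-! Call a permutation a block permutation (`Matches`) if it carries the blocks of one composition
onto the blocks of another by translating each of them. Such an `x` from `J` to `I` conjugates the
simple reflections of `J` into those of `I`. Hence its `(I, J)`-coset is the one-sided coset of `x`
modulo `W_J`, with shortest element `x` and longest element `x w_J` (`Matches.max_mk`). On such
cosets the product of the nilCoxeter algebroid becomes transparent: it is the coset of `x y` if
lengths add up and zero otherwise (`Matches.isReduced_iff`, `Matches.star_mk`), and `x` can be read
off from its coset (`Matches.eq_of_mk_eq`).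

Atomic cosets are those of exchanges of two adjacent blocks. Indeed `w_M` reverses the union of the
two blocks, so it differs from the exchange by an element of `W_J`
(`inv_blockSwap_mul_longest_mem`), and every atomic coset arises so (`exists_crossing_of_isAtomic`).
The functor sends a crossing to this coset. The two sides of a braid or commutation relation have
the same permutation and the same total length. A crossing followed by its reverse has trivial
permutation but positive total length, so it maps to zero.

Faithfulness is a block version of Matsumoto's theorem. Crossing adjacent blocks of sizes `a` and
`b` changes the length by `a b`, up or down according to their order (`Matches.len_blockSwap_mul`,
`Matches.len_eq_of_gt`). Consequently every block permutation has a reduced path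
(`exists_reducedPath`), reduced paths with equal permutations have equal classes (`wordProperty`),
and paths that are not reduced vanish (`pathClass_eq_zero`). Each morphism space of `NC(n)` is thus
spanned by one class per block permutation, and these go to distinct basis elements. The resulting
left inverse is made explicit in `linearCombination_evalPaths`. -/

/-- `v` is a partial sum of the list `L`. -/
def IsCut (L : List ℕ) (v : ℕ) : Prop := ∃ l r, L = l ++ r ∧ l.sum = v

lemma IsCut.le {L : List ℕ} {v : ℕ} (h : IsCut L v) : v ≤ L.sum := by
  obtain ⟨l, r, rfl, rfl⟩ := h
  simp

lemma isCut_zero (L : List ℕ) : IsCut L 0 := ⟨[], L, rfl, rfl⟩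

lemma isCut_sum (L : List ℕ) : IsCut L L.sum := ⟨L, [], by simp, rfl⟩

lemma isCut_nil {v : ℕ} : IsCut [] v ↔ v = 0 := by
  constructor
  · intro h
    simpa using h.le
  · rintro rfl
    exact isCut_zero _

lemma isCut_cons {x : ℕ} {r : List ℕ} {v : ℕ} :
    IsCut (x :: r) v ↔ v = 0 ∨ x ≤ v ∧ IsCut r (v - x) := by
  constructor
  · rintro ⟨_ | ⟨y, l⟩, r', h, rfl⟩
    · exact Or.inl rfl
    · simp only [List.cons_append, List.cons.injEq] at h
      obtain ⟨rfl, rfl⟩ := h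
      refine Or.inr ⟨by simp, l, r', rfl, by simp⟩
  · rintro (rfl | ⟨hx, l, r', rfl, h⟩)
    · exact isCut_zero _
    · exact ⟨x :: l, r', rfl, by simp; omega⟩

lemma isCut_append {l r : List ℕ} {v : ℕ} :
    IsCut (l ++ r) v ↔ IsCut l v ∨ l.sum ≤ v ∧ IsCut r (v - l.sum) := by
  induction l generalizing v with
  | nil =>
    simp only [List.nil_append, isCut_nil, List.sum_nil, zero_le, true_and, Nat.sub_zero]
    refine ⟨Or.inr, ?_⟩
    rintro (rfl | h)
    · exact isCut_zero _
    · exact h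
  | cons x l ih =>
    simp only [List.cons_append, isCut_cons, ih, List.sum_cons, Nat.sub_sub]
    have : x ≤ v ∧ l.sum ≤ v - x ↔ x + l.sum ≤ v := by omega
    tauto

/-- The cuts at `l.sum` and `l.sum + a + b` are absorbed into the cases for `l` and `r`. Exchanging
`a` and `b` then affects only the middle alternative. -/
lemma isCut_append_cons_cons {l r : List ℕ} {a b v : ℕ} :
    IsCut (l ++ a :: b :: r) v ↔ IsCut l v ∨ v = l.sum + a ∨
      l.sum + a + b ≤ v ∧ IsCut r (v - (l.sum + a + b)) := by
  rw [isCut_append, isCut_cons, isCut_cons, Nat.sub_sub, Nat.sub_sub]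
  have h0 := isCut_sum l
  constructor
  · rintro (h | ⟨h1, h2 | ⟨h2, h3 | ⟨h3, h4⟩⟩⟩)
    · exact Or.inl h
    · rw [show v = l.sum by omega]; exact Or.inl h0
    · right; left; omega
    · right; right; exact ⟨by omega, h4⟩
  · rintro (h | h | ⟨h1, h2⟩)
    · exact Or.inl h
    · right; exact ⟨by omega, Or.inr ⟨by omega, Or.inl (by omega)⟩⟩
    · right; exact ⟨by omega, Or.inr ⟨by omega, Or.inr ⟨by omega, h2⟩⟩⟩

lemma isCut_blocks_iff (c : Composition n) (v : ℕ) :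
    IsCut c.blocks v ↔ ∃ m, c.sizeUpTo m = v := by
  constructor
  · rintro ⟨l, r, h, rfl⟩
    exact ⟨l.length, by simp [Composition.sizeUpTo, h]⟩
  · rintro ⟨m, rfl⟩
    exact ⟨c.blocks.take m, c.blocks.drop m, by simp, rfl⟩

/-- Letters are numbered from `0`, so the wall between the letters `j` and `j + 1` has `j + 1`
letters to its left. The two letters share a block unless a block ends at that wall. -/
lemma mem_subsetOf {c : Composition n} {j : Fin (n - 1)} :
    j ∈ subsetOf c ↔ ¬ IsCut c.blocks (j + 1) := by
  rw [subsetOf, Finset.mem_filter, isCut_blocks_iff]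
  simp only [Finset.mem_univ, true_and]
  have h1 := c.sizeUpTo_index_le (lo j)
  have h2 := c.lt_sizeUpTo_index_succ (lo j)
  have h3 := c.sizeUpTo_index_le (hi j)
  have h4 := c.lt_sizeUpTo_index_succ (hi j)
  change ((lo j : Fin n) : ℕ) < c.sizeUpTo ((c.index (lo j) : ℕ) + 1) at h2
  change ((hi j : Fin n) : ℕ) < c.sizeUpTo ((c.index (hi j) : ℕ) + 1) at h4
  have e1 : ((lo j : Fin n) : ℕ) = j := rfl
  have e2 : ((hi j : Fin n) : ℕ) = j + 1 := rfl
  rw [e1] at h1 h2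
  rw [e2] at h3 h4
  constructor
  · rintro h ⟨m, hm⟩
    rw [← h] at h4
    rcases Nat.lt_or_ge (c.index (lo j)) m with hlt | hge
    · have := c.monotone_sizeUpTo (show (c.index (lo j) : ℕ) + 1 ≤ m from hlt)
      omega
    · have := c.monotone_sizeUpTo hge
      omega
  · intro h
    by_contra hne
    rcases lt_or_gt_of_ne hne with hlt | hgt
    · have := c.monotone_sizeUpTo (show (c.index (lo j) : ℕ) + 1 ≤ c.index (hi j) from hlt)
      exact h ⟨_, le_antisymm (this.trans h3) h2⟩
    · have := c.monotone_sizeUpTo (show (c.index (hi j) : ℕ) + 1 ≤ c.index (lo j) from hgt)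
      omega

/-- A composition is determined by its boundaries. The boundaries `0` and `n` are always present,
and the subset records all others. -/
lemma subsetOf_injective : Function.Injective (subsetOf : Composition n → _) := by
  intro c d h
  apply (compositionEquiv n).injective
  apply CompositionAsSet.ext
  have key : ∀ (c : Composition n) (v : Fin (n + 1)),
      v ∈ c.boundaries ↔ IsCut c.blocks v := by
    intro c v
    rw [isCut_blocks_iff]
    simp only [Composition.boundaries, Finset.mem_map, Finset.mem_univ, true_and]
    constructor
    · rintro ⟨i, rfl⟩
      exact ⟨i, rfl⟩
    · rintro ⟨m, hm⟩
      rcases Nat.lt_or_ge m (c.length + 1) with hlt | hge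
      · exact ⟨⟨m, hlt⟩, Fin.ext hm⟩
      · refine ⟨Fin.last _, Fin.ext ?_⟩
        rw [c.sizeUpTo_ofLength_le m (by omega)] at hm
        rw [← hm]
        exact c.sizeUpTo_length
  change c.boundaries = d.boundaries
  ext v
  rw [key, key]
  by_cases h0 : (v : ℕ) = 0
  · rw [h0]
    exact iff_of_true (isCut_zero _) (isCut_zero _)
  by_cases hn : (v : ℕ) = n
  · have hc := isCut_sum c.blocks
    have hd := isCut_sum d.blocks
    rw [c.blocks_sum] at hc
    rw [d.blocks_sum] at hd
    rw [hn]
    exact iff_of_true hc hd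
  have hv := v.2
  -- An interior boundary `v` is the wall of the reflection with index `v - 1`.
  have h1 : (⟨v - 1, by omega⟩ : Fin (n - 1)) ∈ subsetOf c ↔ _ := mem_subsetOf
  have h2 : (⟨v - 1, by omega⟩ : Fin (n - 1)) ∈ subsetOf d ↔ _ := mem_subsetOf
  have e : (v : ℕ) - 1 + 1 = v := by omega
  simp only [e] at h1 h2
  rw [h] at h1
  exact not_iff_not.1 (h1.symm.trans h2)

lemma subsetOf_bijective : Function.Bijective (subsetOf : Composition n → _) := by
  rw [Fintype.bijective_iff_injective_and_card]
  refine ⟨subsetOf_injective, ?_⟩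
  rw [composition_card, Fintype.card_finset, Fintype.card_fin]

/-- The reflections outside the subset sit at the interior boundaries, and these increase with the
block index. Uniqueness of the increasing enumeration identifies this list with `outer`, so position
`i` of a crossing and index `i` of `outer` agree. -/
lemma card_compl_subsetOf_and_outer (c : Composition n) : (subsetOf c)ᶜ.card = c.length - 1 ∧
    ∀ (i : ℕ) (hi : i < (subsetOf c)ᶜ.card),
      (outer (subsetOf c) ⟨i, hi⟩ : ℕ) + 1 = c.sizeUpTo (i + 1) := by
  have hlt : ∀ i : Fin (c.length - 1), c.sizeUpTo (i + 1) < n := fun i => by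
    have hi' := i.2
    have := c.sizeUpTo_strict_mono (show (i : ℕ) + 1 < c.length by omega)
    exact this.trans_le (c.sizeUpTo_le _)
  have hpos : ∀ i : Fin (c.length - 1), 0 < c.sizeUpTo (i + 1) := fun i => by
    have hi' := i.2
    have := c.sizeUpTo_strict_mono (show (i : ℕ) < c.length by omega)
    omega
  let f : Fin (c.length - 1) → Fin (n - 1) := fun i =>
    ⟨c.sizeUpTo (i + 1) - 1, by have := hlt i; have := hpos i; omega⟩
  have hf : StrictMono f := by
    intro i j hij
    have h1 := j.2
    have h2 : c.sizeUpTo (i + 1) < c.sizeUpTo (i + 1 + 1) :=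
      c.sizeUpTo_strict_mono (by have := Fin.lt_def.1 hij; omega)
    have h3 : c.sizeUpTo (i + 1 + 1) ≤ c.sizeUpTo (j + 1) :=
      c.monotone_sizeUpTo (by have := Fin.lt_def.1 hij; omega)
    have h4 := hpos i
    simp only [f, Fin.lt_def]
    omega
  have hmem : ∀ i, f i ∈ (subsetOf c)ᶜ := by
    intro i
    have h4 := hpos i
    rw [Finset.mem_compl, mem_subsetOf, not_not, isCut_blocks_iff]
    exact ⟨i + 1, by simp only [f]; omega⟩
  have himg : (subsetOf c)ᶜ = Finset.univ.map ⟨f, hf.injective⟩ := by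
    ext j
    simp only [Finset.mem_map, Finset.mem_univ, true_and, Function.Embedding.coeFn_mk]
    constructor
    · intro h
      rw [Finset.mem_compl, mem_subsetOf, not_not, isCut_blocks_iff] at h
      obtain ⟨m, hm⟩ := h
      have hj := j.2
      have hm0 : m ≠ 0 := by
        rintro rfl
        simp at hm
      have hml : m < c.length := by
        by_contra hge
        rw [c.sizeUpTo_ofLength_le m (by omega)] at hm
        omega
      refine ⟨⟨m - 1, by omega⟩, Fin.ext ?_⟩
      simp only [f]
      rw [show m - 1 + 1 = m by omega]
      omega
    · rintro ⟨i, rfl⟩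
      exact hmem i
  have hcard : (subsetOf c)ᶜ.card = c.length - 1 := by
    rw [himg, Finset.card_map, Finset.card_univ, Fintype.card_fin]
  refine ⟨hcard, fun i hi' => ?_⟩
  have h := Finset.orderEmbOfFin_unique (s := (subsetOf c)ᶜ) rfl
    (f := f ∘ Fin.cast hcard) (fun i => hmem _) (fun i j hij => hf hij)
  have h' := congrFun h ⟨i, hi'⟩
  rw [outer, ← h']
  have := hpos ⟨i, by omega⟩
  simp only [f, Function.comp, Fin.cast_mk]
  simp only at this
  omega

lemma outer_subsetOf {c : Composition n} {l r : List ℕ} {a b : ℕ}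
    (h : c.blocks = l ++ a :: b :: r) : ∃ hi : l.length < (subsetOf c)ᶜ.card,
      (outer (subsetOf c) ⟨l.length, hi⟩ : ℕ) + 1 = l.sum + a := by
  obtain ⟨h1, h2⟩ := card_compl_subsetOf_and_outer c
  have hlen : c.length = l.length + (r.length + 2) := by
    rw [← c.blocks_length, h]; simp
  have hi' : l.length < (subsetOf c)ᶜ.card := by omega
  refine ⟨hi', ?_⟩
  rw [h2, Composition.sizeUpTo, h]
  simp [List.take_append, List.take_of_length_le]

lemma exists_swapped {c : Composition n} {l r : List ℕ} {a b : ℕ}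
    (h : c.blocks = l ++ a :: b :: r) : ∃ d : Composition n, d.blocks = l ++ b :: a :: r := by
  have hpos := @Composition.blocks_pos _ c
  have hsum := c.blocks_sum
  rw [h] at hpos hsum
  refine ⟨⟨l ++ b :: a :: r, fun {i} hi' => hpos (i := i) ?_, ?_⟩, rfl⟩
  · simp only [List.mem_append, List.mem_cons] at hi' ⊢
    tauto
  · rw [← hsum]
    simp
    omega

lemma blocks_facts {c : Composition n} {l r : List ℕ} {a b : ℕ}
    (h : c.blocks = l ++ a :: b :: r) :
    0 < a ∧ 0 < b ∧ l.sum + a + b + r.sum = n := by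
  have hpos := @Composition.blocks_pos _ c
  have hsum := c.blocks_sum
  rw [h] at hpos hsum
  refine ⟨hpos (by simp), hpos (by simp), ?_⟩
  simp at hsum
  omega

end

noncomputable section

variable {n : ℕ}

/-! ### Block swaps -/

/-- The converse of `parabolic_le`: `W_J` consists of the permutations preserving every initial
segment that ends at a wall outside `J`. Such a permutation has no descent outside `J`, so descents
can be stripped off within `J`. -/
lemma mem_parabolic_of {J : Finset (Fin (n - 1))} {u : Equiv.Perm (Fin n)}
    (h : ∀ k ∉ J, ∀ a, u a ≤ lo k ↔ a ≤ lo k) : u ∈ parabolic J := by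
  induction hk : len u using Nat.strong_induction_on generalizing u with
  | _ k ih =>
    by_cases hne : u = 1
    · rw [hne]
      exact Subgroup.one_mem _
    · obtain ⟨i, hi'⟩ := exists_descR hne
      have hiJ : i ∈ J := by
        by_contra hiJ
        have h1 := (h i hiJ (lo i)).2 le_rfl
        have h2 := (h i hiJ (hi i)).1 (hi'.le.trans h1)
        exact absurd (lo_lt_hi i) (not_lt.2 h2)
      have hl := len_descR (i := i) (w := u) (by rw [ascR_iff]; exact not_lt.2 hi'.le)
      have := ih (len (u * simple i)) (by omega) (u := u * simple i) (fun k hk a => by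
        rw [Equiv.Perm.mul_apply, h k hk, parabolic_le (simple_mem hiJ) hk]) rfl
      have := Subgroup.mul_mem _ this (simple_mem hiJ)
      rwa [mul_simple_mul_simple] at this

/-- The map exchanging the intervals `[P, P + a)` and `[P + a, P + a + b)`, increasing on each. -/
def blockMove (P a b v : ℕ) : ℕ :=
  if v < P then v else if v < P + a then v + b else if v < P + a + b then v - a else v

lemma blockMove_of_lt {P a b v : ℕ} (h : v < P) : blockMove P a b v = v := if_pos h

lemma blockMove_left {P a b v : ℕ} (h : P ≤ v) (h' : v < P + a) : blockMove P a b v = v + b := by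
  rw [blockMove, if_neg (by omega), if_pos h']

lemma blockMove_right {P a b v : ℕ} (h : P + a ≤ v) (h' : v < P + a + b) :
    blockMove P a b v = v - a := by
  rw [blockMove, if_neg (by omega), if_neg (by omega), if_pos h']

lemma blockMove_of_ge {P a b v : ℕ} (h : P + a + b ≤ v) : blockMove P a b v = v := by
  rw [blockMove, if_neg (by omega), if_neg (by omega), if_neg (by omega)]

lemma blockMove_blockMove (P a b v : ℕ) : blockMove P b a (blockMove P a b v) = v := by
  unfold blockMove
  split_ifs <;> omega

lemma blockMove_lt {P a b v n : ℕ} (h : P + a + b ≤ n) (hv : v < n) : blockMove P a b v < n := by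
  unfold blockMove
  split_ifs <;> omega

/-- The permutation exchanging the intervals `[P, P + a)` and `[P + a, P + a + b)`. -/
def blockSwap (P a b : ℕ) (h : P + a + b ≤ n) : Equiv.Perm (Fin n) where
  toFun v := ⟨blockMove P a b v, blockMove_lt h v.2⟩
  invFun v := ⟨blockMove P b a v, blockMove_lt (by omega) v.2⟩
  left_inv v := Fin.ext (blockMove_blockMove P a b v)
  right_inv v := Fin.ext (blockMove_blockMove P b a v)

lemma blockSwap_val {P a b : ℕ} (h : P + a + b ≤ n) (v : Fin n) :
    (blockSwap P a b h v : ℕ) = blockMove P a b v := rfl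

lemma blockSwap_inv {P a b : ℕ} (h : P + a + b ≤ n) (h' : P + b + a ≤ n) :
    (blockSwap P a b h)⁻¹ = blockSwap P b a h' := rfl

lemma blockSwap_mul_blockSwap {P a b : ℕ} (h : P + a + b ≤ n) (h' : P + b + a ≤ n) :
    blockSwap P b a h' * blockSwap P a b h = 1 := by
  rw [← blockSwap_inv h, inv_mul_cancel]

/-- Both sides reverse the order of three consecutive intervals while translating each of them. -/
lemma blockSwap_braid {P a b c : ℕ} (h : P + a + b + c ≤ n) :
    blockSwap P b c (by omega) * (blockSwap (P + b) a c (by omega) *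
      blockSwap P a b (by omega)) =
    blockSwap (P + c) a b (by omega) * (blockSwap P a c (by omega) *
      blockSwap (P + a) b c h) := by
  ext v
  simp only [Equiv.Perm.mul_apply, blockSwap_val]
  obtain hv | hv | hv | hv | hv : (v : ℕ) < P ∨ (P ≤ v ∧ (v : ℕ) < P + a) ∨
    (P + a ≤ v ∧ (v : ℕ) < P + a + b) ∨ (P + a + b ≤ v ∧ (v : ℕ) < P + a + b + c) ∨
    P + a + b + c ≤ v := by omega
  · rw [show blockMove P a b v = v from blockMove_of_lt hv,
      show blockMove (P + b) a c v = v from blockMove_of_lt (by omega),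
      show blockMove P b c v = v from blockMove_of_lt hv,
      show blockMove (P + a) b c v = v from blockMove_of_lt (by omega),
      show blockMove P a c v = v from blockMove_of_lt hv,
      show blockMove (P + c) a b v = v from blockMove_of_lt (by omega)]
  · rw [show blockMove P a b v = v + b from blockMove_left (by omega) (by omega),
      show blockMove (P + b) a c (v + b) = v + b + c from blockMove_left (by omega) (by omega),
      show blockMove P b c (v + b + c) = v + b + c from blockMove_of_ge (by omega),
      show blockMove (P + a) b c v = v from blockMove_of_lt (by omega),
      show blockMove P a c v = v + c from blockMove_left (by omega) (by omega),
      show blockMove (P + c) a b (v + c) = v + c + b from blockMove_left (by omega) (by omega)]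
    omega
  · rw [show blockMove P a b v = v - a from blockMove_right (by omega) (by omega),
      show blockMove (P + b) a c (v - a) = v - a from blockMove_of_lt (by omega),
      show blockMove P b c (v - a) = v - a + c from blockMove_left (by omega) (by omega),
      show blockMove (P + a) b c v = v + c from blockMove_left (by omega) (by omega),
      show blockMove P a c (v + c) = v + c from blockMove_of_ge (by omega),
      show blockMove (P + c) a b (v + c) = v + c - a from blockMove_right (by omega) (by omega)]
    omega
  · rw [show blockMove P a b v = v from blockMove_of_ge (by omega),
      show blockMove (P + b) a c v = v - a from blockMove_right (by omega) (by omega),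
      show blockMove P b c (v - a) = v - a - b from blockMove_right (by omega) (by omega),
      show blockMove (P + a) b c v = v - b from blockMove_right (by omega) (by omega),
      show blockMove P a c (v - b) = v - b - a from blockMove_right (by omega) (by omega),
      show blockMove (P + c) a b (v - b - a) = v - b - a from blockMove_of_lt (by omega)]
    omega
  · rw [show blockMove P a b v = v from blockMove_of_ge (by omega),
      show blockMove (P + b) a c v = v from blockMove_of_ge (by omega),
      show blockMove P b c v = v from blockMove_of_ge (by omega),
      show blockMove (P + a) b c v = v from blockMove_of_ge (by omega),
      show blockMove P a c v = v from blockMove_of_ge (by omega),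
      show blockMove (P + c) a b v = v from blockMove_of_ge (by omega)]

lemma blockSwap_comm {P a b Q c d : ℕ} (h : P + a + b ≤ Q) (h' : Q + c + d ≤ n) :
    blockSwap P a b (by omega) * blockSwap Q c d h' =
      blockSwap Q c d h' * blockSwap P a b (by omega) := by
  ext v
  simp only [Equiv.Perm.mul_apply, blockSwap_val, blockMove]
  split_ifs <;> omega

/-- The inversions are exactly the pairs formed by one letter from each interval. -/
lemma len_blockSwap {P a b : ℕ} (h : P + a + b ≤ n) : len (blockSwap P a b h) = a * b := by
  have hcard : (Finset.univ : Finset (Fin a × Fin b)).card = a * b := by simp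
  rw [← hcard, len, eq_comm]
  refine Finset.card_bij (fun q _ => (⟨P + q.1, by omega⟩, ⟨P + a + q.2, by omega⟩)) ?_ ?_ ?_
  · rintro ⟨x, y⟩ -
    have hx := x.2
    have hy := y.2
    simp only [Finset.mem_filter, Finset.mem_univ, true_and, Fin.lt_def, blockSwap_val]
    rw [show blockMove P a b (P + a + y) = P + a + y - a from
        blockMove_right (by omega) (by omega),
      show blockMove P a b (P + x) = P + x + b from blockMove_left (by omega) (by omega)]
    omega
  · rintro ⟨x, y⟩ - ⟨x', y'⟩ - e
    simp only [Prod.mk.injEq, Fin.mk.injEq, Nat.add_left_cancel_iff] at e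
    exact Prod.ext (Fin.ext e.1) (Fin.ext e.2)
  · rintro ⟨u, v⟩ h1
    simp only [Finset.mem_filter, Finset.mem_univ, true_and, Fin.lt_def, blockSwap_val] at h1
    have : P ≤ u ∧ (u : ℕ) < P + a ∧ P + a ≤ v ∧ (v : ℕ) < P + a + b := by
      obtain ⟨h1, h2⟩ := h1
      unfold blockMove at h2
      split_ifs at h2 <;> omega
    refine ⟨(⟨u - P, by omega⟩, ⟨v - (P + a), by omega⟩), Finset.mem_univ _, ?_⟩
    exact Prod.ext (Fin.ext (by simp only; omega)) (Fin.ext (by simp only; omega))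

/-! ### Block permutations -/

/-- `x` restricts to an increasing bijection between the pairs of adjacent letters exchanged by `J`
and those exchanged by `I`. -/
def Matches (J I : Finset (Fin (n - 1))) (x : Equiv.Perm (Fin n)) : Prop :=
  (∀ j ∈ J, ∃ i ∈ I, x (lo j) = lo i ∧ x (hi j) = hi i) ∧
    ∀ i ∈ I, ∃ j ∈ J, x (lo j) = lo i ∧ x (hi j) = hi i

variable {I J K : Finset (Fin (n - 1))} {x y : Equiv.Perm (Fin n)}

lemma Matches.mul (hx : Matches J I x) (hy : Matches K J y) : Matches K I (x * y) := by
  constructor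
  · intro k hk
    obtain ⟨j, hj, h1, h2⟩ := hy.1 k hk
    obtain ⟨i, hi', h3, h4⟩ := hx.1 j hj
    exact ⟨i, hi', by rw [Equiv.Perm.mul_apply, h1, h3], by rw [Equiv.Perm.mul_apply, h2, h4]⟩
  · intro i hi'
    obtain ⟨j, hj, h1, h2⟩ := hx.2 i hi'
    obtain ⟨k, hk, h3, h4⟩ := hy.2 j hj
    exact ⟨k, hk, by rw [Equiv.Perm.mul_apply, h3, h1], by rw [Equiv.Perm.mul_apply, h4, h2]⟩

lemma Matches.one (J : Finset (Fin (n - 1))) : Matches J J 1 :=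
  ⟨fun j hj => ⟨j, hj, rfl, rfl⟩, fun j hj => ⟨j, hj, rfl, rfl⟩⟩

lemma lo_injective : Function.Injective (lo : Fin (n - 1) → Fin n) := fun _ _ h =>
  Fin.ext (Fin.mk.inj h)

lemma Matches.eq_of_one (h : Matches J I 1) : J = I := by
  ext j
  constructor
  · intro hj
    obtain ⟨i, hi', h1, -⟩ := h.1 j hj
    rwa [lo_injective h1]
  · intro hj
    obtain ⟨i, hi', h1, -⟩ := h.2 j hj
    rwa [← lo_injective h1]

lemma Matches.inv (h : Matches J I x) : Matches I J x⁻¹ := by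
  refine ⟨fun i hi' => ?_, fun j hj => ?_⟩
  · obtain ⟨j, hj, h1, h2⟩ := h.2 i hi'
    exact ⟨j, hj, Equiv.Perm.inv_eq_iff_eq.2 h1.symm, Equiv.Perm.inv_eq_iff_eq.2 h2.symm⟩
  · obtain ⟨i, hi', h1, h2⟩ := h.1 j hj
    exact ⟨i, hi', Equiv.Perm.inv_eq_iff_eq.2 h1.symm, Equiv.Perm.inv_eq_iff_eq.2 h2.symm⟩

lemma Matches.lt (h : Matches J I x) : ∀ j ∈ J, x (lo j) < x (hi j) := by
  intro j hj
  obtain ⟨i, -, h1, h2⟩ := h.1 j hj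
  rw [h1, h2]
  exact lo_lt_hi i

/-- Conjugation by `x` matches the generators of `W_J` with those of `W_I`. This is why left
multiplication by `W_I` does not enlarge `x W_J`. -/
lemma Matches.simple_mul (h : Matches J I x) {i : Fin (n - 1)} (hi' : i ∈ I) :
    ∃ j ∈ J, x * simple j = simple i * x := by
  obtain ⟨j, hj, h1, h2⟩ := h.2 i hi'
  exact ⟨j, hj, by rw [simple, simple, ← h1, ← h2, Equiv.mul_swap_eq_swap_mul]⟩

/-- Exchanging two adjacent blocks of a composition is a block permutation. -/
lemma matches_blockSwap {c d : Composition n} {l r : List ℕ} {a b P : ℕ}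
    (hc : c.blocks = l ++ a :: b :: r) (hd : d.blocks = l ++ b :: a :: r) (hP : l.sum = P)
    (h : P + a + b ≤ n) :
    Matches (subsetOf c) (subsetOf d) (blockSwap P a b h) := by
  subst hP
  -- This is the first half of `Matches`, kept general in the compositions and sizes. The second
  -- half is the same statement for the inverse swap, with `c` and `d` exchanged.
  have key : ∀ {c d : Composition n} {a b : ℕ} (hc : c.blocks = l ++ a :: b :: r)
      (hd : d.blocks = l ++ b :: a :: r) (h : l.sum + a + b ≤ n),
      ∀ j ∈ subsetOf c, ∃ i ∈ subsetOf d, blockSwap l.sum a b h (lo j) = lo i ∧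
        blockSwap l.sum a b h (hi j) = hi i := by
    intro c d a b hc hd h j hj
    have hjn := j.2
    rw [mem_subsetOf, hc, isCut_append_cons_cons, not_or, not_or] at hj
    obtain ⟨h1, h2, h3⟩ := hj
    have hl : (j : ℕ) + 1 ≠ l.sum := fun e => h1 (e ▸ isCut_sum l)
    have hr : (j : ℕ) + 1 ≠ l.sum + a + b := fun e => h3 ⟨by omega, by
      rw [e, Nat.sub_self]; exact isCut_zero r⟩
    have hlo : ∀ v : ℕ, blockMove l.sum a b j = v → blockMove l.sum a b (j + 1) = v + 1 →
        (hv : ¬ IsCut (l ++ b :: a :: r) (v + 1)) → ∃ i ∈ subsetOf d,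
          blockSwap l.sum a b h (lo j) = lo i ∧ blockSwap l.sum a b h (hi j) = hi i := by
      intro v e1 e2 hv
      have hvn : v + 1 < n := by
        rw [← e2]
        exact blockMove_lt h (by omega)
      refine ⟨⟨v, by omega⟩, ?_, Fin.ext e1, Fin.ext e2⟩
      rw [mem_subsetOf, hd]
      exact hv
    have hle : ∀ v, IsCut l v → v ≤ l.sum := fun v hv => hv.le
    -- The walls at `l.sum`, `l.sum + a` and `l.sum + a + b` are cuts, so the letters `j` and `j +
    -- 1` lie on the same side of each of them and are translated together.
    obtain hv | hv | hv | hv : (j : ℕ) + 1 < l.sum ∨ (l.sum ≤ j ∧ (j : ℕ) + 1 < l.sum + a) ∨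
      (l.sum + a ≤ j ∧ (j : ℕ) + 1 < l.sum + a + b) ∨ l.sum + a + b ≤ j := by omega
    · refine hlo j (blockMove_of_lt (by omega)) (blockMove_of_lt hv) ?_
      rw [isCut_append_cons_cons]
      rintro (h4 | h4 | h4)
      · exact h1 h4
      · omega
      · omega
    · refine hlo (j + b) (blockMove_left (by omega) (by omega)) ?_ ?_
      · rw [blockMove_left (by omega) (by omega)]
        omega
      · rw [isCut_append_cons_cons]
        rintro (h4 | h4 | h4)
        · have := h4.le
          omega
        · omega
        · omega
    · refine hlo (j - a) (blockMove_right (by omega) (by omega)) ?_ ?_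
      · rw [blockMove_right (by omega) (by omega)]
        omega
      · rw [isCut_append_cons_cons]
        rintro (h4 | h4 | h4)
        · have := h4.le
          omega
        · omega
        · omega
    · refine hlo j (blockMove_of_ge (by omega)) (blockMove_of_ge (by omega)) ?_
      rw [isCut_append_cons_cons]
      rintro (h4 | h4 | h4)
      · exact h1 h4
      · omega
      · refine h3 ⟨by omega, ?_⟩
        rw [add_right_comm]
        exact h4.2
  have h' : l.sum + b + a ≤ n := by omega
  refine ⟨key hc hd h, fun i hi' => ?_⟩
  obtain ⟨j, hj, h1, h2⟩ := key hd hc h' i hi'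
  rw [← blockSwap_inv h, Equiv.Perm.inv_eq_iff_eq] at h1 h2
  exact ⟨j, hj, h1.symm, h2.symm⟩

end

noncomputable section

variable {n : ℕ} {I J K : Finset (Fin (n - 1))} {x y : Equiv.Perm (Fin n)}

/-! ### Crossings of block permutations -/

lemma inv_blockSwap_mul_apply {P a b : ℕ} (h : P + a + b ≤ n) (h' : P + b + a ≤ n)
    (x : Equiv.Perm (Fin n)) (w : Fin n) :
    (blockSwap P a b h * x)⁻¹ w = x⁻¹ (blockSwap P b a h' w) := rfl

section

variable {c d : Composition n} {l r : List ℕ} {a b : ℕ}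

/-- Neighbours within a block stay neighbours in the same order, so each block is moved rigidly and
the position of its first letter determines the rest. -/
lemma Matches.inv_block (hx : Matches J (subsetOf c) x) (hc : c.blocks = l ++ a :: b :: r) {t : ℕ}
    (ht : t < a) {u v : Fin n} (hu : (u : ℕ) = l.sum) (hv : (v : ℕ) = l.sum + t) :
    (x⁻¹ v : ℕ) = x⁻¹ u + t := by
  induction t generalizing v with
  | zero =>
    rw [show v = u from Fin.ext (by omega), add_zero]
  | succ t ih =>
    have hvn := v.2
    have hj : (⟨l.sum + t, by omega⟩ : Fin (n - 1)) ∈ subsetOf c := by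
      rw [mem_subsetOf, hc, isCut_append_cons_cons]
      rintro (h | h | h)
      · have := h.le
        simp only at this
        omega
      · simp only at h
        omega
      · simp only at h
        omega
    obtain ⟨i, -, h1, h2⟩ := hx.inv.1 _ hj
    have e : v = hi (⟨l.sum + t, by omega⟩ : Fin (n - 1)) := Fin.ext (by simp [hi]; omega)
    have h3 := ih (by omega) (v := lo (⟨l.sum + t, by omega⟩ : Fin (n - 1))) rfl
    rw [e, h2]
    rw [h1] at h3
    simp only [lo, hi] at h3 ⊢
    omega

/-- Comparing the first letters of two adjacent blocks amounts to comparing the adjacent letters. -/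
lemma Matches.inv_lt_of_lt (hx : Matches J (subsetOf c) x) (hc : c.blocks = l ++ a :: b :: r)
    {u v w : Fin n} (hu : (u : ℕ) = l.sum) (hv : (v : ℕ) = l.sum + a)
    (hw : (w : ℕ) + 1 = l.sum + a) (h : x⁻¹ u < x⁻¹ v) : x⁻¹ w < x⁻¹ v := by
  obtain ⟨ha, -, -⟩ := blocks_facts hc
  have hw' := hx.inv_block hc (t := a - 1) (by omega) hu (v := w) (by omega)
  rw [Fin.lt_def] at h ⊢
  -- Otherwise the preimage of `v` falls into the interval filled by the preimages of the first
  -- block, which contradicts injectivity.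
  by_contra hlt
  have hv' := v.2
  have h1 := hx.inv_block hc (t := x⁻¹ v - x⁻¹ u) (by omega) hu
    (v := ⟨l.sum + (x⁻¹ v - x⁻¹ u), by omega⟩) rfl
  have h2 := x⁻¹.injective (Fin.ext (h1.trans (Nat.add_sub_cancel' h.le)))
  have h3 := congrArg Fin.val h2
  simp only at h3
  omega

/-- Once the wall `s` is removed, the two exchanged intervals form a single block and no remaining
wall separates them. -/
lemma blockSwap_mem {s : Fin (n - 1)} (hc : c.blocks = l ++ a :: b :: r)
    (hs : (s : ℕ) + 1 = l.sum + a) (h : l.sum + a + b ≤ n) :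
    blockSwap l.sum a b h ∈ parabolic (insert s (subsetOf c)) := by
  apply mem_parabolic_of
  intro k hk z
  rw [Finset.mem_insert, not_or, mem_subsetOf, not_not, hc, isCut_append_cons_cons] at hk
  obtain ⟨hks, hk⟩ := hk
  have hks : (k : ℕ) ≠ s := fun e => hks (Fin.ext e)
  have hk : (k : ℕ) + 1 ≤ l.sum ∨ l.sum + a + b ≤ k + 1 := by
    rcases hk with h1 | h1 | h1
    · exact Or.inl h1.le
    · omega
    · exact Or.inr h1.1
  rw [Fin.le_def, Fin.le_def, blockSwap_val]
  simp only [lo]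
  unfold blockMove
  split_ifs <;> omega

/-- Crossing two blocks that appear in increasing order increases the length. -/
lemma Matches.len_blockSwap_mul (hx : Matches J (subsetOf c) x)
    (hc : c.blocks = l ++ a :: b :: r) (h : l.sum + a + b ≤ n) {u v : Fin n}
    (hu : (u : ℕ) = l.sum) (hv : (v : ℕ) = l.sum + a) (hlt : x⁻¹ u < x⁻¹ v) :
    len (blockSwap l.sum a b h * x) = len x + a * b := by
  obtain ⟨ha, hb, -⟩ := blocks_facts hc
  have hvn := v.2
  let s : Fin (n - 1) := ⟨l.sum + a - 1, by omega⟩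
  have hs : (s : ℕ) + 1 = l.sum + a := by simp only [s]; omega
  -- Ascending at all generators of the merged parabolic, `x⁻¹` is the shortest element of its
  -- coset. Multiplication by the inverse of the block swap, which lies in that parabolic, therefore
  -- adds lengths.
  have hasc : ∀ j ∈ insert s (subsetOf c), x⁻¹ (lo j) < x⁻¹ (hi j) := by
    intro j hj
    rcases Finset.mem_insert.1 hj with rfl | hj
    · have e : hi s = v := Fin.ext (by simp only [hi]; omega)
      rw [e]
      exact hx.inv_lt_of_lt hc hu hv (by simp only [lo]; omega) hlt
    · exact hx.inv.lt j hj
  have := len_mul_parabolic hasc (Subgroup.inv_mem _ (blockSwap_mem hc hs h))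
  rwa [← mul_inv_rev, len_inv, len_inv, len_inv, len_blockSwap] at this

/-- Crossing two blocks that appear in decreasing order decreases the length. -/
lemma Matches.len_eq_of_gt (hx : Matches J (subsetOf c) x) (hc : c.blocks = l ++ a :: b :: r)
    {P : ℕ} (hP : l.sum = P) (h : P + a + b ≤ n) {u v : Fin n}
    (hu : (u : ℕ) = P) (hv : (v : ℕ) = P + a) (hlt : x⁻¹ v < x⁻¹ u) :
    len x = len (blockSwap P a b h * x) + a * b := by
  subst hP
  obtain ⟨ha, hb, -⟩ := blocks_facts hc
  obtain ⟨d, hd⟩ := exists_swapped hc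
  have h' : l.sum + b + a ≤ n := by omega
  -- After the crossing the two blocks appear in increasing order, so the increasing case applies to
  -- the crossing back.
  have hx' := (matches_blockSwap hc hd rfl h).mul hx
  have e1 : blockSwap l.sum b a h' u = v := Fin.ext (by
    rw [blockSwap_val, blockMove_left (by omega) (by omega)]; omega)
  have e2 : blockSwap l.sum b a h' ⟨l.sum + b, by omega⟩ = u := Fin.ext (by
    rw [blockSwap_val, blockMove_right (by simp) (by simp; omega)]; simp only; omega)
  have := hx'.len_blockSwap_mul hd h' (u := u) (v := ⟨l.sum + b, by omega⟩) hu rfl (by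
    rw [inv_blockSwap_mul_apply h h', inv_blockSwap_mul_apply h h', e1, e2]
    exact hlt)
  rwa [← mul_assoc, blockSwap_mul_blockSwap, one_mul, mul_comm b] at this

/-- As `a * b` is positive, a gain of length excludes the decreasing order. -/
lemma Matches.lt_of_len (hx : Matches J (subsetOf c) x) (hc : c.blocks = l ++ a :: b :: r)
    {P : ℕ} (hP : l.sum = P) (h : P + a + b ≤ n) {u v : Fin n}
    (hu : (u : ℕ) = P) (hv : (v : ℕ) = P + a)
    (hlen : len (blockSwap P a b h * x) = len x + a * b) : x⁻¹ u < x⁻¹ v := by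
  subst hP
  obtain ⟨ha, hb, -⟩ := blocks_facts hc
  have hab := Nat.mul_pos ha hb
  rcases lt_trichotomy (x⁻¹ u) (x⁻¹ v) with hlt | he | hgt
  · exact hlt
  · have := congrArg Fin.val (x⁻¹.injective he)
    omega
  · have := hx.len_eq_of_gt hc rfl h hu hv hgt
    omega

lemma exists_split {i : Fin (n - 1)} (h : i ∉ subsetOf c) : ∃ (l r : List ℕ) (a b : ℕ),
    c.blocks = l ++ a :: b :: r ∧ (i : ℕ) + 1 = l.sum + a := by
  have hin := i.2
  rw [mem_subsetOf, not_not] at h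
  obtain ⟨L, r', hLr, hsum⟩ := h
  rcases List.eq_nil_or_concat L with rfl | ⟨l, a, rfl⟩
  · simp at hsum
  rcases r' with _ | ⟨b, r⟩
  · have := c.blocks_sum
    rw [hLr, List.append_nil, hsum] at this
    omega
  refine ⟨l, r, a, b, by rw [hLr]; simp, ?_⟩
  rw [← hsum]
  simp

/-- A descent of `x⁻¹` cannot lie inside a block, so it occurs at a wall. By rigidity the two
neighbouring blocks are then in decreasing order as a whole. -/
lemma Matches.exists_gt (hx : Matches J (subsetOf c) x) (hne : x ≠ 1) :
    ∃ (l r : List ℕ) (a b : ℕ) (u v : Fin n), c.blocks = l ++ a :: b :: r ∧ (u : ℕ) = l.sum ∧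
      (v : ℕ) = l.sum + a ∧ x⁻¹ v < x⁻¹ u := by
  obtain ⟨i, hlt⟩ := exists_descR (inv_ne_one.2 hne)
  have hin := i.2
  obtain ⟨l, r, a, b, hc, hsum⟩ := exists_split (c := c) (i := i) fun h =>
    absurd hlt (not_lt.2 (hx.inv.lt i h).le)
  obtain ⟨ha, -, -⟩ := blocks_facts hc
  refine ⟨l, r, a, b, ⟨l.sum, by omega⟩, hi i, hc, rfl, by simp only [hi]; omega, ?_⟩
  by_contra hge
  rcases lt_or_eq_of_le (not_lt.1 hge) with h1 | h1
  · have := hx.inv_lt_of_lt hc rfl (v := hi i) (w := lo i) (by simp only [hi]; omega)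
      (by simp only [lo]; omega) h1
    exact absurd hlt (not_lt.2 this.le)
  · have := congrArg Fin.val (x⁻¹.injective h1)
    simp only [hi] at this
    omega

end

/-! ### Longest elements -/

lemma longest_mul_self (J : Finset (Fin (n - 1))) : longest J * longest J = 1 :=
  mul_eq_one_iff_eq_inv.2 (longest_inv J).symm

lemma eq_longest_conj {s t : Equiv.Perm (Fin n)} (h : t = longest J * s * longest J) :
    s = longest J * t * longest J := by
  rw [h, mul_assoc, mul_assoc, longest_mul_self, mul_one, ← mul_assoc, longest_mul_self, one_mul]

/-- This version of `parabolic_le` also covers walls at `0` or at least `n`, where no generator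
exists and nothing needs to be preserved. -/
lemma parabolic_lt {w : Equiv.Perm (Fin n)} (hw : w ∈ parabolic J) {v : ℕ}
    (hv : ∀ k : Fin (n - 1), (k : ℕ) + 1 = v → k ∉ J) (z : Fin n) :
    (w z : ℕ) < v ↔ (z : ℕ) < v := by
  have h1 := z.2
  have h2 := (w z).2
  rcases Nat.eq_zero_or_pos v with h0 | h0
  · omega
  rcases Nat.lt_or_ge v n with hn | hn
  · have := parabolic_le hw (hv ⟨v - 1, by omega⟩ (by simp only; omega)) z
    rw [Fin.le_def, Fin.le_def] at this
    simp only [lo] at this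
    omega
  · omega

/-- A strictly decreasing self-map of an interval is its reversal: descending from the left end
bounds each value above, and climbing from the right end bounds it below by the same number. -/
lemma apply_of_descending {w : Equiv.Perm (Fin n)} {P Q : ℕ} (hQ : Q ≤ n)
    (hw : ∀ z : Fin n, P ≤ z → (z : ℕ) < Q → P ≤ w z ∧ (w z : ℕ) < Q)
    (hdesc : ∀ i : Fin (n - 1), P ≤ i → (i : ℕ) + 1 < Q → w (hi i) < w (lo i))
    (z : Fin n) (h1 : P ≤ z) (h2 : (z : ℕ) < Q) : (w z : ℕ) + z + 1 = P + Q := by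
  have upper : ∀ (t : ℕ) (ht : P + t < Q), (w ⟨P + t, by omega⟩ : ℕ) + t + 1 ≤ Q := by
    intro t
    induction t with
    | zero =>
      intro ht
      exact (hw ⟨P, by omega⟩ le_rfl ht).2
    | succ t ih =>
      intro ht
      have h3 := ih (by omega)
      have h4 : (w ⟨P + (t + 1), _⟩ : ℕ) < w ⟨P + t, _⟩ :=
        hdesc ⟨P + t, by omega⟩ (by simp) (by simp only; omega)
      omega
  have lower : ∀ (t : ℕ) (ht : P + t < Q), P + t ≤ w ⟨Q - 1 - t, by omega⟩ := by
    intro t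
    induction t with
    | zero =>
      intro ht
      exact (hw ⟨Q - 1, by omega⟩ (by simp only; omega) (by simp only; omega)).1
    | succ t ih =>
      intro ht
      have h3 := ih (by omega)
      have h4 := hdesc ⟨Q - 1 - (t + 1), by omega⟩ (by simp only; omega) (by simp only; omega)
      have e : hi (⟨Q - 1 - (t + 1), by omega⟩ : Fin (n - 1)) = ⟨Q - 1 - t, by omega⟩ :=
        Fin.ext (by simp only [hi]; omega)
      rw [e, Fin.lt_def] at h4
      simp only [lo] at h4
      omega
  have h3 := upper (z - P) (by omega)
  have h4 := lower (Q - 1 - z) (by omega)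
  have e1 : (⟨P + (z - P), by omega⟩ : Fin n) = z := Fin.ext (by simp only; omega)
  have e2 : (⟨Q - 1 - (Q - 1 - z), by omega⟩ : Fin n) = z := Fin.ext (by simp only; omega)
  rw [e1] at h3
  rw [e2] at h4
  omega

lemma AbsR.gt {w : Equiv.Perm (Fin n)} (hw : AbsR J w) {i : Fin (n - 1)} (hi' : i ∈ J) :
    w (hi i) < w (lo i) := by
  by_contra h
  have hlt : w (lo i) < w (hi i) :=
    lt_of_le_of_ne (not_lt.1 h) fun e => (lo_lt_hi i).ne (w.injective e)
  have h1 := len_mul_simple hlt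
  have h2 := hw i hi'
  rw [starRight, if_pos (ascR_iff.2 hlt)] at h2
  rw [h2] at h1
  omega

section

variable {c d : Composition n} {l r : List ℕ} {a b : ℕ} {s t : Fin (n - 1)}

lemma longest_insert_lt (hs : (s : ℕ) + 1 = l.sum + a) {v : ℕ}
    (hv : IsCut c.blocks v) (hne : v ≠ l.sum + a) (z : Fin n) :
    (longest (insert s (subsetOf c)) z : ℕ) < v ↔ (z : ℕ) < v := by
  refine parabolic_lt (longest_mem _) (fun k hk => ?_) z
  rw [Finset.mem_insert, not_or, mem_subsetOf, not_not, hk]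
  exact ⟨fun e => hne (by rw [← hk, ← hs, e]), hv⟩

/-- On the union of two merged blocks, the longest element is the reversal. -/
lemma longest_insert_apply (hc : c.blocks = l ++ a :: b :: r) (hs : (s : ℕ) + 1 = l.sum + a)
    (z : Fin n) (h1 : l.sum ≤ z) (h2 : (z : ℕ) < l.sum + a + b) :
    (longest (insert s (subsetOf c)) z : ℕ) + z + 1 = l.sum + (l.sum + a + b) := by
  obtain ⟨ha, hb, hn⟩ := blocks_facts hc
  refine apply_of_descending (by omega) (fun z h3 h4 => ?_) (fun i h3 h4 => ?_) z h1 h2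
  · have h5 := longest_insert_lt hs (v := l.sum) (by
      rw [hc, isCut_append_cons_cons]; exact Or.inl (isCut_sum l)) (by omega) z
    have h6 := longest_insert_lt hs (v := l.sum + a + b) (by
      rw [hc, isCut_append_cons_cons]
      exact Or.inr (Or.inr ⟨le_rfl, by rw [Nat.sub_self]; exact isCut_zero r⟩)) (by omega) z
    omega
  · refine (absR_longest _).gt ?_
    rw [Finset.mem_insert, or_iff_not_imp_left, mem_subsetOf, hc, isCut_append_cons_cons]
    rintro hne (h5 | h5 | h5)
    · have := h5.le
      omega
    · exact hne (Fin.ext (by omega))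
    · omega

/-- The reversal of the merged block and the block swap both send its first `a` letters to its last
`a` places. They differ only by rearrangements inside the blocks of `c`. -/
lemma inv_blockSwap_mul_longest_mem (hc : c.blocks = l ++ a :: b :: r)
    (hs : (s : ℕ) + 1 = l.sum + a) (h : l.sum + a + b ≤ n) :
    (blockSwap l.sum a b h)⁻¹ * longest (insert s (subsetOf c)) ∈ parabolic (subsetOf c) := by
  obtain ⟨ha, hb, -⟩ := blocks_facts hc
  apply mem_parabolic_of
  intro k hk z
  rw [mem_subsetOf, not_not] at hk
  have h1 := longest_insert_lt hs (v := l.sum) (by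
      rw [hc, isCut_append_cons_cons]; exact Or.inl (isCut_sum l)) (by omega) z
  have h2 := longest_insert_lt hs (v := l.sum + a + b) (by
      rw [hc, isCut_append_cons_cons]
      exact Or.inr (Or.inr ⟨le_rfl, by rw [Nat.sub_self]; exact isCut_zero r⟩)) (by omega) z
  have h3 := longest_insert_apply hc hs z
  have h4 := fun hne => longest_insert_lt hs hk hne z
  rw [hc, isCut_append_cons_cons] at hk
  have hk : (k : ℕ) + 1 ≤ l.sum ∨ (k : ℕ) + 1 = l.sum + a ∨ l.sum + a + b ≤ k + 1 := by
    rcases hk with hk | hk | hk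
    · exact Or.inl hk.le
    · exact Or.inr (Or.inl hk)
    · exact Or.inr (Or.inr hk.1)
  rw [Equiv.Perm.mul_apply, blockSwap_inv h (by omega), Fin.le_def, Fin.le_def, blockSwap_val]
  simp only [lo]
  generalize ((longest (insert s (subsetOf c)) z : Fin n) : ℕ) = y at *
  unfold blockMove
  split_ifs <;> omega

/-- Reversal of the merged block turns the wall at distance `a` from its left end into the wall at
distance `b`, exchanging the lower and upper letter. -/
lemma simple_eq_longest_conj (hc : c.blocks = l ++ a :: b :: r)
    (hs : (s : ℕ) + 1 = l.sum + a) (ht : (t : ℕ) + 1 = l.sum + b) :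
    simple t = longest (insert s (subsetOf c)) * simple s * longest (insert s (subsetOf c)) := by
  obtain ⟨ha, hb, -⟩ := blocks_facts hc
  have h1 := longest_insert_apply hc hs (lo s) (by simp only [lo]; omega) (by simp only [lo]; omega)
  have h2 := longest_insert_apply hc hs (hi s) (by simp only [hi]; omega) (by simp only [hi]; omega)
  have e1 : longest (insert s (subsetOf c)) (lo s) = hi t := Fin.ext (by
    simp only [lo, hi] at h1 ⊢; omega)
  have e2 : longest (insert s (subsetOf c)) (hi s) = lo t := Fin.ext (by
    simp only [lo, hi] at h2 ⊢; omega)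
  rw [simple, simple, Equiv.mul_swap_eq_swap_mul, e1, e2, mul_assoc, longest_mul_self, mul_one,
    Equiv.swap_comm]

lemma simple_injective : Function.Injective (simple : Fin (n - 1) → Equiv.Perm (Fin n)) := by
  intro i j h
  have h1 := simple_lo i
  rw [h, simple, Equiv.swap_apply_def] at h1
  rw [Fin.ext_iff, apply_ite Fin.val, apply_ite Fin.val] at h1
  simp only [lo, hi, Fin.mk.injEq] at h1
  apply Fin.ext
  split_ifs at h1 <;> omega

/-- The two compositions share all walls except the one between the exchanged blocks. Adjoining `s`
removes the old wall and deleting `t` creates the new one; they may coincide. -/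
lemma subsetOf_swapped (hc : c.blocks = l ++ a :: b :: r) (hd : d.blocks = l ++ b :: a :: r)
    (hs : (s : ℕ) + 1 = l.sum + a) (ht : (t : ℕ) + 1 = l.sum + b) :
    subsetOf d = (insert s (subsetOf c)).erase t := by
  obtain ⟨ha, hb, -⟩ := blocks_facts hc
  ext k
  rw [Finset.mem_erase, Finset.mem_insert, mem_subsetOf, mem_subsetOf, hc, hd,
    isCut_append_cons_cons, isCut_append_cons_cons, Ne, Fin.ext_iff, Fin.ext_iff,
    add_right_comm l.sum b a]
  have hle : IsCut l (k + 1) → (k : ℕ) + 1 ≤ l.sum := IsCut.le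
  by_cases h1 : (k : ℕ) = s <;> by_cases h2 : (k : ℕ) = t <;> by_cases h3 : IsCut l (k + 1) <;>
    by_cases h4 : IsCut r (k + 1 - (l.sum + a + b)) <;>
    simp only [h3, h4, true_implies, false_or, true_or, not_true_eq_false, false_iff, and_true,
      and_false, or_false] at hle ⊢ <;>
    omega

/-- The target is defined by filtering on the reflection `w_M s w_M`. Since distinct indices give
distinct reflections, the filter removes exactly the index `t` of the new wall. -/
lemma atomicTarget_subsetOf (hc : c.blocks = l ++ a :: b :: r)
    (hd : d.blocks = l ++ b :: a :: r) (hl : l.length < (subsetOf c)ᶜ.card) :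
    atomicTarget (subsetOf c) ⟨l.length, hl⟩ = subsetOf d := by
  obtain ⟨ha, hb, hn⟩ := blocks_facts hc
  obtain ⟨hl', hs⟩ := outer_subsetOf hc
  have ht : ((⟨l.sum + b - 1, by omega⟩ : Fin (n - 1)) : ℕ) + 1 = l.sum + b := by
    simp only; omega
  rw [subsetOf_swapped hc hd hs ht, atomicTarget, atomicTop,
    ← simple_eq_longest_conj hc hs ht, Finset.filter_congr (q := (· ≠ _))
      (fun k _ => simple_injective.ne_iff), Finset.filter_ne']

lemma mk_longest_insert (hc : c.blocks = l ++ a :: b :: r) (hs : (s : ℕ) + 1 = l.sum + a)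
    (h : l.sum + a + b ≤ n) :
    Coset.mk I (subsetOf c) (longest (insert s (subsetOf c))) =
      Coset.mk I (subsetOf c) (blockSwap l.sum a b h) := by
  rw [eq_comm, Coset.mk_eq_iff]
  exact ⟨1, Subgroup.one_mem _, _, inv_blockSwap_mul_longest_mem hc hs h, by simp⟩

end

/-! ### Cosets of block permutations -/

lemma Coset.mk_mul_longest (x : Equiv.Perm (Fin n)) :
    Coset.mk I J (x * longest J) = Coset.mk I J x := by
  rw [eq_comm, Coset.mk_eq_iff]
  exact ⟨1, Subgroup.one_mem _, _, longest_mem J, by simp⟩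

/-- Since `x` is increasing on blocks, lengths add in `x v` for `v` in `W_J`, and `x w_J` is longest
among these. Left multiplication by a generator of `I` stays in the same set by
`Matches.simple_mul`, so `x w_J` absorbs on both sides. -/
lemma Matches.max_mk (hx : Matches J I x) : (Coset.mk I J x).max = x * longest J := by
  rw [← Coset.mk_mul_longest]
  have key : ∀ v ∈ parabolic J, len (x * v) ≤ len (x * longest J) := fun v hv => by
    rw [len_mul_parabolic hx.lt hv, len_mul_parabolic hx.lt (longest_mem J)]
    have := len_le_longest hv
    omega
  refine Coset.max_mk_of_abs (fun i hi' => if_neg (not_lt.2 ?_))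
    (fun j hj => if_neg (not_lt.2 ?_))
  · obtain ⟨j, hj, e⟩ := hx.simple_mul hi'
    rw [← mul_assoc, ← e, mul_assoc]
    exact key _ (Subgroup.mul_mem _ (simple_mem hj) (longest_mem J))
  · rw [mul_assoc]
    exact key _ (Subgroup.mul_mem _ (longest_mem J) (simple_mem hj))

/-- The longest element `w_J` contributed by the left factor is absorbed by the right factor, which
is already maximal on its left. -/
lemma Matches.star_max (hx : Matches J I x) (hy : Matches K J y) :
    star (Coset.mk I J x).max (Coset.mk J K y).max = star (star x y) (longest K) := by
  have h1 := absL_max (Coset.mk J K y)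
  rw [hx.max_mk, ← star_eq_mul_of_len' (len_mul_parabolic hx.lt (longest_mem J)), star_assoc,
    star_absL h1 (longest_mem J), hy.max_mk,
    ← star_eq_mul_of_len' (len_mul_parabolic hy.lt (longest_mem K)), star_assoc]

/-- The length of `w_J` cancels from the numerical criterion. What remains says that `x`, `y` and
`w_K` multiply in the Coxeter monoid without loss of length, and `w_K` never causes a loss when `x
y` does not. -/
lemma Matches.isReduced_iff (hx : Matches J I x) (hy : Matches K J y) :
    (Coset.mk I J x).IsReduced (Coset.mk J K y) ↔ len (x * y) = len x + len y := by
  rw [Coset.isReduced_iff, hx.star_max hy, hx.max_mk, hy.max_mk,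
    len_mul_parabolic hx.lt (longest_mem J), len_mul_parabolic hy.lt (longest_mem K)]
  have h1 := len_star_le x y
  have h2 := len_star_le (star x y) (longest K)
  constructor
  · intro h
    have h3 : len (star x y) = len x + len y := by omega
    rw [← star_eq_mul_of_len h3, h3]
  · intro h
    rw [star_eq_mul_of_len' h,
      star_eq_mul_of_len' (len_mul_parabolic (hx.mul hy).lt (longest_mem K)),
      len_mul_parabolic (hx.mul hy).lt (longest_mem K)]
    omega

lemma Matches.star_mk (hx : Matches J I x) (hy : Matches K J y)
    (h : len (x * y) = len x + len y) :
    (Coset.mk I J x).star (Coset.mk J K y) = Coset.mk I K (x * y) := by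
  rw [Coset.star, hx.star_max hy, star_eq_mul_of_len' h,
    star_eq_mul_of_len' (len_mul_parabolic (hx.mul hy).lt (longest_mem K)),
    Coset.mk_mul_longest]

/-- The longest element of the coset determines `x` after cancelling `w_J`. -/
lemma Matches.eq_of_mk_eq (hx : Matches J I x) (hy : Matches J I y)
    (h : Coset.mk I J x = Coset.mk I J y) : x = y := by
  have h1 := hx.max_mk
  rw [h, hy.max_mk] at h1
  exact (mul_right_cancel h1).symm

end

noncomputable section

variable {n : ℕ}

/-! ### Paths of crossings -/

lemma len_mul_le (x y : Equiv.Perm (Fin n)) : len (x * y) ≤ len x + len y := by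
  have := prod_mul_le (reducedWord x) y
  rwa [prod_reducedWord, len_reducedWord] at this

/-- The permutation exchanging the blocks in positions `i` and `i + 1`. -/
def crossPerm (c : Composition n) (i : ℕ) : Equiv.Perm (Fin n) :=
  -- The bound holds at every actual crossing, so the default value plays no role there.
  if h : (c.blocks.take i).sum + c.blocks.getD i 0 + c.blocks.getD (i + 1) 0 ≤ n then
    blockSwap _ _ _ h else 1

lemma crossPerm_eq {c : Composition n} {l r : List ℕ} {a b i P : ℕ}
    (hc : c.blocks = l ++ a :: b :: r) (hl : l.length = i) (hP : l.sum = P)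
    (h : P + a + b ≤ n) : crossPerm c i = blockSwap P a b h := by
  subst hl hP
  have h1 : (c.blocks.take l.length).sum = l.sum := by simp [hc]
  have h2 : c.blocks.getD l.length 0 = a := by simp [hc]
  have h3 : c.blocks.getD (l.length + 1) 0 = b := by simp [hc]
  simp only [crossPerm, h1, h2, h3, dif_pos h]

lemma matches_crossPerm {c d : Composition n} {i : ℕ} (h : IsCrossing i c d) :
    Matches (subsetOf c) (subsetOf d) (crossPerm c i) := by
  obtain ⟨l, r, a, b, hl, hc, hd⟩ := h
  obtain ⟨-, -, hn⟩ := blocks_facts hc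
  rw [crossPerm_eq hc hl rfl (by omega)]
  exact matches_blockSwap hc hd rfl _

/-- The permutation of the letters effected by a path of crossings. -/
def pathPerm {c : Strands n} : ∀ {d : Strands n}, Quiver.Path c d → Equiv.Perm (Fin n)
  | _, .nil => 1
  | _, .cons (b := z) p e => crossPerm z.labels e.1 * pathPerm p

/-- The sum of the lengths of the crossings in a path. -/
def weight {c : Strands n} : ∀ {d : Strands n}, Quiver.Path c d → ℕ
  | _, .nil => 0
  | _, .cons (b := z) p e => weight p + len (crossPerm z.labels e.1)

/-- The lengths of the crossings in the path add up. -/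
def ReducedPath {c d : Strands n} (p : Quiver.Path c d) : Prop := len (pathPerm p) = weight p

lemma pathPerm_comp {c d e : Strands n} (p : Quiver.Path c d) (q : Quiver.Path d e) :
    pathPerm (p.comp q) = pathPerm q * pathPerm p := by
  induction q with
  | nil => exact (one_mul _).symm
  | cons q f ih => simp only [Quiver.Path.comp_cons, pathPerm, ih, mul_assoc]

lemma weight_comp {c d e : Strands n} (p : Quiver.Path c d) (q : Quiver.Path d e) :
    weight (p.comp q) = weight p + weight q := by
  induction q with
  | nil => rfl
  | cons q f ih => simp only [Quiver.Path.comp_cons, weight, ih, add_assoc]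

lemma len_pathPerm_le {c d : Strands n} (p : Quiver.Path c d) : len (pathPerm p) ≤ weight p := by
  induction p with
  | nil => exact len_one.le
  | cons p e ih =>
    simp only [pathPerm, weight]
    refine (len_mul_le _ _).trans ?_
    omega

lemma matches_pathPerm {c d : Strands n} (p : Quiver.Path c d) :
    Matches (subsetOf c.labels) (subsetOf d.labels) (pathPerm p) := by
  induction p with
  | nil => exact Matches.one _
  | cons p e ih => exact (matches_crossPerm e.2).mul ih

/-- The length of the permutation never exceeds the weight, and length is subadditive. Equality for
the composite therefore forces equality at each stage. -/
lemma reducedPath_comp_iff {c d e : Strands n} (p : Quiver.Path c d) (q : Quiver.Path d e) :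
    ReducedPath (p.comp q) ↔ ReducedPath p ∧ ReducedPath q ∧
      len (pathPerm q * pathPerm p) = len (pathPerm q) + len (pathPerm p) := by
  have h1 := len_pathPerm_le p
  have h2 := len_pathPerm_le q
  have h3 := len_mul_le (pathPerm q) (pathPerm p)
  rw [ReducedPath, ReducedPath, ReducedPath, pathPerm_comp, weight_comp]
  omega

/-- The prefix length and sum enter through equations, so that different expressions for a prefix
with the same sum give literally comparable swaps. -/
lemma pathPerm_comp_crossing {c d e : Strands n} {l r : List ℕ} {a b i P : ℕ}
    (p : Quiver.Path c d) (h : IsCrossing i d.labels e.labels)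
    (hd : d.labels.blocks = l ++ a :: b :: r) (hl : l.length = i) (hP : l.sum = P)
    (hn : P + a + b ≤ n) :
    pathPerm (p.comp (crossing i h)) = blockSwap P a b hn * pathPerm p := by
  rw [← crossPerm_eq hd hl hP]
  rfl

lemma weight_comp_crossing {c d e : Strands n} {l r : List ℕ} {a b i : ℕ}
    (p : Quiver.Path c d) (h : IsCrossing i d.labels e.labels)
    (hd : d.labels.blocks = l ++ a :: b :: r) (hl : l.length = i) :
    weight (p.comp (crossing i h)) = weight p + a * b := by
  obtain ⟨-, -, hn⟩ := blocks_facts hd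
  rw [← len_blockSwap (n := n) (P := l.sum) (a := a) (b := b) (by omega),
    ← crossPerm_eq hd hl rfl]
  rfl

lemma pathPerm_crossing {c d : Strands n} {l r : List ℕ} {a b i P : ℕ}
    (h : IsCrossing i c.labels d.labels) (hc : c.labels.blocks = l ++ a :: b :: r)
    (hl : l.length = i) (hP : l.sum = P) (hn : P + a + b ≤ n) :
    pathPerm (crossing i h) = blockSwap P a b hn := by
  rw [← Quiver.Path.nil_comp (crossing i h), pathPerm_comp_crossing _ h hc hl hP hn]
  exact mul_one _

lemma weight_crossing {c d : Strands n} {l r : List ℕ} {a b i : ℕ}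
    (h : IsCrossing i c.labels d.labels) (hc : c.labels.blocks = l ++ a :: b :: r)
    (hl : l.length = i) : weight (crossing i h) = a * b := by
  rw [← Quiver.Path.nil_comp (crossing i h), weight_comp_crossing _ h hc hl]
  exact Nat.zero_add _

lemma IsCrossing.blocks_eq {c d : Composition n} {l r : List ℕ} {a b i : ℕ}
    (h : IsCrossing i c d) (hc : c.blocks = l ++ a :: b :: r) (hl : l.length = i) :
    d.blocks = l ++ b :: a :: r := by
  obtain ⟨l', r', a', b', hl', hc', hd⟩ := h
  obtain ⟨rfl, h3⟩ := List.append_inj (hc.symm.trans hc') (hl.trans hl'.symm)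
  simp only [List.cons.injEq] at h3
  obtain ⟨rfl, rfl, rfl⟩ := h3
  exact hd

lemma IsCrossing.symm {c d : Composition n} {i : ℕ} (h : IsCrossing i c d) : IsCrossing i d c := by
  obtain ⟨l, r, a, b, hl, hc, hd⟩ := h
  exact ⟨l, r, b, a, hl, hd, hc⟩

lemma Strands.ext_blocks {c d : Strands n} (h : c.labels.blocks = d.labels.blocks) : c = d := by
  cases c
  cases d
  exact congrArg Strands.mk (Composition.ext h)

/-- Every block permutation is realized by a reduced path of crossings. -/
lemma exists_reducedPath {c : Strands n} (d : Strands n) {x : Equiv.Perm (Fin n)}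
    (hx : Matches (subsetOf c.labels) (subsetOf d.labels) x) :
    ∃ p : Quiver.Path c d, pathPerm p = x ∧ ReducedPath p := by
  induction hk : len x using Nat.strong_induction_on generalizing d x with
  | _ k ih =>
    by_cases hne : x = 1
    · subst hne
      have e : c = d := by
        cases c
        cases d
        exact congrArg Strands.mk (subsetOf_injective hx.eq_of_one)
      subst e
      exact ⟨.nil, rfl, len_one⟩
    · obtain ⟨l, r, a, b, u, v, hd, hu, hv, hlt⟩ := hx.exists_gt hne
      obtain ⟨ha, hb, hn⟩ := blocks_facts hd
      obtain ⟨d', hd'⟩ := exists_swapped hd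
      have hab := Nat.mul_pos ha hb
      have hn1 : l.sum + a + b ≤ n := by omega
      have hn2 : l.sum + b + a ≤ n := by omega
      -- Uncrossing two blocks in decreasing order shortens `x`, so induction supplies a reduced
      -- path for the rest. Crossing them back restores exactly the lost length.
      have hlen := hx.len_eq_of_gt hd rfl hn1 hu hv hlt
      obtain ⟨p, hp, hp'⟩ := ih _ (by omega) ⟨d'⟩ ((matches_blockSwap hd hd' rfl hn1).mul hx) rfl
      have hcr : IsCrossing l.length d' d.labels := ⟨l, r, b, a, rfl, hd', hd⟩
      have e1 := pathPerm_comp_crossing (d := ⟨d'⟩) p hcr hd' rfl rfl hn2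
      have e2 := weight_comp_crossing (d := ⟨d'⟩) p hcr hd' rfl
      have e3 : pathPerm (p.comp (crossing (c := ⟨d'⟩) _ hcr)) = x := by
        rw [e1, hp, ← mul_assoc, blockSwap_mul_blockSwap, one_mul]
      refine ⟨_, e3, ?_⟩
      rw [ReducedPath, hp] at hp'
      rw [ReducedPath, e3, e2, ← hp', hlen, mul_comm]

/-! ### The word property in the labeled nilCoxeter algebroid -/

/-- The class of a path of crossings in `NC(n)`. -/
def pathClass (R : Type u) [CommRing R] {c d : Strands n} (p : Quiver.Path c d) :
    (⟨c⟩ : NC R n) ⟶ ⟨d⟩ :=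
  Presented.toHom (⟨c⟩ : NC R n) ⟨d⟩ (Finsupp.single p 1)

section

variable {R : Type u} [CommRing R]

lemma pathClass_comp {c d e : Strands n} (p : Quiver.Path c d) (q : Quiver.Path d e) :
    pathClass R (p.comp q) = pathClass R p ≫ pathClass R q := by
  change _ = Presented.homComp _ _ _ _ _
  rw [pathClass, pathClass, pathClass, Presented.homComp_toHom, Presented.pathComp_single]

lemma toHom_relator {c d : Strands n} {y : Quiver.Path c d →₀ R} (h : NilRelator R n c d y) :
    Presented.toHom (⟨c⟩ : NC R n) ⟨d⟩ y = 0 := by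
  rw [Presented.toHom_eq_zero_iff]
  refine Submodule.subset_span ⟨c, d, Finsupp.single .nil 1, y, Finsupp.single .nil 1, h, ?_⟩
  rw [Presented.pathComp_nil_left, Presented.pathComp_nil_right]

lemma pathClass_braid (i : ℕ) {c c₁ c₂ d₁ d₂ d : Strands n}
    (h₁ : IsCrossing i c.labels c₁.labels) (h₂ : IsCrossing (i + 1) c₁.labels c₂.labels)
    (h₃ : IsCrossing i c₂.labels d.labels)
    (k₁ : IsCrossing (i + 1) c.labels d₁.labels) (k₂ : IsCrossing i d₁.labels d₂.labels)
    (k₃ : IsCrossing (i + 1) d₂.labels d.labels) :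
    pathClass R (((crossing i h₁).comp (crossing (i + 1) h₂)).comp (crossing i h₃)) =
      pathClass R (((crossing (i + 1) k₁).comp (crossing i k₂)).comp (crossing (i + 1) k₃)) := by
  have := toHom_relator (NilRelator.braid (R := R) i h₁ h₂ h₃ k₁ k₂ k₃)
  rwa [map_sub, sub_eq_zero] at this

lemma pathClass_comm (i j : ℕ) (hij : i + 1 < j ∨ j + 1 < i) {c c₁ d₁ d : Strands n}
    (h₁ : IsCrossing j c.labels c₁.labels) (h₂ : IsCrossing i c₁.labels d.labels)
    (k₁ : IsCrossing i c.labels d₁.labels) (k₂ : IsCrossing j d₁.labels d.labels) :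
    pathClass R ((crossing j h₁).comp (crossing i h₂)) =
      pathClass R ((crossing i k₁).comp (crossing j k₂)) := by
  have := toHom_relator (NilRelator.comm (R := R) i j hij h₁ h₂ k₁ k₂)
  rwa [map_sub, sub_eq_zero] at this

lemma pathClass_nil (i : ℕ) {c c₁ d : Strands n}
    (h₁ : IsCrossing i c.labels c₁.labels) (h₂ : IsCrossing i c₁.labels d.labels) :
    pathClass R ((crossing i h₁).comp (crossing i h₂)) = 0 :=
  toHom_relator (NilRelator.nil (R := R) i h₁ h₂)

/-- Reduced paths from `c` whose permutations agree and have length less than `N` have the same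
class. -/
def WordProperty (R : Type u) [CommRing R] (c : Strands n) (N : ℕ) : Prop :=
  ∀ (d : Strands n) (p q : Quiver.Path c d), len (pathPerm p) < N → ReducedPath p →
    ReducedPath q → pathPerm p = pathPerm q → pathClass R p = pathClass R q

/-- Both last crossings lengthen, so `C`, `B`, `A` stand in this order at the source, the reverse of
their order in `d`. Hence the permutation factors reducedly through the composition `z` with blocks
`C, B, A`. The two routes from `z` to `d` are the two sides of the braid relation, and the induction
hypothesis identifies `p` and `q` with their initial parts. -/
lemma pathClass_eq_of_braid {c d d₁ d₂ : Strands n} {l r : List ℕ} {A B C i : ℕ}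
    (hl : l.length = i) (hd : d.labels.blocks = l ++ A :: B :: C :: r)
    (hd₁ : d₁.labels.blocks = l ++ B :: A :: C :: r)
    (hd₂ : d₂.labels.blocks = l ++ A :: C :: B :: r)
    (p : Quiver.Path c d₁) (q : Quiver.Path c d₂)
    (h₁ : IsCrossing i d₁.labels d.labels) (h₂ : IsCrossing (i + 1) d₂.labels d.labels)
    (hp : ReducedPath (p.comp (crossing i h₁))) (hq : ReducedPath (q.comp (crossing (i + 1) h₂)))
    (h : pathPerm (p.comp (crossing i h₁)) = pathPerm (q.comp (crossing (i + 1) h₂)))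
    (IH : WordProperty R c (len (pathPerm (p.comp (crossing i h₁))))) :
    pathClass R (p.comp (crossing i h₁)) = pathClass R (q.comp (crossing (i + 1) h₂)) := by
  obtain ⟨P, hP⟩ : ∃ P, l.sum = P := ⟨_, rfl⟩
  have hd₁' : d₁.labels.blocks = (l ++ [B]) ++ A :: C :: r := by simp [hd₁]
  have hd₂' : d₂.labels.blocks = (l ++ [A]) ++ C :: B :: r := by simp [hd₂]
  obtain ⟨hA, hB, -⟩ := blocks_facts hd
  obtain ⟨-, hC, hn⟩ := blocks_facts hd₁'
  obtain ⟨m, hm⟩ := exists_swapped hd₁'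
  have hm' : m.blocks = l ++ B :: C :: A :: r := by simp [hm]
  obtain ⟨z, hz⟩ := exists_swapped hm'
  have hz' : z.blocks = (l ++ [C]) ++ B :: A :: r := by simp [hz]
  obtain ⟨k, hk⟩ := exists_swapped hz'
  have hk' : k.blocks = l ++ C :: A :: B :: r := by simp [hk]
  have sB : (l ++ [B]).sum = P + B := by simp [hP]
  have sA : (l ++ [A]).sum = P + A := by simp [hP]
  have sC : (l ++ [C]).sum = P + C := by simp [hP]
  have lB : (l ++ [B]).length = i + 1 := by simp [hl]
  have lA : (l ++ [A]).length = i + 1 := by simp [hl]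
  have lC : (l ++ [C]).length = i + 1 := by simp [hl]
  rw [sB] at hn
  -- the permutations and weights of the two given paths
  have ep := pathPerm_comp_crossing p h₁ hd₁ hl hP (by omega)
  have eq := pathPerm_comp_crossing q h₂ hd₂' lA sA (by omega)
  have wp := weight_comp_crossing p h₁ hd₁ hl
  have wq := weight_comp_crossing q h₂ hd₂' lA
  obtain ⟨rp, -, lp⟩ := (reducedPath_comp_iff _ _).1 hp
  obtain ⟨rq, -, lq⟩ := (reducedPath_comp_iff _ _).1 hq
  have mp := matches_pathPerm p
  have mq := matches_pathPerm q
  rw [ReducedPath] at rp rq hp hq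
  have hAB := Nat.mul_pos hB hA
  have hCB := Nat.mul_pos hC hB
  -- This records that `B` precedes `A` at the source, and `asc₂` that `C` precedes `B`. Both are
  -- then transported to the common permutation `x`.
  have asc₁ := mp.lt_of_len hd₁ hP (u := ⟨P, by omega⟩) (v := ⟨P + B, by omega⟩)
    (by omega) rfl rfl (by rw [← ep]; omega)
  have asc₂ := mq.lt_of_len hd₂' sA (u := ⟨P + A, by omega⟩) (v := ⟨P + A + C, by omega⟩)
    (by omega) rfl rfl (by rw [← eq]; omega)
  set x := pathPerm (p.comp (crossing i h₁)) with hx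
  have ep' : pathPerm p = blockSwap P A B (by omega) * x := by
    rw [ep, ← mul_assoc, blockSwap_mul_blockSwap, one_mul]
  have eq' : pathPerm q = blockSwap (P + A) B C (by omega) * x := by
    rw [h, eq, ← mul_assoc, blockSwap_mul_blockSwap, one_mul]
  rw [ep', inv_blockSwap_mul_apply (h' := by omega), inv_blockSwap_mul_apply (h' := by omega)]
    at asc₁
  rw [eq', inv_blockSwap_mul_apply (h' := by omega), inv_blockSwap_mul_apply (h' := by omega)]
    at asc₂
  have move : ∀ {Q a b u v : ℕ} (hQ : Q + a + b ≤ n) (hu : u < n) (hv : v < n),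
      blockMove Q a b u = v → blockSwap Q a b hQ ⟨u, hu⟩ = ⟨v, hv⟩ :=
    fun _ _ _ e => Fin.ext e
  rw [move (v := P + A) (hv := by omega), move (v := P) (hv := by omega)] at asc₁
  rotate_left
  · rw [blockMove_right (by omega) (by omega)]; omega
  · rw [blockMove_left (by omega) (by omega)]
  rw [move (v := P + A + B) (hv := by omega), move (v := P + A) (hv := by omega)] at asc₂
  rotate_left
  · rw [blockMove_right (by omega) (by omega)]; omega
  · rw [blockMove_left (by omega) (by omega)]
  -- uncross the first and the last block, and then the remaining pair
  have len₁ := mp.len_eq_of_gt hd₁' sB (u := ⟨P + B, by omega⟩) (v := ⟨P + B + A, by omega⟩)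
    (by omega) rfl rfl (by
      rw [ep', inv_blockSwap_mul_apply (h' := by omega), inv_blockSwap_mul_apply (h' := by omega),
        move (v := P + A + B) (hv := by omega), move (v := P) (hv := by omega)]
      · exact asc₂.trans asc₁
      · rw [blockMove_right (by omega) (by omega)]; omega
      · rw [blockMove_of_ge (by omega)]; omega)
  have mm := (matches_blockSwap hd₁' hm sB (by omega)).mul mp
  have len₂ := mm.len_eq_of_gt hm' hP (u := ⟨P, by omega⟩) (v := ⟨P + B, by omega⟩)
    (by omega) rfl rfl (by
      rw [inv_blockSwap_mul_apply (h' := by omega), inv_blockSwap_mul_apply (h' := by omega),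
        ep', inv_blockSwap_mul_apply (h' := by omega), inv_blockSwap_mul_apply (h' := by omega),
        move (u := P + B) (v := P + B + A) (hv := by omega), move (u := P) (v := P) (hv := by omega),
        move (v := P + A + B) (hv := by omega), move (v := P + A) (hv := by omega)]
      · exact asc₂
      · rw [blockMove_left (by omega) (by omega)]
      · rw [blockMove_of_ge (by omega)]; omega
      · rw [blockMove_of_lt (by omega)]
      · rw [blockMove_left (by omega) (by omega)])
  obtain ⟨s, hs, rs⟩ := exists_reducedPath ⟨z⟩ ((matches_blockSwap hm' hz hP (by omega)).mul mm)
  rw [ReducedPath] at rs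
  have c₁ : IsCrossing i z m := ⟨l, _, _, _, hl, hz, hm'⟩
  have c₂ : IsCrossing (i + 1) m d₁.labels := ⟨_, _, _, _, lB, hm, hd₁'⟩
  have c₃ : IsCrossing (i + 1) z k := ⟨_, _, _, _, lC, hz', hk⟩
  have c₄ : IsCrossing i k d₂.labels := ⟨_, _, _, _, hl, hk', hd₂⟩
  have key := pathClass_braid (R := R) (c := ⟨z⟩) (c₁ := ⟨m⟩) (d₁ := ⟨k⟩) i c₁ c₂ h₁ c₃ c₄ h₂
  have e₁ : pathPerm ((s.comp (crossing (d := ⟨m⟩) i c₁)).comp (crossing (i + 1) c₂)) =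
      pathPerm p := by
    rw [pathPerm_comp_crossing (d := ⟨m⟩) _ _ hm lB sB (by omega),
      pathPerm_comp_crossing (d := ⟨z⟩) _ _ hz hl hP (by omega), hs, ← mul_assoc (blockSwap P C B _),
      blockSwap_mul_blockSwap, one_mul, ← mul_assoc, blockSwap_mul_blockSwap, one_mul]
  have e₂ : pathPerm ((s.comp (crossing (d := ⟨k⟩) (i + 1) c₃)).comp (crossing i c₄)) =
      pathPerm q := by
    -- Restoring the last crossing of `q` turns the claim into a comparison of the two full routes
    -- to `d`, where the braid identity applies.
    apply mul_left_cancel (a := blockSwap (P + A) C B (by omega))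
    rw [← eq, ← h, ep, ← e₁,
      pathPerm_comp_crossing (d := ⟨m⟩) _ _ hm lB sB (by omega),
      pathPerm_comp_crossing (d := ⟨z⟩) _ _ hz hl hP (by omega),
      pathPerm_comp_crossing (d := ⟨k⟩) _ _ hk' hl hP (by omega),
      pathPerm_comp_crossing (d := ⟨z⟩) _ _ hz' lC sC (by omega)]
    simp only [← mul_assoc]
    congr 1
    simp only [mul_assoc]
    exact (blockSwap_braid (by omega)).symm
  have w₁ : weight ((s.comp (crossing (d := ⟨m⟩) i c₁)).comp (crossing (i + 1) c₂)) =
      len (pathPerm p) := by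
    rw [weight_comp_crossing (d := ⟨m⟩) _ _ hm lB, weight_comp_crossing (d := ⟨z⟩) _ _ hz hl,
      ← rs, hs, len₁, len₂, mul_comm A C, mul_comm B C]
  have w₂ : weight ((s.comp (crossing (d := ⟨k⟩) (i + 1) c₃)).comp (crossing i c₄)) =
      len (pathPerm q) := by
    rw [weight_comp_crossing (d := ⟨k⟩) _ _ hk' hl, weight_comp_crossing (d := ⟨z⟩) _ _ hz' lC]
    rw [weight_comp_crossing (d := ⟨m⟩) _ _ hm lB, weight_comp_crossing (d := ⟨z⟩) _ _ hz hl]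
      at w₁
    rw [← h] at hq
    have h1 := mul_comm B A
    have h2 := mul_comm C B
    omega
  -- Both `p` and `q` are strictly shorter than `x`, so the induction hypothesis replaces each by a
  -- path starting with the common piece `s`.
  rw [pathClass_comp, pathClass_comp,
    IH _ p _ (by omega) rp (by rw [ReducedPath, e₁, w₁]) e₁.symm,
    IH _ q _ (by rw [← h] at hq; omega) rq (by rw [ReducedPath, e₂, w₂]) e₂.symm,
    ← pathClass_comp, ← pathClass_comp, Quiver.Path.comp_assoc, Quiver.Path.comp_assoc,
    Quiver.Path.comp_assoc, Quiver.Path.comp_assoc, pathClass_comp s, pathClass_comp s,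
    ← Quiver.Path.comp_assoc, ← Quiver.Path.comp_assoc, key]

/-- The two last crossings involve disjoint pairs of blocks, so undoing one leaves the other pair in
decreasing order. Undoing both leads to a common composition `z`, from which the two routes are
related by commutation. -/
lemma pathClass_eq_of_comm {c d d₁ d₂ : Strands n} {l m r : List ℕ} {A B C D i j : ℕ}
    (hl : l.length = i) (hj : (l ++ B :: A :: m).length = j)
    (hd : d.labels.blocks = l ++ A :: B :: (m ++ C :: D :: r))
    (hd₁ : d₁.labels.blocks = l ++ B :: A :: (m ++ C :: D :: r))
    (hd₂ : d₂.labels.blocks = l ++ A :: B :: (m ++ D :: C :: r))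
    (p : Quiver.Path c d₁) (q : Quiver.Path c d₂)
    (h₁ : IsCrossing i d₁.labels d.labels) (h₂ : IsCrossing j d₂.labels d.labels)
    (hp : ReducedPath (p.comp (crossing i h₁))) (hq : ReducedPath (q.comp (crossing j h₂)))
    (h : pathPerm (p.comp (crossing i h₁)) = pathPerm (q.comp (crossing j h₂)))
    (IH : WordProperty R c (len (pathPerm (p.comp (crossing i h₁))))) :
    pathClass R (p.comp (crossing i h₁)) = pathClass R (q.comp (crossing j h₂)) := by
  obtain ⟨P, hP⟩ : ∃ P, l.sum = P := ⟨_, rfl⟩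
  obtain ⟨Q, hQ⟩ : ∃ Q, (l ++ A :: B :: m).sum = Q := ⟨_, rfl⟩
  have hQ' : (l ++ B :: A :: m).sum = Q := by rw [← hQ]; simp; omega
  have hj' : (l ++ A :: B :: m).length = j := by rw [← hj]; simp
  have hPQ : P + A + B ≤ Q := by rw [← hQ, ← hP]; simp; omega
  have hPQ' : P + B + A ≤ Q := by omega
  have hd₁' : d₁.labels.blocks = (l ++ B :: A :: m) ++ C :: D :: r := by simp [hd₁]
  have hd₂' : d₂.labels.blocks = (l ++ A :: B :: m) ++ D :: C :: r := by simp [hd₂]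
  obtain ⟨hA, hB, -⟩ := blocks_facts hd
  obtain ⟨hC, hD, hn⟩ := blocks_facts hd₁'
  obtain ⟨z, hz⟩ := exists_swapped hd₁'
  have hz' : z.blocks = l ++ B :: A :: (m ++ D :: C :: r) := by simp [hz]
  rw [hQ'] at hn
  have ep := pathPerm_comp_crossing p h₁ hd₁ hl hP (by omega)
  have eq := pathPerm_comp_crossing q h₂ hd₂' hj' hQ (by omega)
  have wp := weight_comp_crossing p h₁ hd₁ hl
  have wq := weight_comp_crossing q h₂ hd₂' hj'
  obtain ⟨rp, -, lp⟩ := (reducedPath_comp_iff _ _).1 hp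
  obtain ⟨rq, -, lq⟩ := (reducedPath_comp_iff _ _).1 hq
  have mp := matches_pathPerm p
  have mq := matches_pathPerm q
  rw [ReducedPath] at rp rq hp hq
  have hAB := Nat.mul_pos hB hA
  have hCD := Nat.mul_pos hD hC
  have asc₂ := mq.lt_of_len hd₂' hQ (u := ⟨Q, by omega⟩) (v := ⟨Q + D, by omega⟩)
    (by omega) rfl rfl (by rw [← eq]; omega)
  set x := pathPerm (p.comp (crossing i h₁)) with hx
  have ep' : pathPerm p = blockSwap P A B (by omega) * x := by
    rw [ep, ← mul_assoc, blockSwap_mul_blockSwap, one_mul]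
  have eq' : pathPerm q = blockSwap Q C D (by omega) * x := by
    rw [h, eq, ← mul_assoc, blockSwap_mul_blockSwap, one_mul]
  rw [eq', inv_blockSwap_mul_apply (h' := by omega), inv_blockSwap_mul_apply (h' := by omega)]
    at asc₂
  have move : ∀ {Q a b u v : ℕ} (hQ : Q + a + b ≤ n) (hu : u < n) (hv : v < n),
      blockMove Q a b u = v → blockSwap Q a b hQ ⟨u, hu⟩ = ⟨v, hv⟩ :=
    fun _ _ _ e => Fin.ext e
  rw [move (v := Q + C) (hv := by omega), move (v := Q) (hv := by omega)] at asc₂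
  rotate_left
  · rw [blockMove_right (by omega) (by omega)]; omega
  · rw [blockMove_left (by omega) (by omega)]
  have len₁ := mp.len_eq_of_gt hd₁' hQ' (u := ⟨Q, by omega⟩) (v := ⟨Q + C, by omega⟩)
    (by omega) rfl rfl (by
      rw [ep', inv_blockSwap_mul_apply (h' := by omega), inv_blockSwap_mul_apply (h' := by omega),
        move (v := Q + C) (hv := by omega), move (v := Q) (hv := by omega)]
      · exact asc₂
      · rw [blockMove_of_ge (by omega)]
      · rw [blockMove_of_ge (by omega)])
  obtain ⟨s, hs, rs⟩ := exists_reducedPath ⟨z⟩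
    ((matches_blockSwap hd₁' hz hQ' (by omega)).mul mp)
  rw [ReducedPath] at rs
  have c₁ : IsCrossing j z d₁.labels := ⟨_, _, _, _, hj, hz, hd₁'⟩
  have c₂ : IsCrossing i z d₂.labels := ⟨_, _, _, _, hl, hz', hd₂⟩
  have key := pathClass_comm (R := R) (c := ⟨z⟩) i j (Or.inl (by rw [← hj, ← hl]; simp))
    c₁ h₁ c₂ h₂
  have e₁ : pathPerm (s.comp (crossing j c₁)) = pathPerm p := by
    rw [pathPerm_comp_crossing (d := ⟨z⟩) _ _ hz hj hQ' (by omega), hs, ← mul_assoc,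
      blockSwap_mul_blockSwap, one_mul]
  have e₂ : pathPerm (s.comp (crossing i c₂)) = pathPerm q := by
    apply mul_left_cancel (a := blockSwap Q D C (by omega))
    rw [← eq, ← h, ep, ← e₁, pathPerm_comp_crossing (d := ⟨z⟩) _ _ hz hj hQ' (by omega),
      pathPerm_comp_crossing (d := ⟨z⟩) _ _ hz' hl hP (by omega), ← mul_assoc, ← mul_assoc]
    congr 1
    exact (blockSwap_comm hPQ' (by omega)).symm
  have w₁ : weight (s.comp (crossing j c₁)) = len (pathPerm p) := by
    rw [weight_comp_crossing (d := ⟨z⟩) _ _ hz hj, ← rs, hs, len₁, mul_comm D C]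
  have w₂ : weight (s.comp (crossing i c₂)) = len (pathPerm q) := by
    rw [weight_comp_crossing (d := ⟨z⟩) _ _ hz' hl]
    rw [weight_comp_crossing (d := ⟨z⟩) _ _ hz hj] at w₁
    rw [← h] at hq
    omega
  have hlt : len (pathPerm q) < len x := by
    rw [← h] at hq
    omega
  rw [pathClass_comp, pathClass_comp,
    IH _ p _ (by omega) rp (by rw [ReducedPath, e₁, w₁]) e₁.symm,
    IH _ q _ hlt rq (by rw [ReducedPath, e₂, w₂]) e₂.symm,
    ← pathClass_comp, ← pathClass_comp, Quiver.Path.comp_assoc, Quiver.Path.comp_assoc,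
    pathClass_comp s, pathClass_comp s, key]

lemma pathClass_eq_of_lt {c d d₁ d₂ : Strands n} {i j : ℕ} (hij : i < j)
    (p : Quiver.Path c d₁) (q : Quiver.Path c d₂)
    (h₁ : IsCrossing i d₁.labels d.labels) (h₂ : IsCrossing j d₂.labels d.labels)
    (hp : ReducedPath (p.comp (crossing i h₁))) (hq : ReducedPath (q.comp (crossing j h₂)))
    (h : pathPerm (p.comp (crossing i h₁)) = pathPerm (q.comp (crossing j h₂)))
    (IH : WordProperty R c (len (pathPerm (p.comp (crossing i h₁))))) :
    pathClass R (p.comp (crossing i h₁)) = pathClass R (q.comp (crossing j h₂)) := by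
  obtain ⟨l, r, a, b, hl, hd₁, hd⟩ := id h₁
  obtain ⟨l', r', a', b', hl', hd₂, hd'⟩ := id h₂
  -- The two splittings of the blocks of `d` differ by a middle list: one element means that the
  -- crossings share a block, at least two that they are disjoint. The other shapes contradict `i <
  -- j`.
  rcases List.append_eq_append_iff.1 (hd.symm.trans hd') with ⟨m, rfl, hm⟩ | ⟨m, rfl, -⟩
  · rcases m with _ | ⟨x, _ | ⟨y, m⟩⟩
    · simp only [List.append_nil] at hl'
      omega
    · simp only [List.cons_append, List.nil_append, List.cons.injEq] at hm
      obtain ⟨rfl, rfl, rfl⟩ := hm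
      obtain rfl : j = i + 1 := by rw [← hl', ← hl]; simp
      exact pathClass_eq_of_braid hl hd hd₁ (by simp [hd₂]) p q h₁ h₂ hp hq h IH
    · simp only [List.cons_append, List.cons.injEq] at hm
      obtain ⟨rfl, rfl, rfl⟩ := hm
      exact pathClass_eq_of_comm hl (by rw [← hl']; simp) hd hd₁ (by simp [hd₂]) p q h₁ h₂
        hp hq h IH
  · simp only [List.length_append] at hl
    omega

lemma weight_comp_crossing_pos {c d e : Strands n} {i : ℕ} (p : Quiver.Path c d)
    (h : IsCrossing i d.labels e.labels) : 0 < weight (p.comp (crossing i h)) := by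
  obtain ⟨l, r, a, b, hl, hd, -⟩ := id h
  obtain ⟨ha, hb, -⟩ := blocks_facts hd
  have := Nat.mul_pos ha hb
  rw [weight_comp_crossing p h hd hl]
  omega

/-- The induction compares the last crossings of the two paths. Equal ones cancel, and distinct ones
are exchanged by a braid or commutation relation after rewriting the shorter initial parts. -/
lemma wordProperty (R : Type u) [CommRing R] (c : Strands n) (N : ℕ) : WordProperty R c N := by
  induction N with
  | zero => exact fun _ _ _ h => absurd h (Nat.not_lt_zero _)
  | succ N ih =>
    have ih' : ∀ {M}, M < N + 1 → WordProperty R c M := fun hM d p q h =>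
      ih d p q (by omega)
    rintro d p q hN hp hq h
    -- A path with a crossing has positive weight, so if it is reduced its permutation is not the
    -- identity. This excludes the mixed cases.
    rcases p with _ | @⟨d₁, _, p, ⟨i, h₁⟩⟩ <;> rcases q with _ | @⟨d₂, _, q, ⟨j, h₂⟩⟩
    · rfl
    · have h3 := weight_comp_crossing_pos q h₂
      have h4 : len (1 : Equiv.Perm (Fin n)) = weight (q.comp (crossing j h₂)) :=
        (congrArg len h).trans hq
      rw [len_one] at h4
      omega
    · have h3 := weight_comp_crossing_pos p h₁
      have h4 : len (1 : Equiv.Perm (Fin n)) = weight (p.comp (crossing i h₁)) :=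
        (congrArg len h.symm).trans hp
      rw [len_one] at h4
      omega
    · change pathClass R (p.comp (crossing i h₁)) = pathClass R (q.comp (crossing j h₂))
      rcases lt_trichotomy i j with hij | rfl | hij
      · exact pathClass_eq_of_lt hij p q h₁ h₂ hp hq h (ih' hN)
      · obtain ⟨l, r, a, b, hl, hd₁, hd⟩ := id h₁
        have hd₂ := h₂.symm.blocks_eq hd hl
        -- The target and the position of a crossing determine its source.
        obtain rfl : d₁ = d₂ := Strands.ext_blocks (hd₁.trans hd₂.symm)
        obtain ⟨ha, hb, hn⟩ := blocks_facts hd₁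
        have hab := Nat.mul_pos ha hb
        have wp := weight_comp_crossing p h₁ hd₁ hl
        have h4 : pathPerm p = pathPerm q := mul_left_cancel h
        obtain ⟨rp, -, -⟩ := (reducedPath_comp_iff p (crossing i h₁)).1 hp
        obtain ⟨rq, -, -⟩ := (reducedPath_comp_iff q (crossing i h₂)).1 hq
        rw [pathClass_comp, pathClass_comp, ih' hN _ p q ?_ rp rq h4]
        have h5 : len (pathPerm (p.comp (crossing i h₁))) = weight (p.comp (crossing i h₁)) := hp
        change _ < len (pathPerm (p.comp (crossing i h₁)))
        rw [ReducedPath] at rp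
        omega
      · exact (pathClass_eq_of_lt hij q p h₂ h₁ hq hp h.symm (ih' (h ▸ hN))).symm

/-- Reduced paths with the same permutation have the same class. -/
lemma pathClass_eq {c d : Strands n} {p q : Quiver.Path c d} (hp : ReducedPath p)
    (hq : ReducedPath q) (h : pathPerm p = pathPerm q) : pathClass R p = pathClass R q :=
  wordProperty R c _ d p q (Nat.lt_succ_self _) hp hq h

/-- The class of a path that is not reduced vanishes. -/
lemma pathClass_eq_zero {c d : Strands n} {p : Quiver.Path c d} (hp : ¬ ReducedPath p) :
    pathClass R p = 0 := by
  induction p with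
  | nil => exact absurd len_one hp
  | @cons z d p e ih =>
    obtain ⟨i, h⟩ := e
    change pathClass R (p.comp (crossing i h)) = 0
    by_cases rp : ReducedPath p
    · obtain ⟨l, r, a, b, hl, hz, hd⟩ := id h
      obtain ⟨ha, hb, hn⟩ := blocks_facts hz
      have hn₁ : l.sum + a + b ≤ n := by omega
      have hn₂ : l.sum + b + a ≤ n := by omega
      have mp := matches_pathPerm p
      -- If the two blocks were in increasing order, the crossing would add its full length and the
      -- extended path would be reduced.
      have hgt : (pathPerm p)⁻¹ ⟨l.sum + a, by omega⟩ < (pathPerm p)⁻¹ ⟨l.sum, by omega⟩ := by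
        by_contra hge
        rcases lt_or_eq_of_le (not_lt.1 hge) with hlt | he
        · apply hp
          have h1 := mp.len_blockSwap_mul hz hn₁ rfl rfl hlt
          have h2 : len (pathPerm (p.comp (crossing i h))) = weight (p.comp (crossing i h)) := by
            rw [pathPerm_comp_crossing p h hz hl rfl hn₁, weight_comp_crossing p h hz hl, h1, rp]
          exact h2
        · have := congrArg Fin.val ((pathPerm p)⁻¹.injective he)
          simp only at this
          omega
      have hlen := mp.len_eq_of_gt hz rfl hn₁ rfl rfl hgt
      -- The decreasing order allows `p` to be replaced by a reduced path ending in the reverse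
      -- crossing, so that a double crossing appears and the nil relation applies.
      obtain ⟨q, hq, rq⟩ := exists_reducedPath d ((matches_blockSwap hz hd rfl hn₁).mul mp)
      have h' : IsCrossing i d.labels z.labels := h.symm
      have e₁ : pathPerm (q.comp (crossing i h')) = pathPerm p := by
        rw [pathPerm_comp_crossing q h' hd hl rfl hn₂, hq, ← mul_assoc,
          blockSwap_mul_blockSwap, one_mul]
      have e₂ : ReducedPath (q.comp (crossing i h')) := by
        rw [ReducedPath, e₁, weight_comp_crossing q h' hd hl, ← rq, hq, hlen, mul_comm b]
      rw [pathClass_comp, pathClass_eq rp e₂ e₁.symm, ← pathClass_comp, Quiver.Path.comp_assoc,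
        pathClass_comp, pathClass_nil, Limits.comp_zero]
    · rw [pathClass_comp, ih rp, Limits.zero_comp]

end

end

noncomputable section

variable {n : ℕ} {R : Type u} [CommRing R]

/-! ### The functor -/

open Classical in
/-- The basis morphism of a reduced path, and zero for a path that is not reduced. -/
def pathVal (R : Type u) [CommRing R] {c d : Strands n} (p : Quiver.Path c d) :
    Coset (subsetOf d.labels) (subsetOf c.labels) →₀ R :=
  if ReducedPath p then Finsupp.single (Coset.mk _ _ (pathPerm p)) 1 else 0

lemma pathVal_of_reduced {c d : Strands n} {p : Quiver.Path c d} (h : ReducedPath p) :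
    pathVal R p = Finsupp.single (Coset.mk _ _ (pathPerm p)) 1 := if_pos h

lemma pathVal_of_not_reduced {c d : Strands n} {p : Quiver.Path c d} (h : ¬ ReducedPath p) :
    pathVal R p = 0 := if_neg h

/-- The conditions for a reduced composite path are those for the two pieces together with
additivity of length, which is reducedness of the product of cosets. Composition of paths reads left
to right, so the factors are reversed. -/
lemma pathVal_comp {c d e : Strands n} (p : Quiver.Path c d) (q : Quiver.Path d e) :
    pathVal R (p.comp q) = nilComp R _ _ _ (pathVal R q) (pathVal R p) := by
  have h := reducedPath_comp_iff p q
  have hq := matches_pathPerm q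
  have hp := matches_pathPerm p
  by_cases h1 : ReducedPath p
  · by_cases h2 : ReducedPath q
    · rw [pathVal_of_reduced h1, pathVal_of_reduced h2, nilComp_single, demazureComp,
        hq.isReduced_iff hp]
      by_cases h3 : len (pathPerm q * pathPerm p) = len (pathPerm q) + len (pathPerm p)
      · rw [pathVal_of_reduced (h.2 ⟨h1, h2, h3⟩), if_pos h3, hq.star_mk hp h3, pathPerm_comp]
      · rw [pathVal_of_not_reduced fun h4 => h3 (h.1 h4).2.2, if_neg h3]
    · rw [pathVal_of_not_reduced h2, map_zero, LinearMap.zero_apply,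
        pathVal_of_not_reduced fun h4 => h2 (h.1 h4).2.1]
  · rw [pathVal_of_not_reduced h1, map_zero, pathVal_of_not_reduced fun h4 => h1 (h.1 h4).1]

/-- Evaluation of linear combinations of paths. -/
def evalPaths (R : Type u) [CommRing R] (c d : Strands n) :
    (Quiver.Path c d →₀ R) →ₗ[R] (Coset (subsetOf d.labels) (subsetOf c.labels) →₀ R) :=
  Finsupp.linearCombination R (pathVal R)

lemma evalPaths_single {c d : Strands n} (p : Quiver.Path c d) :
    evalPaths R c d (Finsupp.single p 1) = pathVal R p := by
  simp [evalPaths]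

lemma evalPaths_pathComp {c d e : Strands n} (f : Quiver.Path c d →₀ R)
    (g : Quiver.Path d e →₀ R) :
    evalPaths R c e (Presented.pathComp R c d e f g) =
      nilComp R _ _ _ (evalPaths R d e g) (evalPaths R c d f) := by
  induction f using Finsupp.induction_linear with
  | zero => simp
  | add f₁ f₂ h₁ h₂ => simp only [map_add, LinearMap.add_apply, h₁, h₂]
  | single p r =>
    induction g using Finsupp.induction_linear with
    | zero => simp
    | add f₁ f₂ h₁ h₂ => simp only [map_add, LinearMap.add_apply, h₁, h₂]
    | single q s =>
      rw [← mul_one r, ← mul_one s, ← smul_eq_mul, ← smul_eq_mul, ← Finsupp.smul_single,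
        ← Finsupp.smul_single]
      simp only [map_smul, LinearMap.smul_apply, Presented.pathComp_single, evalPaths_single,
        pathVal_comp]
      rw [smul_comm]

/-! ### The relations of `NC(n)` hold in the nilCoxeter algebroid -/

lemma pathVal_congr {c d : Strands n} {p q : Quiver.Path c d} (h : pathPerm p = pathPerm q)
    (h' : weight p = weight q) : pathVal R p = pathVal R q := by
  rw [pathVal, pathVal, ReducedPath, ReducedPath, h, h']

/-- Each side crosses every pair of the three blocks exactly once. The permutations agree by
`blockSwap_braid`, and both weights are the sum of the three pairwise products of block sizes. -/
lemma pathVal_braid (i : ℕ) {c c₁ c₂ d₁ d₂ d : Strands n}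
    (h₁ : IsCrossing i c.labels c₁.labels) (h₂ : IsCrossing (i + 1) c₁.labels c₂.labels)
    (h₃ : IsCrossing i c₂.labels d.labels)
    (k₁ : IsCrossing (i + 1) c.labels d₁.labels) (k₂ : IsCrossing i d₁.labels d₂.labels)
    (k₃ : IsCrossing (i + 1) d₂.labels d.labels) :
    pathVal R (((crossing i h₁).comp (crossing (i + 1) h₂)).comp (crossing i h₃)) =
      pathVal R (((crossing (i + 1) k₁).comp (crossing i k₂)).comp (crossing (i + 1) k₃)) := by
  obtain ⟨l, r, a, b, hl, hc, hc₁⟩ := id h₁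
  -- The crossing at position `i + 1` requires a third block.
  rcases r with _ | ⟨e, r⟩
  · obtain ⟨l', r', a', b', hl', hc', -⟩ := id h₂
    have := congrArg List.length (hc₁.symm.trans hc')
    simp only [List.length_append, List.length_cons, List.length_nil] at this
    omega
  have lb : ∀ x, (l ++ [x]).length = i + 1 := fun x => by simp [hl]
  have sb : ∀ x, (l ++ [x]).sum = l.sum + x := fun x => by simp
  have hc₁' : c₁.labels.blocks = (l ++ [b]) ++ a :: e :: r := by simp [hc₁]
  have hc₂ : c₂.labels.blocks = l ++ b :: e :: a :: r := by simp [h₂.blocks_eq hc₁' (lb b)]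
  have hc' : c.labels.blocks = (l ++ [a]) ++ b :: e :: r := by simp [hc]
  have hd₁ : d₁.labels.blocks = l ++ a :: e :: b :: r := by simp [k₁.blocks_eq hc' (lb a)]
  have hd₂ : d₂.labels.blocks = (l ++ [e]) ++ a :: b :: r := by simp [k₂.blocks_eq hd₁ hl]
  obtain ⟨-, -, hn⟩ := blocks_facts hc'
  rw [sb] at hn
  apply pathVal_congr
  · rw [pathPerm_comp_crossing _ h₃ hc₂ hl rfl (by omega),
      pathPerm_comp_crossing _ h₂ hc₁' (lb b) (sb b) (by omega),
      pathPerm_crossing h₁ hc hl rfl (by omega),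
      pathPerm_comp_crossing _ k₃ hd₂ (lb e) (sb e) (by omega),
      pathPerm_comp_crossing _ k₂ hd₁ hl rfl (by omega),
      pathPerm_crossing k₁ hc' (lb a) (sb a) (by omega)]
    exact blockSwap_braid (by omega)
  · rw [weight_comp_crossing _ h₃ hc₂ hl, weight_comp_crossing _ h₂ hc₁' (lb b),
      weight_crossing h₁ hc hl, weight_comp_crossing _ k₃ hd₂ (lb e),
      weight_comp_crossing _ k₂ hd₁ hl, weight_crossing k₁ hc' (lb a)]
    ring

lemma pathVal_comm_of_lt {i j : ℕ} (hij : i + 1 < j) {c c₁ d₁ d : Strands n}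
    (h₁ : IsCrossing j c.labels c₁.labels) (h₂ : IsCrossing i c₁.labels d.labels)
    (k₁ : IsCrossing i c.labels d₁.labels) (k₂ : IsCrossing j d₁.labels d.labels) :
    pathVal R ((crossing j h₁).comp (crossing i h₂)) =
      pathVal R ((crossing i k₁).comp (crossing j k₂)) := by
  obtain ⟨l, r₀, a, b, hl, hc, hd₁⟩ := id k₁
  obtain ⟨l', r, a', b', hl', hc', hc₁⟩ := id h₁
  rcases List.append_eq_append_iff.1 (hc.symm.trans hc') with ⟨m, rfl, hm⟩ | ⟨m, rfl, -⟩
  · rcases m with _ | ⟨x, _ | ⟨y, m⟩⟩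
    · simp only [List.append_nil] at hl'
      omega
    · simp only [List.length_append, List.length_cons, List.length_nil] at hl'
      omega
    simp only [List.cons_append, List.cons.injEq] at hm
    obtain ⟨rfl, rfl, rfl⟩ := hm
    have hj : (l ++ b :: a :: m).length = j := by rw [← hl']; simp
    have hQ : (l ++ b :: a :: m).sum = (l ++ a :: b :: m).sum := by simp; omega
    have hP : l.sum + a + b ≤ (l ++ a :: b :: m).sum := by simp; omega
    have hd₁' : d₁.labels.blocks = (l ++ b :: a :: m) ++ a' :: b' :: r := by simp [hd₁]
    have hc₁' : c₁.labels.blocks = l ++ a :: b :: (m ++ b' :: a' :: r) := by simp [hc₁]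
    obtain ⟨-, -, hn⟩ := blocks_facts hc'
    apply pathVal_congr
    · rw [pathPerm_comp_crossing _ h₂ hc₁' hl rfl (by omega),
        pathPerm_crossing h₁ hc' hl' rfl (by omega),
        pathPerm_comp_crossing _ k₂ hd₁' hj hQ (by omega),
        pathPerm_crossing k₁ hc hl rfl (by omega)]
      exact blockSwap_comm hP (by omega)
    · rw [weight_comp_crossing _ h₂ hc₁' hl, weight_crossing h₁ hc' hl',
        weight_comp_crossing _ k₂ hd₁' hj, weight_crossing k₁ hc hl, add_comm]
  · simp only [List.length_append] at hl
    omega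

lemma pathVal_comm {i j : ℕ} (hij : i + 1 < j ∨ j + 1 < i) {c c₁ d₁ d : Strands n}
    (h₁ : IsCrossing j c.labels c₁.labels) (h₂ : IsCrossing i c₁.labels d.labels)
    (k₁ : IsCrossing i c.labels d₁.labels) (k₂ : IsCrossing j d₁.labels d.labels) :
    pathVal R ((crossing j h₁).comp (crossing i h₂)) =
      pathVal R ((crossing i k₁).comp (crossing j k₂)) := by
  rcases hij with hij | hij
  · exact pathVal_comm_of_lt hij h₁ h₂ k₁ k₂
  · exact (pathVal_comm_of_lt hij k₁ k₂ h₁ h₂).symm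

/-- The permutation is trivial while the weight is twice `a * b`, hence positive. -/
lemma pathVal_nil (i : ℕ) {c c₁ d : Strands n}
    (h₁ : IsCrossing i c.labels c₁.labels) (h₂ : IsCrossing i c₁.labels d.labels) :
    pathVal R ((crossing i h₁).comp (crossing i h₂)) = 0 := by
  obtain ⟨l, r, a, b, hl, hc, hc₁⟩ := id h₁
  obtain ⟨ha, hb, hn⟩ := blocks_facts hc
  have hab := Nat.mul_pos ha hb
  apply pathVal_of_not_reduced
  rw [ReducedPath, pathPerm_comp_crossing _ h₂ hc₁ hl rfl (by omega),
    pathPerm_crossing h₁ hc hl rfl (by omega), blockSwap_mul_blockSwap, len_one,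
    weight_comp_crossing _ h₂ hc₁ hl, weight_crossing h₁ hc hl]
  omega

lemma evalPaths_relator {c d : Strands n} {y : Quiver.Path c d →₀ R} (h : NilRelator R n c d y) :
    evalPaths R c d y = 0 := by
  cases h with
  | braid i h₁ h₂ h₃ k₁ k₂ k₃ =>
    rw [map_sub, evalPaths_single, evalPaths_single, pathVal_braid i h₁ h₂ h₃ k₁ k₂ k₃, sub_self]
  | comm i j hij h₁ h₂ k₁ k₂ =>
    rw [map_sub, evalPaths_single, evalPaths_single, pathVal_comm hij h₁ h₂ k₁ k₂, sub_self]
  | nil i h₁ h₂ => rw [evalPaths_single, pathVal_nil]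

lemma evalPaths_ideal {c d : Strands n} {y : Quiver.Path c d →₀ R}
    (h : y ∈ Presented.ideal (fun c d => {x | NilRelator R n c d x}) c d) :
    evalPaths R c d y = 0 := by
  induction h using Submodule.span_induction with
  | mem x hx =>
    obtain ⟨c', d', f, y, g, hy, rfl⟩ := hx
    rw [evalPaths_pathComp, evalPaths_pathComp, evalPaths_relator hy, map_zero,
      LinearMap.zero_apply, map_zero]
  | zero => rw [map_zero]
  | add x y _ _ hx hy => rw [map_add, hx, hy, add_zero]
  | smul r x _ hx => rw [map_smul, hx, smul_zero]

/-- Evaluation of morphisms of `NC(n)`. -/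
def evalHom (X Y : NC R n) : (X ⟶ Y) →ₗ[R]
    (Coset (subsetOf Y.vertex.labels) (subsetOf X.vertex.labels) →₀ R) :=
  (Presented.ideal (fun c d => {x | NilRelator R n c d x}) X.vertex Y.vertex).liftQ
    (evalPaths R X.vertex Y.vertex) (fun _ h => evalPaths_ideal h)

/-- The functor from `NC(n)` to the nilCoxeter algebroid. -/
def toNilCoxeter (R : Type u) [CommRing R] (n : ℕ) : NC R n ⥤ NilCoxeter R n where
  obj X := ⟨subsetOf X.vertex.labels⟩
  map {X Y} f := evalHom X Y f
  map_id X := by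
    change evalPaths R X.vertex X.vertex (Finsupp.single Quiver.Path.nil 1) = _
    rw [evalPaths_single]
    exact pathVal_of_reduced (p := Quiver.Path.nil) len_one
  map_comp {X Y Z} f g := by
    obtain ⟨f, rfl⟩ := Presented.toHom_surjective X Y f
    obtain ⟨g, rfl⟩ := Presented.toHom_surjective Y Z g
    change evalHom X Z (Presented.homComp X Y Z _ _) = nilComp R _ _ _ _ _
    rw [Presented.homComp_toHom]
    exact evalPaths_pathComp f g

lemma toNilCoxeter_pathClass {c d : Strands n} (p : Quiver.Path c d) :
    (toNilCoxeter R n).map (pathClass R p) = pathVal R p :=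
  evalPaths_single p

/-! ### Faithfulness: a linear left inverse -/

open Classical in
/-- The class of a reduced path mapping to the given coset, if there is one. -/
def classOfCoset (R : Type u) [CommRing R] (c d : Strands n)
    (q : Coset (subsetOf d.labels) (subsetOf c.labels)) : (⟨c⟩ : NC R n) ⟶ ⟨d⟩ :=
  if h : ∃ p : Quiver.Path c d, ReducedPath p ∧ Coset.mk _ _ (pathPerm p) = q then
    pathClass R h.choose else 0

/-- The coset determines the block permutation, and the word property makes the chosen reduced path
irrelevant. For a path that is not reduced both sides vanish. -/
lemma linearCombination_classOfCoset {c d : Strands n} (p : Quiver.Path c d) :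
    Finsupp.linearCombination R (classOfCoset R c d) (pathVal R p) = pathClass R p := by
  by_cases hp : ReducedPath p
  · rw [pathVal_of_reduced hp, Finsupp.linearCombination_single, one_smul]
    have h : ∃ p' : Quiver.Path c d, ReducedPath p' ∧
      Coset.mk (subsetOf d.labels) (subsetOf c.labels) (pathPerm p') = Coset.mk _ _ (pathPerm p) :=
        ⟨p, hp, rfl⟩
    rw [classOfCoset, dif_pos h]
    exact pathClass_eq h.choose_spec.1 hp
      ((matches_pathPerm _).eq_of_mk_eq (matches_pathPerm p) h.choose_spec.2)
  · rw [pathVal_of_not_reduced hp, map_zero, pathClass_eq_zero hp]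

lemma linearCombination_evalPaths {c d : Strands n} (f : Quiver.Path c d →₀ R) :
    Finsupp.linearCombination R (classOfCoset R c d) (evalPaths R c d f) =
      Presented.toHom (⟨c⟩ : NC R n) ⟨d⟩ f := by
  induction f using Finsupp.induction_linear with
  | zero => simp
  | add f₁ f₂ h₁ h₂ => rw [map_add, map_add, map_add, h₁, h₂]
  | single p r =>
    rw [← mul_one r, ← smul_eq_mul, ← Finsupp.smul_single, map_smul, map_smul, map_smul,
      evalPaths_single, linearCombination_classOfCoset]
    rfl

lemma toNilCoxeter_injective (X Y : NC R n) :
    Function.Injective fun f : X ⟶ Y => (toNilCoxeter R n).map f := by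
  intro f g h
  obtain ⟨f, rfl⟩ := Presented.toHom_surjective X Y f
  obtain ⟨g, rfl⟩ := Presented.toHom_surjective X Y g
  have h' : evalPaths R X.vertex Y.vertex f = evalPaths R X.vertex Y.vertex g := h
  have := congrArg (Finsupp.linearCombination R (classOfCoset R X.vertex Y.vertex)) h'
  rwa [linearCombination_evalPaths, linearCombination_evalPaths] at this

/-! ### Atomic cosets -/

lemma reducedPath_crossing {c d : Strands n} {i : ℕ} (h : IsCrossing i c.labels d.labels) :
    ReducedPath (crossing i h) := by
  change len (crossPerm c.labels i * 1) = 0 + len (crossPerm c.labels i)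
  rw [mul_one, zero_add]

lemma pathVal_crossing {c d : Strands n} {l r : List ℕ} {a b : ℕ} {s : Fin (n - 1)}
    (hc : c.labels.blocks = l ++ a :: b :: r) (hs : (s : ℕ) + 1 = l.sum + a)
    (h : IsCrossing l.length c.labels d.labels) :
    pathVal R (crossing l.length h) =
      Finsupp.single (Coset.mk _ _ (longest (insert s (subsetOf c.labels)))) 1 := by
  obtain ⟨ha, hb, hn⟩ := blocks_facts hc
  rw [pathVal_of_reduced (reducedPath_crossing h),
    mk_longest_insert hc hs (by omega), ← crossPerm_eq hc rfl rfl]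
  change Finsupp.single (Coset.mk _ _ (crossPerm c.labels _ * 1)) 1 = _
  rw [mul_one]

lemma isAtomic_crossing {c d : Composition n} {l r : List ℕ} {a b : ℕ} {s : Fin (n - 1)}
    (hc : c.blocks = l ++ a :: b :: r) (hd : d.blocks = l ++ b :: a :: r)
    (hs : (s : ℕ) + 1 = l.sum + a) :
    (Coset.mk (subsetOf d) (subsetOf c) (longest (insert s (subsetOf c)))).IsAtomic := by
  obtain ⟨ha, hb, hn⟩ := blocks_facts hc
  obtain ⟨t, ht⟩ : ∃ t : Fin (n - 1), (t : ℕ) + 1 = l.sum + b :=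
    ⟨⟨l.sum + b - 1, by omega⟩, by simp only; omega⟩
  -- In `IsAtomic` the first reflection is removed on the target side and the second on the source
  -- side, so the new wall `t` comes first and the old wall `s` second.
  refine ⟨insert s (subsetOf c), t, s, ?_, Finset.mem_insert_self _ _,
    eq_longest_conj (simple_eq_longest_conj hc hs ht), subsetOf_swapped hc hd hs ht, ?_, rfl⟩
  · rw [Finset.mem_insert, or_iff_not_imp_left, mem_subsetOf, hc, isCut_append_cons_cons]
    rintro hne (h | h | h)
    · have := h.le
      omega
    · exact hne (Fin.ext (by omega))
    · omega
  · rw [Finset.erase_insert]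
    rw [mem_subsetOf, not_not, hc, isCut_append_cons_cons]
    exact Or.inr (Or.inl hs)

/-- Every atomic coset comes from a crossing. -/
lemma exists_crossing_of_isAtomic {c d : Strands n}
    {p : Coset (subsetOf d.labels) (subsetOf c.labels)} (hp : p.IsAtomic) :
    ∃ (i : ℕ) (h : IsCrossing i c.labels d.labels),
      pathVal R (crossing i h) = Finsupp.single p 1 := by
  obtain ⟨M, s, t, hs, ht, hst, hI, hJ, rfl⟩ := hp
  have hM : M = insert t (subsetOf c.labels) := by rw [hJ, Finset.insert_erase ht]
  obtain ⟨l, r, a, b, hc, hta⟩ := exists_split (c := c.labels) (i := t) (by rw [hJ]; simp)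
  obtain ⟨ha, hb, hn⟩ := blocks_facts hc
  obtain ⟨d', hd'⟩ := exists_swapped hc
  obtain ⟨s', hs'⟩ : ∃ s' : Fin (n - 1), (s' : ℕ) + 1 = l.sum + b :=
    ⟨⟨l.sum + b - 1, by omega⟩, by simp only; omega⟩
  -- Both `s` and the computed wall `s'` are conjugate to `t` by `w_M`, hence equal. The target is
  -- then forced to be the swapped composition.
  have h1 := simple_eq_longest_conj hc hta hs'
  rw [← hM, ← eq_longest_conj hst] at h1
  obtain rfl := simple_injective h1
  have h2 := subsetOf_swapped hc hd' hta hs'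
  rw [← hM, ← hI] at h2
  have hd : d'.blocks = d.labels.blocks := congrArg Composition.blocks (subsetOf_injective h2)
  rw [hd] at hd'
  have h : IsCrossing l.length c.labels d.labels := ⟨l, r, a, b, rfl, hc, hd'⟩
  exact ⟨_, h, by rw [pathVal_crossing hc hta h, hM]⟩

/-! ### The isomorphism with the atomic subcategory -/

instance : (toNilCoxeter R n).Additive where
  map_add {X Y f g} := (evalHom X Y).map_add f g

instance : (toNilCoxeter R n).Linear R where
  map_smul {X Y} f r := (evalHom X Y).map_smul r f

lemma pathClass_mem {c d : Strands n} (p : Quiver.Path c d) :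
    GeneratedSubcategory.Mem R (atomicMorphisms R n)
      ((toNilCoxeter R n).map (pathClass R p)) := by
  induction p with
  | nil =>
    change GeneratedSubcategory.Mem R _ ((toNilCoxeter R n).map (𝟙 (⟨c⟩ : NC R n)))
    rw [CategoryTheory.Functor.map_id]
    exact .id _
  | @cons z d p e ih =>
    obtain ⟨i, h⟩ := e
    change GeneratedSubcategory.Mem R _
      ((toNilCoxeter R n).map (pathClass R (p.comp (crossing i h))))
    rw [pathClass_comp, Functor.map_comp]
    refine .comp _ _ ih (.of _ ?_)
    obtain ⟨l, r, a, b, rfl, hz, hd⟩ := id h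
    obtain ⟨_, hs⟩ := outer_subsetOf hz
    exact ⟨_, isAtomic_crossing hz hd hs,
      (toNilCoxeter_pathClass _).trans (pathVal_crossing hz hs h)⟩

lemma toNilCoxeter_mem {X Y : NC R n} (f : X ⟶ Y) :
    GeneratedSubcategory.Mem R (atomicMorphisms R n) ((toNilCoxeter R n).map f) := by
  obtain ⟨f, rfl⟩ := Presented.toHom_surjective X Y f
  induction f using Finsupp.induction_linear with
  | zero =>
    have : Presented.toHom X Y 0 = (0 : X ⟶ Y) := map_zero _
    rw [this, Functor.map_zero]
    exact .zero _ _
  | add f g hf hg =>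
    have : Presented.toHom X Y (f + g) =
      (Presented.toHom X Y f + Presented.toHom X Y g : X ⟶ Y) := map_add _ _ _
    rw [this, Functor.map_add]
    exact .add _ _ hf hg
  | single p r =>
    have : Presented.toHom X Y (Finsupp.single p r) = (r • pathClass R p : X ⟶ Y) := by
      rw [← mul_one r, ← smul_eq_mul, ← Finsupp.smul_single, map_smul, smul_eq_mul, mul_one]
      rfl
    rw [this, Functor.map_smul]
    exact .smul _ _ (pathClass_mem p)

/-- The functor from `NC(n)` to the atomic subcategory of the nilCoxeter algebroid. -/
def toAD (R : Type u) [CommRing R] (n : ℕ) : NC R n ⥤ AD R n where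
  obj X := ⟨(toNilCoxeter R n).obj X⟩
  map f := ⟨(toNilCoxeter R n).map f, toNilCoxeter_mem f⟩
  map_id X := Subtype.ext ((toNilCoxeter R n).map_id X)
  map_comp f g := Subtype.ext ((toNilCoxeter R n).map_comp f g)

lemma toNilCoxeter_obj_bijective : Function.Bijective (toNilCoxeter R n).obj := by
  constructor
  · rintro ⟨⟨c⟩⟩ ⟨⟨d⟩⟩ h
    exact congrArg (NC.of R) (subsetOf_injective (congrArg NilCoxeter.subset h))
  · rintro ⟨J⟩
    obtain ⟨c, rfl⟩ := subsetOf_bijective.2 J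
    exact ⟨NC.of R c, rfl⟩

/-- Induction on membership requires the endpoints to vary, hence the transports along equalities of
objects. For a composite, the intermediate object is lifted by surjectivity on objects. -/
lemma exists_preimage {A B : NilCoxeter R n} {f : A ⟶ B}
    (hf : GeneratedSubcategory.Mem R (atomicMorphisms R n) f) :
    ∀ {X Y : NC R n} (hX : (toNilCoxeter R n).obj X = A) (hY : (toNilCoxeter R n).obj Y = B),
      ∃ g : X ⟶ Y, (toNilCoxeter R n).map g = eqToHom hX ≫ f ≫ eqToHom hY.symm := by
  induction hf with
  | of f h =>
    rintro X Y rfl rfl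
    obtain ⟨p, hp, rfl⟩ := h
    obtain ⟨i, h, e⟩ := exists_crossing_of_isAtomic (R := R) (c := X.vertex) (d := Y.vertex) hp
    refine ⟨pathClass R (crossing i h), ?_⟩
    rw [toNilCoxeter_pathClass, eqToHom_refl, eqToHom_refl, Category.id_comp, Category.comp_id]
    exact e
  | id A =>
    rintro X Y rfl hY
    obtain rfl := toNilCoxeter_obj_bijective.1 hY
    exact ⟨𝟙 _, by simp⟩
  | @comp A B C f g _ _ hf hg =>
    intro X Z hX hZ
    obtain ⟨Y, hY⟩ := toNilCoxeter_obj_bijective.2 B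
    obtain ⟨f', hf'⟩ := hf hX hY
    obtain ⟨g', hg'⟩ := hg hY hZ
    exact ⟨f' ≫ g', by simp [hf', hg']⟩
  | zero A B => exact fun _ _ => ⟨0, by simp⟩
  | add f g _ _ hf hg =>
    intro X Y hX hY
    obtain ⟨f', hf'⟩ := hf hX hY
    obtain ⟨g', hg'⟩ := hg hX hY
    exact ⟨f' + g', by simp [hf', hg', Functor.map_add]⟩
  | smul r f _ hf =>
    intro X Y hX hY
    obtain ⟨f', hf'⟩ := hf hX hY
    exact ⟨r • f', by simp [hf', Functor.map_smul]⟩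

lemma toAD_map_bijective (X Y : NC R n) :
    Function.Bijective fun f : X ⟶ Y => (toAD R n).map f := by
  constructor
  · intro f g h
    exact toNilCoxeter_injective X Y (congrArg Subtype.val h)
  · rintro ⟨f, hf⟩
    obtain ⟨g, hg⟩ := exists_preimage hf (X := X) (Y := Y) rfl rfl
    exact ⟨g, Subtype.ext (hg.trans ((Category.id_comp _).trans (Category.comp_id _)))⟩

/-- The target of a crossing and the set defining the atomic target are equal but not definitionally
so. Bundling morphisms as arrows allows the comparison. -/
lemma arrow_del_congr {I I' J : Finset (Fin (n - 1))} (h : I = I') (w : Equiv.Perm (Fin n)) :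
    Arrow.mk (NilCoxeter.del R (Coset.mk I J w)) = Arrow.mk (NilCoxeter.del R (Coset.mk I' J w)) := by
  subst h
  rfl

end

end TypeA

theorem mainTheorem6 (R : Type u) [CommRing R] (n : ℕ) :
    ∃ ψ : TypeA.NC R n ⥤ TypeA.AD R n,
      ψ.Additive ∧ ψ.Linear R ∧
      Function.Bijective ψ.obj ∧
      (∀ X Y : TypeA.NC R n,
        Function.Bijective (fun f : X ⟶ Y => (ψ.map f : ψ.obj X ⟶ ψ.obj Y))) ∧
      (∀ c : Composition n, (ψ.obj (TypeA.NC.of R c)).obj.subset = TypeA.subsetOf c) ∧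
      ∀ (c d : Composition n) (i : ℕ) (h : TypeA.IsCrossing i c d),
        ∃ hi : i < (TypeA.subsetOf c)ᶜ.card,
          Arrow.mk ((GeneratedSubcategory.incl R (TypeA.atomicMorphisms R n)).map
              (ψ.map (TypeA.NC.del R i h))) =
            Arrow.mk (TypeA.NilCoxeter.del R (TypeA.atomicCoset (TypeA.subsetOf c) ⟨i, hi⟩)) := by
  refine ⟨TypeA.toAD R n, ⟨fun {X Y f g} => Subtype.ext ((TypeA.toNilCoxeter R n).map_add)⟩,
    ⟨fun f r => Subtype.ext ((TypeA.toNilCoxeter R n).map_smul r f)⟩, ?_,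
    TypeA.toAD_map_bijective, fun _ => rfl, ?_⟩
  · constructor
    · intro X Y h
      exact TypeA.toNilCoxeter_obj_bijective.1 (congrArg GeneratedSubcategory.obj h)
    · rintro ⟨A⟩
      obtain ⟨X, hX⟩ := TypeA.toNilCoxeter_obj_bijective.2 A
      exact ⟨X, congrArg GeneratedSubcategory.mk hX⟩
  · intro c d i h
    obtain ⟨l, r, a, b, rfl, hc, hd⟩ := id h
    obtain ⟨hi, hs⟩ := TypeA.outer_subsetOf hc
    refine ⟨hi, ?_⟩
    have e : (TypeA.toNilCoxeter R n).map (TypeA.NC.del R l.length h) =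
        TypeA.NilCoxeter.del R (TypeA.Coset.mk _ _ (TypeA.longest (insert
          (TypeA.outer (TypeA.subsetOf c) ⟨l.length, hi⟩) (TypeA.subsetOf c)))) :=
      (TypeA.toNilCoxeter_pathClass (TypeA.crossing (c := ⟨c⟩) (d := ⟨d⟩) _ h)).trans
        (TypeA.pathVal_crossing (c := ⟨c⟩) (d := ⟨d⟩) hc hs h)
    exact (congrArg Arrow.mk e).trans
      (TypeA.arrow_del_congr (TypeA.atomicTarget_subsetOf hc hd hi).symm _)
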